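/- \textbf{Setting.} We are given $n$ objects, and a function $d(s,t)$ on pairs of objects with values in a totally ordered set; no symmetry, triangle inequality or other law is assumed. A \emph{cluster} is either a single object or is formed by merging two clusters. \emph{Bottom-up hierarchical clustering} for a cluster distance $\delta(A,B)$ starts with the $n$ single-object clusters and, $n-1$ times, replaces two distinct current clusters $A,B$ for which $\delta(A,B)$ is minimum among all pairs of distinct current clusters (ties broken arbitrarily) by their merger; the output is the sequence of mergers. The machine is a random access machine that stores an object, a distance, or an integer of $O(\log n)$ bits in one memory cell, and evaluates $d$, compares two distances, and performs an arithmetic operation or memory access in unit time. Programs and constants below do not depend on the objects, on the distances, or on $n$. \textbf{Theorem.} (1) Suppose that for single objects $\delta$ is given by $d$, and that, whenever a cluster $A\cup B$ is formed from $A$ and $B$ while $C$ is another current cluster, $\delta(A\cup B,C)$ and $\delta(C,A\cup B)$ are given by formulas, evaluated in unit time, in the distances (in both directions) between the clusters $A,B,C$ and the sizes $|A|,|B|,|C|$. Then bottom-up hierarchical clustering for $\delta$ can be performed in total time $O(n^2)$ (using $O(n^2)$ space). (2) Suppose that each cluster is represented by an object, the object representing a merged cluster being computed in unit time from the objects representing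 its two parts, and that $\delta(A,B)$ is the value of $d$ on the objects representing $A$ and $B$. Then bottom-up hierarchical clustering for $\delta$ can be performed in time $O(n^2\log^2 n)$ and space $O(n)$. In particular this holds for $n$ points of a real inner product space, with vector operations and distances taking unit time, and the following methods: the \emph{median} method (a single point is its own median, the median of a merged cluster is the midpoint of the medians of its two parts, and $\delta$ is the distance between medians); the \emph{centroid} method ($\delta$ is the distance between the centroids of the clusters); and \emph{Ward's} method ($\delta(A,B)=\mathrm{SS}(A\cup B)-\mathrm{SS}(A)-\mathrm{SS}(B)$, where $\mathrm{SS}$ is the sum of squared distances of the points of a cluster to its centroid). -/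

import Mathlib

universe u v w

namespace Agglomerative

/-! ## Model of computation

A random access machine with three memories: one for machine words (natural numbers bounded by
`W`), one for objects, and one for distances.  Objects and distances are atomic: a cell holds one
of them, and they are accessible only through the unit-cost primitive operations `Ops`, through
copying, and through comparison of two distances.  Programs are structured (while) programs. -/

/-- The primitive operations on objects and distances, each of which takes constant time:
* `dist s t` is the distance between two objects (no symmetry or other law is required);
* `join s t` is the object that represents the merger of the clusters represented by `s`, `t`;
* `updL`, `updR` are formulas giving the distances `d(A ∪ B, C)` and `d(C, A ∪ B)` from the sizes
  `![|A|, |B|, |C|]` and from the distances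
  `![d(A,B), d(B,A), d(A,C), d(C,A), d(B,C), d(C,B)]`. -/
structure Ops (Ob : Type u) (D : Type v) where
  dist : Ob → Ob → D
  join : Ob → Ob → Ob
  updL : (Fin 3 → ℕ) → (Fin 6 → D) → D
  updR : (Fin 3 → ℕ) → (Fin 6 → D) → D

/-- Word-valued expressions.  Registers are named by literals in the program text, so a program
uses only a fixed number of them. -/
inductive Expr : Type
  | lit (k : ℕ)
  | reg (r : ℕ)
  | mem (a : Expr)
  | add (e f : Expr)
  | sub (e f : Expr)
  | mul (e f : Expr)
  | div (e f : Expr)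

/-- Tests: comparisons of two words, or of the distances stored in two cells. -/
inductive Test : Type
  | lt (e f : Expr)
  | eq (e f : Expr)
  | leDist (a b : Expr)

/-- Programs.  Arguments named `a`, `b`, `b'`, `s i`, `d i` are word-valued expressions; for the
operations on objects and distances `a` is the address of the target cell. -/
inductive Cmd : Type
  | skip
  | setReg (r : ℕ) (e : Expr)
  | store (a e : Expr)
  | copyObj (a b : Expr)
  | joinObj (a b b' : Expr)
  | copyDist (a b : Expr)
  | evalDist (a b b' : Expr)
  | updateL (a : Expr) (s : Fin 3 → Expr) (d : Fin 6 → Expr)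
  | updateR (a : Expr) (s : Fin 3 → Expr) (d : Fin 6 → Expr)
  | seq (P Q : Cmd)
  | ite (t : Test) (P Q : Cmd)
  | while (t : Test) (P : Cmd)

/-- Machine states; `none` marks a cell that has not been initialized. -/
structure State (Ob : Type u) (D : Type v) where
  reg : ℕ → ℕ
  mem : ℕ → ℕ
  obj : ℕ → Option Ob
  dst : ℕ → Option D

section Semantics

variable {Ob : Type u} {D : Type v}

/-- `v`, provided that it fits in a machine word. -/
def word (W v : ℕ) : Option ℕ := if v ≤ W then some v else none

/-- Value of an expression on a machine with word bound `W` and memory cells `0, …, S - 1`; it is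
`none` if some intermediate value exceeds `W` or an address is not below `S`. -/
def Expr.eval (W S : ℕ) (σ : State Ob D) : Expr → Option ℕ
  | .lit k => word W k
  | .reg r => word W (σ.reg r)
  | .mem a => (a.eval W S σ).bind fun i => if i < S then word W (σ.mem i) else none
  | .add e f => (e.eval W S σ).bind fun i => (f.eval W S σ).bind fun j => word W (i + j)
  | .sub e f => (e.eval W S σ).bind fun i => (f.eval W S σ).bind fun j => word W (i - j)
  | .mul e f => (e.eval W S σ).bind fun i => (f.eval W S σ).bind fun j => word W (i * j)
  | .div e f => (e.eval W S σ).bind fun i => (f.eval W S σ).bind fun j => word W (i / j)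

/-- The time to evaluate an expression is the number of its operations and operands. -/
def Expr.cost : Expr → ℕ
  | .lit _ => 1
  | .reg _ => 1
  | .mem a => a.cost + 1
  | .add e f => e.cost + f.cost + 1
  | .sub e f => e.cost + f.cost + 1
  | .mul e f => e.cost + f.cost + 1
  | .div e f => e.cost + f.cost + 1

/-- The address denoted by `a`, provided that it lies in the memory. -/
def Expr.addr (W S : ℕ) (σ : State Ob D) (a : Expr) : Option ℕ :=
  (a.eval W S σ).bind fun i => if i < S then some i else none

/-- The object stored at the address denoted by `a`. -/
def State.readObj (W S : ℕ) (σ : State Ob D) (a : Expr) : Option Ob :=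
  (a.addr W S σ).bind σ.obj

/-- The distance stored at the address denoted by `a`. -/
def State.readDist (W S : ℕ) (σ : State Ob D) (a : Expr) : Option D :=
  (a.addr W S σ).bind σ.dst

def Test.eval [LinearOrder D] (W S : ℕ) (σ : State Ob D) : Test → Option Bool
  | .lt e f => (e.eval W S σ).bind fun i => (f.eval W S σ).bind fun j => some (decide (i < j))
  | .eq e f => (e.eval W S σ).bind fun i => (f.eval W S σ).bind fun j => some (decide (i = j))
  | .leDist a b =>
      (σ.readDist W S a).bind fun x => (σ.readDist W S b).bind fun y => some (decide (x ≤ y))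

def Test.cost : Test → ℕ
  | .lt e f => e.cost + f.cost + 1
  | .eq e f => e.cost + f.cost + 1
  | .leDist a b => a.cost + b.cost + 1

def State.setReg (σ : State Ob D) (r v : ℕ) : State Ob D :=
  { σ with reg := Function.update σ.reg r v }

def State.setMem (σ : State Ob D) (i v : ℕ) : State Ob D :=
  { σ with mem := Function.update σ.mem i v }

def State.setObj (σ : State Ob D) (i : ℕ) (o : Ob) : State Ob D :=
  { σ with obj := Function.update σ.obj i (some o) }

def State.setDist (σ : State Ob D) (i : ℕ) (x : D) : State Ob D :=
  { σ with dst := Function.update σ.dst i (some x) }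

/-- `Exec ops W S P σ σ' t`: on a machine with words bounded by `W` and with `S` cells in each of
its memories, the program `P` started in state `σ` halts in state `σ'` after `t` time units.
Overflow of a word, an address outside the memory, or a read of an uninitialized object or
distance cell blocks the execution. -/
inductive Exec [LinearOrder D] (ops : Ops Ob D) (W S : ℕ) :
    Cmd → State Ob D → State Ob D → ℕ → Prop
  | skip {σ : State Ob D} : Exec ops W S .skip σ σ 1
  | setReg {σ : State Ob D} {r : ℕ} {e : Expr} {v : ℕ} :
      e.eval W S σ = some v →
      Exec ops W S (.setReg r e) σ (σ.setReg r v) (e.cost + 1)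
  | store {σ : State Ob D} {a e : Expr} {i v : ℕ} :
      a.addr W S σ = some i → e.eval W S σ = some v →
      Exec ops W S (.store a e) σ (σ.setMem i v) (a.cost + e.cost + 1)
  | copyObj {σ : State Ob D} {a b : Expr} {i : ℕ} {o : Ob} :
      a.addr W S σ = some i → σ.readObj W S b = some o →
      Exec ops W S (.copyObj a b) σ (σ.setObj i o) (a.cost + b.cost + 1)
  | joinObj {σ : State Ob D} {a b b' : Expr} {i : ℕ} {o o' : Ob} :
      a.addr W S σ = some i → σ.readObj W S b = some o → σ.readObj W S b' = some o' →
      Exec ops W S (.joinObj a b b') σ (σ.setObj i (ops.join o o'))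
        (a.cost + b.cost + b'.cost + 1)
  | copyDist {σ : State Ob D} {a b : Expr} {i : ℕ} {x : D} :
      a.addr W S σ = some i → σ.readDist W S b = some x →
      Exec ops W S (.copyDist a b) σ (σ.setDist i x) (a.cost + b.cost + 1)
  | evalDist {σ : State Ob D} {a b b' : Expr} {i : ℕ} {o o' : Ob} :
      a.addr W S σ = some i → σ.readObj W S b = some o → σ.readObj W S b' = some o' →
      Exec ops W S (.evalDist a b b') σ (σ.setDist i (ops.dist o o'))
        (a.cost + b.cost + b'.cost + 1)
  | updateL {σ : State Ob D} {a : Expr} {s : Fin 3 → Expr} {d : Fin 6 → Expr} {i : ℕ}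
      {z : Fin 3 → ℕ} {x : Fin 6 → D} :
      a.addr W S σ = some i → (∀ j, (s j).eval W S σ = some (z j)) →
      (∀ j, σ.readDist W S (d j) = some (x j)) →
      Exec ops W S (.updateL a s d) σ (σ.setDist i (ops.updL z x))
        (a.cost + ∑ j, (s j).cost + ∑ j, (d j).cost + 1)
  | updateR {σ : State Ob D} {a : Expr} {s : Fin 3 → Expr} {d : Fin 6 → Expr} {i : ℕ}
      {z : Fin 3 → ℕ} {x : Fin 6 → D} :
      a.addr W S σ = some i → (∀ j, (s j).eval W S σ = some (z j)) →
      (∀ j, σ.readDist W S (d j) = some (x j)) →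
      Exec ops W S (.updateR a s d) σ (σ.setDist i (ops.updR z x))
        (a.cost + ∑ j, (s j).cost + ∑ j, (d j).cost + 1)
  | seq {σ σ' σ'' : State Ob D} {P Q : Cmd} {t t' : ℕ} :
      Exec ops W S P σ σ' t → Exec ops W S Q σ' σ'' t' →
      Exec ops W S (.seq P Q) σ σ'' (t + t')
  | iteTrue {σ σ' : State Ob D} {b : Test} {P Q : Cmd} {t : ℕ} :
      b.eval W S σ = some true → Exec ops W S P σ σ' t →
      Exec ops W S (.ite b P Q) σ σ' (b.cost + t)
  | iteFalse {σ σ' : State Ob D} {b : Test} {P Q : Cmd} {t : ℕ} :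
      b.eval W S σ = some false → Exec ops W S Q σ σ' t →
      Exec ops W S (.ite b P Q) σ σ' (b.cost + t)
  | whileFalse {σ : State Ob D} {b : Test} {P : Cmd} :
      b.eval W S σ = some false → Exec ops W S (.while b P) σ σ b.cost
  | whileTrue {σ σ' σ'' : State Ob D} {b : Test} {P : Cmd} {t t' : ℕ} :
      b.eval W S σ = some true → Exec ops W S P σ σ' t →
      Exec ops W S (.while b P) σ' σ'' t' →
      Exec ops W S (.while b P) σ σ'' (b.cost + t + t')

/-- The input: register `0` holds `n`, the first `n` object cells hold the objects, the words are
zero, and nothing else is initialized. -/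
def initState {n : ℕ} (x : Fin n → Ob) : State Ob D where
  reg := fun r => if r = 0 then n else 0
  mem := fun _ => 0
  obj := fun i => if h : i < n then some (x ⟨i, h⟩) else none
  dst := fun _ => none

end Semantics

/-! ## Hierarchical clusters and agglomerative clustering -/

/-- Hierarchical clusters: `leaf i` consists of the `i`-th object alone, and `node k A B` was
formed in step `k` by merging `A` and `B`. -/
inductive Cluster (n : ℕ) : Type
  | leaf (i : Fin n)
  | node (k : ℕ) (A B : Cluster n)

namespace Cluster

variable {n : ℕ}

/-- The set of objects in a cluster. -/
def members : Cluster n → Finset (Fin n)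
  | leaf i => {i}
  | node _ A B => A.members ∪ B.members

/-- The cluster is present when step `k` begins. -/
def FormedBefore : Cluster n → ℕ → Prop
  | leaf _, _ => True
  | node j _ _, k => j < k

/-- The object representing a cluster, when mergers are represented by means of `join`. -/
def rep {Ob : Type u} (join : Ob → Ob → Ob) (x : Fin n → Ob) : Cluster n → Ob
  | leaf i => x i
  | node _ A B => join (A.rep join x) (B.rep join x)

end Cluster

section Clustering

variable {Ob : Type u} {D : Type v} {n : ℕ}

/-- The clusters present after `k` steps, by label.  The one-object clusters have the labels
`0, …, n - 1`; step `k` merges the clusters labelled `(m k).1` and `(m k).2` into a new cluster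
labelled `n + k`, and removes these two. -/
def forest (n : ℕ) (m : ℕ → ℕ × ℕ) : ℕ → ℕ → Option (Cluster n)
  | 0 => fun l => if h : l < n then some (.leaf ⟨l, h⟩) else none
  | k + 1 => fun l =>
      if l = n + k then
        (forest n m k (m k).1).bind fun A => (forest n m k (m k).2).bind fun B =>
          some (.node k A B)
      else if l = (m k).1 ∨ l = (m k).2 then none
      else forest n m k l

/-- The mergers `m 0, …, m (n - 2)` perform bottom-up clustering for the cluster distance `δ`: each
of them merges two different clusters that are a closest pair among the clusters present. -/
def IsAgglomeration [LinearOrder D] (δ : Cluster n → Cluster n → D) (m : ℕ → ℕ × ℕ) : Prop :=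
  ∀ k, k + 1 < n →
    (m k).1 ≠ (m k).2 ∧
    ∃ A B, forest n m k (m k).1 = some A ∧ forest n m k (m k).2 = some B ∧
      ∀ i j X Y, i ≠ j → forest n m k i = some X → forest n m k j = some Y → δ A B ≤ δ X Y

/-- Started on the `n` objects `x`, with words bounded by `W` and `S` cells in each memory, the
program `P` halts within time `T`, and leaves in the cells `0, …, 2 (n - 1) - 1` of the word memory
the successive mergers of a bottom-up clustering for the cluster distance `δ`. -/
def Performs [LinearOrder D] (P : Cmd) (ops : Ops Ob D) (x : Fin n → Ob)
    (δ : Cluster n → Cluster n → D) (W S T : ℕ) : Prop :=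
  ∃ (σ : State Ob D) (t : ℕ), Exec ops W S P (initState x) σ t ∧ t ≤ T ∧ 2 * (n - 1) ≤ S ∧
    IsAgglomeration δ fun k => (σ.mem (2 * k), σ.mem (2 * k + 1))

/-- The cluster distance `δ` is computed by the primitive operations `ops`: for one-object
clusters by `dist`, and between a cluster newly formed from `A` and `B` and a cluster `C` present
at that time by the formulas `updL` and `updR`, from the sizes of `A`, `B`, `C` and the distances
between them. -/
structure ComputedFromSubclusters (ops : Ops Ob D) (x : Fin n → Ob)
    (δ : Cluster n → Cluster n → D) : Prop where
  base : ∀ i j, i ≠ j → δ (.leaf i) (.leaf j) = ops.dist (x i) (x j)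
  left : ∀ k A B C, A.FormedBefore k → B.FormedBefore k → C.FormedBefore k →
    Disjoint A.members B.members → Disjoint A.members C.members →
    Disjoint B.members C.members →
    δ (.node k A B) C = ops.updL ![A.members.card, B.members.card, C.members.card]
      ![δ A B, δ B A, δ A C, δ C A, δ B C, δ C B]
  right : ∀ k A B C, A.FormedBefore k → B.FormedBefore k → C.FormedBefore k →
    Disjoint A.members B.members → Disjoint A.members C.members →
    Disjoint B.members C.members →
    δ C (.node k A B) = ops.updR ![A.members.card, B.members.card, C.members.card]
      ![δ A B, δ B A, δ A C, δ C A, δ B C, δ C B]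

/-- The distance between clusters is the distance between their representative objects. -/
def repDist (ops : Ops Ob D) (x : Fin n → Ob) (A B : Cluster n) : D :=
  ops.dist (A.rep ops.join x) (B.rep ops.join x)

end Clustering

/-! ## The median, centroid and Ward methods -/

noncomputable section Methods

variable {E : Type w} [NormedAddCommGroup E] [InnerProductSpace ℝ E] {n : ℕ}

/-- Median method: the median of a merged cluster is the midpoint of the two medians. -/
def medianDist (p : Fin n → E) (A B : Cluster n) : ℝ :=
  dist (A.rep (midpoint ℝ) p) (B.rep (midpoint ℝ) p)

/-- The centroid of a set of points. -/
def centroid (p : Fin n → E) (s : Finset (Fin n)) : E :=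
  (s.card : ℝ)⁻¹ • ∑ i ∈ s, p i

/-- Centroid method: the distance between the centroids. -/
def centroidDist (p : Fin n → E) (A B : Cluster n) : ℝ :=
  dist (centroid p A.members) (centroid p B.members)

/-- The sum of the squared distances of the points of a set to their centroid. -/
def sumSq (p : Fin n → E) (s : Finset (Fin n)) : ℝ :=
  ∑ i ∈ s, dist (p i) (centroid p s) ^ 2

/-- Ward's method: the increase of the sum of squares that merging the two clusters causes. -/
def wardDist (p : Fin n → E) (A B : Cluster n) : ℝ :=
  sumSq p (A.members ∪ B.members) - sumSq p A.members - sumSq p B.members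

/-- Merger of clusters represented by their centroid and their size. -/
def weightedJoin (a b : E × ℕ) : E × ℕ :=
  (((a.2 : ℝ) + b.2)⁻¹ • ((a.2 : ℝ) • a.1 + (b.2 : ℝ) • b.1), a.2 + b.2)

/-- Ward's distance in terms of the centroids and sizes of the clusters. -/
def wardOp (a b : E × ℕ) : ℝ :=
  (a.2 : ℝ) * b.2 / (a.2 + b.2) * dist a.1 b.1 ^ 2

end Methods

end Agglomerative

/-! Both algorithms are explicit while programs. A small program logic reduces a loop-free block to
a weakest precondition (`Runs.of_wp`) and handles loops by invariants that carry a time bound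
(`Runs.while_fuel`, `Runs.while_sum`). Clusters live in fixed slots: merging the clusters of slots
`a` and `b` puts the new cluster into `a` and empties `b` (`Slots.merge`). Hence a program is
correct as soon as each merger joins a closest pair of slots (`AgglomerationPrefix.succ`).

Part (1) keeps the distance matrix, padded to a side `2 ^ H` with `n ≤ 2 ^ H < 2 * n`, as the leaves
of a quadtree in which every node stores the address of a smallest entry below it. The root thus
gives a closest pair. A merger changes only the rows and columns of two slots. At height `h` there
are `O(2 ^ (H - h))` nodes above such a row and column, so repairing the tree costs a geometric sum
`O(n)` (`runs_repair`), and the `n` insertions and `n - 1` mergers cost `O(n ^ 2)` together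
(`runs_insertSlot`, `runs_mergeStep`).

Part (2) has no room for a matrix. It keeps `O(n)` directed edges between slots such that every pair
of slots is covered: some edge starts at one of the two and is no longer than the pair. A shortest
edge is then a closest pair. To cover all pairs meeting a set `B` of slots, a conga line walks
greedily to the nearest unvisited slot, using only steps with an end in `B`. Whichever slot of a
pair is left first gets an edge no longer than the pair. The line has at most `2 * |B|` edges and
enters each slot at most once (`PartialLine.step`, `PartialLine.line`).

Mergers are batched by a binary counter. Edges and slots have levels `0, …, L`. Step `t` rebuilds
level `j`, the exponent of two in `t` capped at `L`: all edges of level at most `j` are discarded,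
and a new line of level `j` is built for the slots of level at most `j` together with the fresh
ones, namely the merged slot and the sources of edges into `a` or `b`. One line per level and
in-degree one on each line leave at most `2 * L + 3` fresh slots (`Conga.card_fresh_le`), so a batch
of level `j < L` has at most `2 ^ j * (2 * L + 3)` slots, while such a level occurs every `2 ^ (j +
1)` steps. The batch sizes add up to `O(n * L ^ 2)` (`sum_batchBound_le`), and each batch element
costs `O(n)` time. The choice of `L` with `n ≤ 2 ^ L * (2 * L + 3) ≤ 6 * n` keeps the edges linear
in number (`Conga.length_le`). The invariant is preserved by `Conga.merge` and realised on the
machine by `runs_congaStep`.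

The median method is already of the form of part (2). For centroids and Ward's method the
representing object is the centroid with the size (`Cluster.Proper.rep_weightedJoin`), and Ward's
increment is a function of these by the parallel axis identity (`wardDist_eq`). These formulas need
disjoint parts, and `IsAgglomeration.congr` says that no other clusters matter. -/

namespace Agglomerative

/-! ## A program logic with time bounds -/

section Logic

variable {Ob : Type u} {D : Type v}

/-- The value of an expression on an unbounded machine. -/
def Expr.val (σ : State Ob D) : Expr → ℕ
  | .lit k => k
  | .reg r => σ.reg r
  | .mem a => σ.mem (a.val σ)
  | .add e f => e.val σ + f.val σ
  | .sub e f => e.val σ - f.val σ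
  | .mul e f => e.val σ * f.val σ
  | .div e f => e.val σ / f.val σ

/-- The evaluation of an expression neither overflows nor leaves the memory. -/
def Expr.Ok (W S : ℕ) (σ : State Ob D) : Expr → Prop
  | .lit k => k ≤ W
  | .reg r => σ.reg r ≤ W
  | .mem a => a.Ok W S σ ∧ a.val σ < S ∧ σ.mem (a.val σ) ≤ W
  | .add e f => e.Ok W S σ ∧ f.Ok W S σ ∧ e.val σ + f.val σ ≤ W
  | .sub e f => e.Ok W S σ ∧ f.Ok W S σ
  | .mul e f => e.Ok W S σ ∧ f.Ok W S σ ∧ e.val σ * f.val σ ≤ W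
  | .div e f => e.Ok W S σ ∧ f.Ok W S σ

/-- Truncated subtraction and division never exceed their first operand, so `Expr.Ok` needs no
overflow clause for them. -/
theorem Expr.Ok.val_le {W S : ℕ} {σ : State Ob D} {e : Expr} (h : e.Ok W S σ) : e.val σ ≤ W := by
  induction e with
  | lit k => exact h
  | reg r => exact h
  | mem a => exact h.2.2
  | add e f => exact h.2.2
  | sub e f ihe ihf => exact (Nat.sub_le _ _).trans (ihe h.1)
  | mul e f => exact h.2.2
  | div e f ihe ihf => exact (Nat.div_le_self _ _).trans (ihe h.1)

theorem Expr.Ok.eval_eq {W S : ℕ} {σ : State Ob D} {e : Expr} (h : e.Ok W S σ) :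
    e.eval W S σ = some (e.val σ) := by
  have hw := h.val_le
  induction e with
  | lit k => simp [Expr.eval, word, Expr.val, show k ≤ W from h]
  | reg r => simp [Expr.eval, word, Expr.val, show σ.reg r ≤ W from h]
  | mem a ih =>
    obtain ⟨h1, h2, h3⟩ := h
    simp [Expr.eval, word, ih h1 h1.val_le, h2, h3, Expr.val]
  | add e f ihe ihf | mul e f ihe ihf =>
    obtain ⟨h1, h2, h3⟩ := h
    simp [Expr.eval, word, ihe h1 h1.val_le, ihf h2 h2.val_le, h3, Expr.val]
  | sub e f ihe ihf | div e f ihe ihf =>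
    obtain ⟨h1, h2⟩ := h
    simp only [Expr.val] at hw
    simp only [Expr.eval, word, ihe h1 h1.val_le, ihf h2 h2.val_le, hw, Expr.val,
      Option.bind_some, if_true]

/-- The expression denotes an address inside the memory. -/
def Expr.AddrOk (W S : ℕ) (σ : State Ob D) (a : Expr) : Prop :=
  a.Ok W S σ ∧ a.val σ < S

theorem Expr.AddrOk.addr_eq {W S : ℕ} {σ : State Ob D} {a : Expr} (h : a.AddrOk W S σ) :
    a.addr W S σ = some (a.val σ) := by
  simp [Expr.addr, h.1.eval_eq, h.2]

variable [LinearOrder D]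

/-- The evaluation of a test does not block. -/
def Test.Ok (W S : ℕ) (σ : State Ob D) : Test → Prop
  | .lt e f => e.Ok W S σ ∧ f.Ok W S σ
  | .eq e f => e.Ok W S σ ∧ f.Ok W S σ
  | .leDist a b => a.AddrOk W S σ ∧ b.AddrOk W S σ ∧
      (∃ x, σ.dst (a.val σ) = some x) ∧ ∃ x, σ.dst (b.val σ) = some x

/-- The test succeeds on an unbounded machine. -/
def Test.Holds (σ : State Ob D) : Test → Prop
  | .lt e f => e.val σ < f.val σ
  | .eq e f => e.val σ = f.val σ
  | .leDist a b => ∀ x y, σ.dst (a.val σ) = some x → σ.dst (b.val σ) = some y → x ≤ y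

theorem Test.Ok.eval_true {W S : ℕ} {σ : State Ob D} {b : Test} (h : b.Ok W S σ)
    (hb : b.Holds σ) : b.eval W S σ = some true := by
  cases b with
  | lt e f => simpa [Test.eval, h.1.eval_eq, h.2.eval_eq, Test.Holds] using hb
  | eq e f => simpa [Test.eval, h.1.eval_eq, h.2.eval_eq, Test.Holds] using hb
  | leDist e f =>
    obtain ⟨h1, h2, ⟨x, hx⟩, y, hy⟩ := h
    simpa [Test.eval, State.readDist, h1.addr_eq, h2.addr_eq, hx, hy] using hb x y hx hy

theorem Test.Ok.eval_false {W S : ℕ} {σ : State Ob D} {b : Test} (h : b.Ok W S σ)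
    (hb : ¬ b.Holds σ) : b.eval W S σ = some false := by
  cases b with
  | lt e f => simpa [Test.eval, h.1.eval_eq, h.2.eval_eq, Test.Holds] using hb
  | eq e f => simpa [Test.eval, h.1.eval_eq, h.2.eval_eq, Test.Holds] using hb
  | leDist e f =>
    obtain ⟨h1, h2, ⟨x, hx⟩, y, hy⟩ := h
    simpa [Test.eval, State.readDist, h1.addr_eq, h2.addr_eq, hx, hy, Test.Holds] using hb

/-- Started in `σ`, the program `P` halts within time `T` in a state that satisfies `Q`. -/
def Runs (ops : Ops Ob D) (W S : ℕ) (P : Cmd) (T : ℕ) (σ : State Ob D) (Q : State Ob D → Prop) :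
    Prop :=
  ∃ (σ' : State Ob D) (t : ℕ), Exec ops W S P σ σ' t ∧ t ≤ T ∧ Q σ'

/-- An upper bound for the time that a loop-free program takes. -/
def Cmd.maxCost : Cmd → ℕ
  | .skip => 1
  | .setReg _ e => e.cost + 1
  | .store a e => a.cost + e.cost + 1
  | .copyObj a b => a.cost + b.cost + 1
  | .joinObj a b b' => a.cost + b.cost + b'.cost + 1
  | .copyDist a b => a.cost + b.cost + 1
  | .evalDist a b b' => a.cost + b.cost + b'.cost + 1
  | .updateL a s d => a.cost + ∑ j, (s j).cost + ∑ j, (d j).cost + 1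
  | .updateR a s d => a.cost + ∑ j, (s j).cost + ∑ j, (d j).cost + 1
  | .seq P Q => P.maxCost + Q.maxCost
  | .ite t P Q => t.cost + max P.maxCost Q.maxCost
  -- A default value that is never used: `Cmd.Wp` of a loop is `False`.
  | .while _ _ => 0

/-- The weakest precondition of a loop-free program. -/
def Cmd.Wp (ops : Ops Ob D) (W S : ℕ) : Cmd → (State Ob D → Prop) → State Ob D → Prop
  | .skip, Q, σ => Q σ
  | .setReg r e, Q, σ => e.Ok W S σ ∧ Q (σ.setReg r (e.val σ))
  | .store a e, Q, σ => a.AddrOk W S σ ∧ e.Ok W S σ ∧ Q (σ.setMem (a.val σ) (e.val σ))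
  | .copyObj a b, Q, σ => a.AddrOk W S σ ∧ b.AddrOk W S σ ∧
      ∃ o, σ.obj (b.val σ) = some o ∧ Q (σ.setObj (a.val σ) o)
  | .joinObj a b b', Q, σ => a.AddrOk W S σ ∧ b.AddrOk W S σ ∧ b'.AddrOk W S σ ∧
      ∃ o, σ.obj (b.val σ) = some o ∧ ∃ o', σ.obj (b'.val σ) = some o' ∧
        Q (σ.setObj (a.val σ) (ops.join o o'))
  | .copyDist a b, Q, σ => a.AddrOk W S σ ∧ b.AddrOk W S σ ∧
      ∃ x, σ.dst (b.val σ) = some x ∧ Q (σ.setDist (a.val σ) x)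
  | .evalDist a b b', Q, σ => a.AddrOk W S σ ∧ b.AddrOk W S σ ∧ b'.AddrOk W S σ ∧
      ∃ o, σ.obj (b.val σ) = some o ∧ ∃ o', σ.obj (b'.val σ) = some o' ∧
        Q (σ.setDist (a.val σ) (ops.dist o o'))
  | .updateL a s d, Q, σ => a.AddrOk W S σ ∧ (∀ j, (s j).Ok W S σ) ∧
      (∀ j, (d j).AddrOk W S σ) ∧ ∃ x : Fin 6 → D, (∀ j, σ.dst ((d j).val σ) = some (x j)) ∧
        Q (σ.setDist (a.val σ) (ops.updL (fun j => (s j).val σ) x))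
  | .updateR a s d, Q, σ => a.AddrOk W S σ ∧ (∀ j, (s j).Ok W S σ) ∧
      (∀ j, (d j).AddrOk W S σ) ∧ ∃ x : Fin 6 → D, (∀ j, σ.dst ((d j).val σ) = some (x j)) ∧
        Q (σ.setDist (a.val σ) (ops.updR (fun j => (s j).val σ) x))
  | .seq P R, Q, σ => P.Wp ops W S (R.Wp ops W S Q) σ
  | .ite t P R, Q, σ => t.Ok W S σ ∧ (t.Holds σ → P.Wp ops W S Q σ) ∧
      (¬ t.Holds σ → R.Wp ops W S Q σ)
  | .while _ _, _, _ => False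

variable {ops : Ops Ob D} {W S : ℕ} {P R : Cmd} {T T' : ℕ} {σ : State Ob D}
  {Q Q' : State Ob D → Prop}

theorem Runs.mono (h : Runs ops W S P T σ Q) (hT : T ≤ T') (hQ : ∀ τ, Q τ → Q' τ) :
    Runs ops W S P T' σ Q' := by
  obtain ⟨σ', t, h1, h2, h3⟩ := h
  exact ⟨σ', t, h1, h2.trans hT, hQ _ h3⟩

theorem Runs.seq (h : Runs ops W S P T σ fun τ => Runs ops W S R T' τ Q) :
    Runs ops W S (.seq P R) (T + T') σ Q := by
  obtain ⟨σ', t, h1, h2, σ'', t', h3, h4, h5⟩ := h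
  exact ⟨σ'', t + t', h1.seq h3, add_le_add h2 h4, h5⟩

theorem Runs.ite {b : Test} (hb : b.Ok W S σ) (hP : b.Holds σ → Runs ops W S P T σ Q)
    (hR : ¬ b.Holds σ → Runs ops W S R T σ Q) : Runs ops W S (.ite b P R) (b.cost + T) σ Q := by
  by_cases h : b.Holds σ
  · obtain ⟨σ', t, h1, h2, h3⟩ := hP h
    exact ⟨σ', _, .iteTrue (hb.eval_true h) h1, by omega, h3⟩
  · obtain ⟨σ', t, h1, h2, h3⟩ := hR h
    exact ⟨σ', _, .iteFalse (hb.eval_false h) h1, by omega, h3⟩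

/-- Turns a loop-free block into a first-order condition on the initial state, with a running time
that is independent of that state. All blocks inside and between loops are treated this way. -/
theorem Runs.of_wp (h : P.Wp ops W S Q σ) : Runs ops W S P P.maxCost σ Q := by
  induction P generalizing σ Q with
  | skip => exact ⟨_, _, .skip, le_rfl, h⟩
  | setReg r e => exact ⟨_, _, .setReg h.1.eval_eq, le_rfl, h.2⟩
  | store a e => exact ⟨_, _, .store h.1.addr_eq h.2.1.eval_eq, le_rfl, h.2.2⟩
  | copyObj a b =>
    obtain ⟨h1, h2, o, h3, h4⟩ := h
    exact ⟨_, _, .copyObj h1.addr_eq (by simp [State.readObj, h2.addr_eq, h3]), le_rfl, h4⟩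
  | joinObj a b b' =>
    obtain ⟨h1, h2, h3, o, h4, o', h5, h6⟩ := h
    exact ⟨_, _, .joinObj h1.addr_eq (by simp [State.readObj, h2.addr_eq, h4])
      (by simp [State.readObj, h3.addr_eq, h5]), le_rfl, h6⟩
  | copyDist a b =>
    obtain ⟨h1, h2, o, h3, h4⟩ := h
    exact ⟨_, _, .copyDist h1.addr_eq (by simp [State.readDist, h2.addr_eq, h3]), le_rfl, h4⟩
  | evalDist a b b' =>
    obtain ⟨h1, h2, h3, o, h4, o', h5, h6⟩ := h
    exact ⟨_, _, .evalDist h1.addr_eq (by simp [State.readObj, h2.addr_eq, h4])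
      (by simp [State.readObj, h3.addr_eq, h5]), le_rfl, h6⟩
  | updateL a s d =>
    obtain ⟨h1, h2, h3, x, h4, h5⟩ := h
    exact ⟨_, _, .updateL h1.addr_eq (fun j => (h2 j).eval_eq)
      (fun j => by simp [State.readDist, (h3 j).addr_eq, h4 j]), le_rfl, h5⟩
  | updateR a s d =>
    obtain ⟨h1, h2, h3, x, h4, h5⟩ := h
    exact ⟨_, _, .updateR h1.addr_eq (fun j => (h2 j).eval_eq)
      (fun j => by simp [State.readDist, (h3 j).addr_eq, h4 j]), le_rfl, h5⟩
  | seq P R ihP ihR => exact .seq ((ihP h).mono le_rfl fun τ hτ => ihR hτ)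
  | ite t P R ihP ihR =>
    exact .ite h.1 (fun ht => (ihP (h.2.1 ht)).mono (le_max_left _ _) fun _ => id)
      (fun ht => (ihR (h.2.2 ht)).mono (le_max_right _ _) fun _ => id)
  | _ => exact h.elim

/-- Rule for loop-free programs, with the bound on the running time checked by computation. -/
theorem Runs.of_wp_le (hT : P.maxCost ≤ T) (h : P.Wp ops W S Q σ) : Runs ops W S P T σ Q :=
  (Runs.of_wp h).mono hT fun _ => id

/-- Rule for a loop that is run at most `k` more times when `I k` holds. -/
theorem Runs.while_fuel {b : Test} {C : ℕ} (I : ℕ → State Ob D → Prop)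
    (h : ∀ k τ, I k τ → b.Ok W S τ ∧ (¬ b.Holds τ → Q τ) ∧
      (b.Holds τ → ∃ k', k = k' + 1 ∧ Runs ops W S P C τ (I k'))) (k : ℕ) (hI : I k σ) :
    Runs ops W S (.while b P) (k * (b.cost + C) + b.cost) σ Q := by
  induction k generalizing σ with
  | zero =>
    obtain ⟨h1, h2, h3⟩ := h _ _ hI
    by_cases hb : b.Holds σ
    · obtain ⟨k', hk, -⟩ := h3 hb; omega
    · exact ⟨_, _, .whileFalse (h1.eval_false hb), by omega, h2 hb⟩
  | succ k ih =>
    obtain ⟨h1, h2, h3⟩ := h _ _ hI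
    by_cases hb : b.Holds σ
    · obtain ⟨k', hk, σ', t, h4, h5, h6⟩ := h3 hb
      obtain rfl : k = k' := by omega
      obtain ⟨σ'', t', h7, h8, h9⟩ := ih h6
      exact ⟨_, _, .whileTrue (h1.eval_true hb) h4 h7, by rw [add_mul]; omega, h9⟩
    · exact ⟨_, _, .whileFalse (h1.eval_false hb), by omega, h2 hb⟩

/-- Rule for a loop with a counter, with a time bound for each round. -/
theorem Runs.while_sum {b : Test} (C : ℕ → ℕ) (I : ℕ → State Ob D → Prop) {lo hi : ℕ}
    (hle : lo ≤ hi)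
    (step : ∀ i τ, lo ≤ i → i < hi → I i τ →
      b.Ok W S τ ∧ b.Holds τ ∧ Runs ops W S P (C i) τ (I (i + 1)))
    (done : ∀ τ, I hi τ → b.Ok W S τ ∧ ¬ b.Holds τ ∧ Q τ) (hI : I lo σ) :
    Runs ops W S (.while b P) (∑ i ∈ Finset.Ico lo hi, (b.cost + C i) + b.cost) σ Q := by
  induction hle using Nat.decreasingInduction generalizing σ with
  | self =>
    obtain ⟨h1, h2, h3⟩ := done _ hI
    exact ⟨_, _, .whileFalse (h1.eval_false h2), by omega, h3⟩
  | of_succ lo hlt ih =>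
    obtain ⟨h1, h2, σ', t, h4, h5, h6⟩ := step _ _ le_rfl hlt hI
    obtain ⟨σ'', t', h7, h8, h9⟩ := ih (fun i τ hi => step i τ (by omega)) h6
    refine ⟨_, _, .whileTrue (h1.eval_true h2) h4 h7, ?_, h9⟩
    rw [Finset.sum_eq_sum_Ico_succ_bot hlt]
    omega

/-- Rule for a loop with a counter, with a uniform time bound. -/
theorem Runs.while_count {b : Test} {C : ℕ} (I : ℕ → State Ob D → Prop) {lo hi : ℕ}
    (hle : lo ≤ hi)
    (step : ∀ i τ, lo ≤ i → i < hi → I i τ →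
      b.Ok W S τ ∧ b.Holds τ ∧ Runs ops W S P C τ (I (i + 1)))
    (done : ∀ τ, I hi τ → b.Ok W S τ ∧ ¬ b.Holds τ ∧ Q τ) (hI : I lo σ) :
    Runs ops W S (.while b P) ((hi - lo) * (b.cost + C) + b.cost) σ Q := by
  refine (Runs.while_sum (fun _ => C) I hle step done hI).mono ?_ fun _ => id
  simp

end Logic

/-! Reading a state after a write. -/

section Reads

variable {Ob : Type u} {D : Type v} (σ : State Ob D) (i v : ℕ) (o : Ob) (x : D)

theorem State.reg_setReg (r : ℕ) : (σ.setReg i v).reg r = if r = i then v else σ.reg r :=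
  Function.update_apply ..
theorem State.mem_setReg : (σ.setReg i v).mem = σ.mem := rfl
theorem State.obj_setReg : (σ.setReg i v).obj = σ.obj := rfl
theorem State.dst_setReg : (σ.setReg i v).dst = σ.dst := rfl
theorem State.reg_setMem : (σ.setMem i v).reg = σ.reg := rfl
theorem State.mem_setMem (r : ℕ) : (σ.setMem i v).mem r = if r = i then v else σ.mem r :=
  Function.update_apply ..
theorem State.obj_setMem : (σ.setMem i v).obj = σ.obj := rfl
theorem State.dst_setMem : (σ.setMem i v).dst = σ.dst := rfl
theorem State.reg_setObj : (σ.setObj i o).reg = σ.reg := rfl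
theorem State.mem_setObj : (σ.setObj i o).mem = σ.mem := rfl
theorem State.obj_setObj (r : ℕ) : (σ.setObj i o).obj r = if r = i then some o else σ.obj r :=
  Function.update_apply ..
theorem State.dst_setObj : (σ.setObj i o).dst = σ.dst := rfl
theorem State.reg_setDist : (σ.setDist i x).reg = σ.reg := rfl
theorem State.mem_setDist : (σ.setDist i x).mem = σ.mem := rfl
theorem State.obj_setDist : (σ.setDist i x).obj = σ.obj := rfl
theorem State.dst_setDist (r : ℕ) : (σ.setDist i x).dst r = if r = i then some x else σ.dst r :=
  Function.update_apply ..

end Reads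

attribute [simp] Expr.val Expr.Ok Expr.AddrOk Expr.cost Test.Ok Test.Holds Test.cost Cmd.Wp
  State.reg_setReg State.mem_setReg State.obj_setReg State.dst_setReg
  State.reg_setMem State.mem_setMem State.obj_setMem State.dst_setMem
  State.reg_setObj State.mem_setObj State.obj_setObj State.dst_setObj
  State.reg_setDist State.mem_setDist State.obj_setDist State.dst_setDist

infixr:60 ";;" => Cmd.seq

end Agglomerative

namespace Agglomerative

/-! ## Clusters in slots -/

/-- The two parts of every merged cluster are disjoint. -/
def Cluster.Proper {n : ℕ} : Cluster n → Prop
  | .leaf _ => True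
  | .node _ A B => A.Proper ∧ B.Proper ∧ Disjoint A.members B.members

theorem Cluster.members_nonempty {n : ℕ} : ∀ A : Cluster n, A.members.Nonempty
  | .leaf i => ⟨i, by simp [members]⟩
  | .node _ A B => A.members_nonempty.mono Finset.subset_union_left

theorem Cluster.FormedBefore.mono {n k l : ℕ} {A : Cluster n} (h : A.FormedBefore k)
    (hkl : k ≤ l) : A.FormedBefore l := by
  cases A with
  | leaf i => trivial
  | node j A B => exact lt_of_lt_of_le (show j < k from h) hkl

/-- Only the past matters. The mergers can therefore be read from a memory whose later output cells
are still to be written. -/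
theorem forest_congr {n k : ℕ} {m m' : ℕ → ℕ × ℕ} (h : ∀ i < k, m i = m' i) :
    forest n m k = forest n m' k := by
  induction k with
  | zero => rfl
  | succ k ih =>
    have ih := ih fun i hi => h i (by omega)
    funext l
    simp only [forest, ih, h k (by omega)]

/-- The clusters present after `k` steps are kept in the slots `live`: slot `i` holds the cluster
`cl i`, which is labelled `lab i`. -/
structure Slots (n : ℕ) (m : ℕ → ℕ × ℕ) (k : ℕ) (live : Finset ℕ) (lab : ℕ → ℕ)
    (cl : ℕ → Cluster n) : Prop where
  card : live.card = n - k
  forest_lab : ∀ i ∈ live, forest n m k (lab i) = some (cl i)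
  lab_lt : ∀ i ∈ live, lab i < n + k
  formed : ∀ i ∈ live, (cl i).FormedBefore k
  exists_slot : ∀ l X, forest n m k l = some X → ∃ i ∈ live, lab i = l
  lab_inj : ∀ i ∈ live, ∀ j ∈ live, lab i = lab j → i = j
  disj : ∀ i ∈ live, ∀ j ∈ live, i ≠ j → Disjoint (cl i).members (cl j).members
  proper : ∀ i ∈ live, (cl i).Proper

/-- The offset `s` is `0` for the conga lines and `2 ^ H` for the quadtree, whose slots are numbered
like the leaves of a heap. -/
theorem Slots.init {n : ℕ} (m : ℕ → ℕ × ℕ) (s : ℕ) {lab : ℕ → ℕ} {cl : ℕ → Cluster n}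
    (hlab : ∀ i < n, lab (s + i) = i) (hcl : ∀ i (h : i < n), cl (s + i) = .leaf ⟨i, h⟩) :
    Slots n m 0 (Finset.Ico s (s + n)) lab cl := by
  have key : ∀ i ∈ Finset.Ico s (s + n), ∃ j < n, i = s + j := fun i hi => by
    rw [Finset.mem_Ico] at hi
    exact ⟨i - s, by omega, by omega⟩
  refine ⟨by simp, ?_, ?_, ?_, ?_, ?_, ?_, ?_⟩
  · intro i hi
    obtain ⟨j, hj, rfl⟩ := key i hi
    simp [forest, hlab j hj, hcl j hj, hj]
  · intro i hi
    obtain ⟨j, hj, rfl⟩ := key i hi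
    simpa [hlab j hj] using hj
  · intro i hi
    obtain ⟨j, hj, rfl⟩ := key i hi
    rw [hcl j hj]; trivial
  · intro l X h
    by_cases hl : l < n
    · exact ⟨s + l, by simp [hl], hlab l hl⟩
    · simp [forest, hl] at h
  · intro i hi j hj h
    obtain ⟨i, hi', rfl⟩ := key i hi
    obtain ⟨j, hj', rfl⟩ := key j hj
    rw [hlab i hi', hlab j hj'] at h
    rw [h]
  · intro i hi j hj h
    obtain ⟨i, hi', rfl⟩ := key i hi
    obtain ⟨j, hj', rfl⟩ := key j hj
    rw [hcl i hi', hcl j hj']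
    simpa [Cluster.members] using fun h' => h (by rw [h'])
  · intro i hi
    obtain ⟨j, hj, rfl⟩ := key i hi
    rw [hcl j hj]; trivial

theorem Slots.congr {n k : ℕ} {m m' : ℕ → ℕ × ℕ} {live : Finset ℕ} {lab : ℕ → ℕ}
    {cl : ℕ → Cluster n} (hs : Slots n m k live lab cl) (h : ∀ i < k, m i = m' i) :
    Slots n m' k live lab cl := by
  have e := forest_congr (n := n) h
  obtain ⟨h1, h2, h3, h4, h5, h6, h7, h8⟩ := hs
  exact ⟨h1, e ▸ h2, h3, h4, e ▸ h5, h6, h7, h8⟩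

/-- All earlier labels are below `n + k`, so the label of the new cluster is unused and labels stay
distinct. Every other slot is untouched. -/
theorem Slots.merge {n k : ℕ} {m : ℕ → ℕ × ℕ} {live : Finset ℕ} {lab : ℕ → ℕ}
    {cl : ℕ → Cluster n} (hs : Slots n m k live lab cl) {a b : ℕ} (ha : a ∈ live) (hb : b ∈ live)
    (hab : a ≠ b) (hm : m k = (lab a, lab b)) :
    Slots n m (k + 1) (live.erase b) (Function.update lab a (n + k))
      (Function.update cl a (.node k (cl a) (cl b))) := by
  have la := hs.lab_lt a ha
  have lb := hs.lab_lt b hb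
  have fa := hs.forest_lab a ha
  have fb := hs.forest_lab b hb
  have split : ∀ i ∈ live.erase b, i = a ∨ (i ≠ a ∧ i ≠ b ∧ i ∈ live) := fun i hi => by
    rw [Finset.mem_erase] at hi
    by_cases h : i = a
    · exact .inl h
    · exact .inr ⟨h, hi⟩
  have dis : ∀ i ∈ live, i ≠ a → i ≠ b →
      Disjoint (Cluster.node k (cl a) (cl b)).members (cl i).members := fun i hi h1 h2 =>
    Finset.disjoint_union_left.2 ⟨hs.disj a ha i hi h1.symm, hs.disj b hb i hi h2.symm⟩
  refine ⟨?_, ?_, ?_, ?_, ?_, ?_, ?_, ?_⟩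
  · rw [Finset.card_erase_of_mem hb, hs.card]; omega
  · intro i hi
    rcases split i hi with rfl | ⟨h1, h2, h3⟩
    · simp [forest, hm, fa, fb]
    · have hl := hs.lab_lt i h3
      have n1 : lab i ≠ lab a := fun h => h1 (hs.lab_inj i h3 a ha h)
      have n2 : lab i ≠ lab b := fun h => h2 (hs.lab_inj i h3 b hb h)
      simp [forest, hm, h1, n1, n2, hl.ne, hs.forest_lab i h3]
  · intro i hi
    rcases split i hi with rfl | ⟨h1, h2, h3⟩
    · simp
    · have hl := hs.lab_lt i h3
      simp [h1]; omega
  · intro i hi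
    rcases split i hi with rfl | ⟨h1, h2, h3⟩
    · simp [Cluster.FormedBefore]
    · simpa [h1] using (hs.formed i h3).mono (Nat.le_succ k)
  · intro l X h
    by_cases hl : l = n + k
    · exact ⟨a, by simp [hab, ha], by simp [hl]⟩
    · simp only [forest, hl, if_false, hm] at h
      split_ifs at h with h'
      push Not at h'
      obtain ⟨i, hi, rfl⟩ := hs.exists_slot l X h
      have h1 : i ≠ a := fun e => h'.1 (by rw [e])
      have h2 : i ≠ b := fun e => h'.2 (by rw [e])
      exact ⟨i, by simp [h2, hi], by simp [h1]⟩
  · intro i hi j hj h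
    rcases split i hi with rfl | ⟨h1, h2, h3⟩ <;> rcases split j hj with rfl | ⟨h4, h5, h6⟩
    · rfl
    · have := hs.lab_lt j h6
      simp [h4] at h; omega
    · have := hs.lab_lt i h3
      simp [h1] at h; omega
    · simp only [Function.update_of_ne h1, Function.update_of_ne h4] at h
      exact hs.lab_inj i h3 j h6 h
  · intro i hi j hj h
    rcases split i hi with rfl | ⟨h1, h2, h3⟩ <;> rcases split j hj with rfl | ⟨h4, h5, h6⟩
    · exact absurd rfl h
    · simpa [h4] using dis j h6 h4 h5
    · simpa [h1] using (dis i h3 h1 h2).symm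
    · simpa [h1, h4] using hs.disj i h3 j h6 h
  · intro i hi
    rcases split i hi with rfl | ⟨h1, h2, h3⟩
    · simpa [Cluster.Proper] using ⟨hs.proper i ha, hs.proper b hb, hs.disj i ha b hb hab⟩
    · simpa [h1] using hs.proper i h3

/-- The first `k` mergers are a closest pair among the clusters present. -/
def AgglomerationPrefix {n : ℕ} {D : Type v} [LinearOrder D] (δ : Cluster n → Cluster n → D)
    (m : ℕ → ℕ × ℕ) (k : ℕ) : Prop :=
  ∀ i < k, (m i).1 ≠ (m i).2 ∧
    ∃ A B, forest n m i (m i).1 = some A ∧ forest n m i (m i).2 = some B ∧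
      ∀ p q X Y, p ≠ q → forest n m i p = some X → forest n m i q = some Y → δ A B ≤ δ X Y

section Prefix

variable {n k : ℕ} {D : Type v} [LinearOrder D] {δ δ' : Cluster n → Cluster n → D}
  {m m' : ℕ → ℕ × ℕ} {live : Finset ℕ} {lab : ℕ → ℕ} {cl : ℕ → Cluster n}

theorem AgglomerationPrefix.congr (h : AgglomerationPrefix δ m k) (hm : ∀ i < k, m i = m' i) :
    AgglomerationPrefix δ m' k := by
  intro i hi
  have := h i hi
  rwa [forest_congr (n := n) fun j hj => hm j (hj.trans hi), hm i hi] at this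

theorem AgglomerationPrefix.isAgglomeration (h : AgglomerationPrefix δ m (n - 1)) :
    IsAgglomeration δ m := fun k hk => h k (by omega)

/-- Slots enumerate the present clusters without repetition, so minimality over pairs of slots is
minimality over pairs of labels. -/
theorem AgglomerationPrefix.succ (h : AgglomerationPrefix δ m k)
    (hs : Slots n m k live lab cl) {a b : ℕ} (ha : a ∈ live) (hb : b ∈ live) (hab : a ≠ b)
    (hm : m k = (lab a, lab b))
    (hmin : ∀ i ∈ live, ∀ j ∈ live, i ≠ j → δ (cl a) (cl b) ≤ δ (cl i) (cl j)) :
    AgglomerationPrefix δ m (k + 1) := by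
  intro i hi
  rcases Nat.lt_succ_iff_lt_or_eq.1 hi with hi | rfl
  · exact h i hi
  rw [hm]
  refine ⟨fun e => hab (hs.lab_inj a ha b hb e), cl a, cl b, hs.forest_lab a ha,
    hs.forest_lab b hb, ?_⟩
  intro p q X Y hpq hX hY
  obtain ⟨x, hx, rfl⟩ := hs.exists_slot p X hX
  obtain ⟨y, hy, rfl⟩ := hs.exists_slot q Y hY
  rw [hs.forest_lab x hx] at hX
  rw [hs.forest_lab y hy] at hY
  cases hX; cases hY
  exact hmin x hx y hy fun e => hpq (by rw [e])

/-- The clusters of a bottom-up clustering can be kept in slots. -/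
theorem IsAgglomeration.exists_slots (h : IsAgglomeration δ m) (hk : k < n) :
    ∃ live lab cl, Slots n m k live lab cl := by
  induction k with
  | zero =>
    exact ⟨_, fun i => i, fun i => .leaf ⟨i % n, Nat.mod_lt _ hk⟩, Slots.init m 0 (by simp)
      fun i hi => by simp [Nat.mod_eq_of_lt hi]⟩
  | succ k ih =>
    obtain ⟨live, lab, cl, hs⟩ := ih (by omega)
    obtain ⟨hne, A, B, hA, hB, -⟩ := h k hk
    obtain ⟨a, ha, ha'⟩ := hs.exists_slot _ _ hA
    obtain ⟨b, hb, hb'⟩ := hs.exists_slot _ _ hB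
    exact ⟨_, _, _, hs.merge ha hb (fun e => hne (by rw [← ha', ← hb', e]))
      (by rw [ha', hb'])⟩

/-- Only the distances between disjoint clusters matter. -/
theorem IsAgglomeration.congr (h : IsAgglomeration δ m)
    (hδ : ∀ A B : Cluster n, A.Proper → B.Proper → Disjoint A.members B.members →
      δ A B = δ' A B) : IsAgglomeration δ' m := by
  intro k hk
  obtain ⟨live, lab, cl, hs⟩ := h.exists_slots (k := k) (by omega)
  obtain ⟨hne, A, B, hA, hB, hmin⟩ := h k hk
  have key : ∀ i j X Y, i ≠ j → forest n m k i = some X → forest n m k j = some Y →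
      δ X Y = δ' X Y := by
    intro i j X Y hij hX hY
    obtain ⟨a, ha, rfl⟩ := hs.exists_slot _ _ hX
    obtain ⟨b, hb, rfl⟩ := hs.exists_slot _ _ hY
    rw [hs.forest_lab a ha] at hX
    rw [hs.forest_lab b hb] at hY
    cases hX; cases hY
    exact hδ _ _ (hs.proper a ha) (hs.proper b hb)
      (hs.disj a ha b hb fun e => hij (by rw [e]))
  refine ⟨hne, A, B, hA, hB, fun i j X Y hij hX hY => ?_⟩
  rw [← key _ _ _ _ hne hA hB, ← key _ _ _ _ hij hX hY]
  exact hmin i j X Y hij hX hY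

theorem Performs.congr {Ob : Type u} {P : Cmd} {ops : Ops Ob D} {x : Fin n → Ob} {W S T : ℕ}
    (h : Performs P ops x δ W S T)
    (hδ : ∀ A B : Cluster n, A.Proper → B.Proper → Disjoint A.members B.members →
      δ A B = δ' A B) : Performs P ops x δ' W S T := by
  obtain ⟨σ, t, h1, h2, h3, h4⟩ := h
  exact ⟨σ, t, h1, h2, h3, h4.congr hδ⟩

end Prefix

/-! ## Centroids and Ward's distance in terms of representatives -/

section Methods

variable {E : Type w} [NormedAddCommGroup E] [InnerProductSpace ℝ E] {n : ℕ}

theorem smul_centroid (p : Fin n → E) {s : Finset (Fin n)} (hs : s.Nonempty) :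
    (s.card : ℝ) • centroid p s = ∑ i ∈ s, p i := by
  have : (s.card : ℝ) ≠ 0 := by simpa using hs.ne_empty
  rw [centroid, smul_inv_smul₀ this]

/-- Sizes and sums of points add over disjoint parts; for overlapping parts `weightedJoin` would
count the common points twice. -/
theorem Cluster.Proper.rep_weightedJoin (p : Fin n → E) {A : Cluster n} (hA : A.Proper) :
    A.rep weightedJoin (fun i => (p i, 1)) = (centroid p A.members, A.members.card) := by
  induction A with
  | leaf i => simp [rep, centroid, members]
  | node k A B ihA ihB =>
    obtain ⟨h1, h2, h3⟩ := hA
    simp only [rep, ihA h1, ihB h2, weightedJoin, members]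
    rw [Finset.card_union_of_disjoint h3, smul_centroid p A.members_nonempty,
      smul_centroid p B.members_nonempty, ← Finset.sum_union h3, centroid,
      Finset.card_union_of_disjoint h3]
    push_cast
    rfl

/-- The parallel axis identity: in the expansion of the squares around the centroid the cross terms
cancel, because the deviations from the centroid sum to zero. -/
theorem sum_dist_sq (p : Fin n → E) {s : Finset (Fin n)} (hs : s.Nonempty) (c : E) :
    ∑ i ∈ s, dist (p i) c ^ 2 = sumSq p s + s.card * dist (centroid p s) c ^ 2 := by
  have h : ∀ i, dist (p i) c ^ 2 = dist (p i) (centroid p s) ^ 2 +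
      2 * inner ℝ (p i - centroid p s) (centroid p s - c) + dist (centroid p s) c ^ 2 := fun i => by
    rw [dist_eq_norm, dist_eq_norm, dist_eq_norm, ← norm_add_sq_real, sub_add_sub_cancel]
  have h0 : ∑ i ∈ s, (p i - centroid p s) = 0 := by
    rw [Finset.sum_sub_distrib, Finset.sum_const, ← smul_centroid p hs, Nat.cast_smul_eq_nsmul,
      sub_self]
  simp only [h]
  rw [Finset.sum_add_distrib, Finset.sum_add_distrib, ← Finset.mul_sum, ← sum_inner, h0]
  simp [sumSq]

/-- By the parallel axis identity for both parts, the increase is `a * |x - c| ^ 2 + b * |y - c| ^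
2` with `c` the joint centroid. Since `c` divides the segment from `x` to `y` in the ratio `b : a`,
both terms are multiples of `|x - y| ^ 2`. -/
theorem wardDist_eq (p : Fin n → E) {A B : Cluster n} (h : Disjoint A.members B.members) :
    wardDist p A B = wardOp (centroid p A.members, A.members.card)
      (centroid p B.members, B.members.card) := by
  have hA := A.members_nonempty
  have hB := B.members_nonempty
  have ha : (0 : ℝ) < A.members.card := by exact_mod_cast hA.card_pos
  have hb : (0 : ℝ) < B.members.card := by exact_mod_cast hB.card_pos
  set a : ℝ := (A.members.card : ℝ) with haa
  set b : ℝ := (B.members.card : ℝ) with hbb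
  set x := centroid p A.members with hx
  set y := centroid p B.members with hy
  have hc : centroid p (A.members ∪ B.members) = (a + b)⁻¹ • (a • x + b • y) := by
    rw [smul_centroid p hA, smul_centroid p hB, ← Finset.sum_union h, centroid,
      Finset.card_union_of_disjoint h]
    push_cast; rfl
  have hxc : x - (a + b)⁻¹ • (a • x + b • y) = ((a + b)⁻¹ * b) • (x - y) := by
    have : x = ((a + b)⁻¹ * (a + b)) • x := by rw [inv_mul_cancel₀ (by positivity), one_smul]
    nth_rewrite 1 [this]
    module
  have hyc : y - (a + b)⁻¹ • (a • x + b • y) = (-((a + b)⁻¹ * a)) • (x - y) := by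
    have : y = ((a + b)⁻¹ * (a + b)) • y := by rw [inv_mul_cancel₀ (by positivity), one_smul]
    nth_rewrite 1 [this]
    module
  have e1 : dist x ((a + b)⁻¹ • (a • x + b • y)) ^ 2 = ((a + b)⁻¹ * b) ^ 2 * dist x y ^ 2 := by
    rw [dist_eq_norm, hxc, norm_smul, mul_pow, Real.norm_eq_abs, sq_abs, dist_eq_norm]
  have e2 : dist y ((a + b)⁻¹ • (a • x + b • y)) ^ 2 = ((a + b)⁻¹ * a) ^ 2 * dist x y ^ 2 := by
    rw [dist_eq_norm, hyc, norm_smul, mul_pow, Real.norm_eq_abs, sq_abs, dist_eq_norm, neg_sq]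
  rw [wardDist, sumSq, hc, Finset.sum_union h, sum_dist_sq p hA, sum_dist_sq p hB, ← hx, ← hy,
    e1, e2, wardOp]
  have : a + b ≠ 0 := by positivity
  field_simp
  ring

end Methods

end Agglomerative

namespace Agglomerative

/-! ## Conga lines -/

section Conga

variable {D : Type v} [LinearOrder D]

/-- A directed edge between slots, belonging to the conga line of the level `lev`. -/
structure CEdge where
  src : ℕ
  tgt : ℕ
  lev : ℕ

/-- The mark of a slot while a conga line for the slots `B` is built. -/
def mark (live B : Finset ℕ) (i : ℕ) : ℕ := if i ∈ B then 2 else if i ∈ live then 1 else 0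

theorem mark_le (live B : Finset ℕ) (i : ℕ) : mark live B i ≤ 2 := by
  unfold mark; split_ifs <;> omega

/-- A conga line that has visited the slots `V` and has reached `cur`. -/
structure PartialLine (dm : ℕ → ℕ → D) (live B V : Finset ℕ) (cur j : ℕ) (l : List CEdge) :
    Prop where
  subset : V ⊆ live
  cur_mem : cur ∈ V
  edge : ∀ e ∈ l, e.src ∈ live ∧ e.tgt ∈ live ∧ e.src ≠ e.tgt ∧ e.lev = j
  cover : ∀ p ∈ B, ∀ q ∈ live, p ≠ q →
    (∃ e ∈ l, (e.src = p ∨ e.src = q) ∧ dm e.src e.tgt ≤ dm p q) ∨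
      ((p ∉ V ∨ p = cur) ∧ (q ∉ V ∨ q = cur))
  indeg : ∀ x, l.countP (fun e => e.tgt = x) ≤ if x ∈ V then 1 else 0
  length : l.length + 2 * (B \ V).card + mark live B cur ≤ 2 * B.card

/-- A conga line: it covers all pairs with an element of `B`. -/
structure Line (dm : ℕ → ℕ → D) (live B : Finset ℕ) (j : ℕ) (l : List CEdge) : Prop where
  edge : ∀ e ∈ l, e.src ∈ live ∧ e.tgt ∈ live ∧ e.src ≠ e.tgt ∧ e.lev = j
  cover : ∀ p ∈ B, ∀ q ∈ live, p ≠ q →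
    ∃ e ∈ l, (e.src = p ∨ e.src = q) ∧ dm e.src e.tgt ≤ dm p q
  indeg : ∀ x, l.countP (fun e => e.tgt = x) ≤ 1
  length : l.length ≤ 2 * B.card

variable {dm dm' : ℕ → ℕ → D} {live B V : Finset ℕ} {cur a b j : ℕ} {l : List CEdge}

theorem PartialLine.init (hB : B ⊆ live) (ha : a ∈ B) : PartialLine dm live B {a} a j [] := by
  refine ⟨by simpa using hB ha, by simp, by simp, ?_, by simp, ?_⟩
  · intro p _ q _ _
    refine .inr ⟨?_, ?_⟩ <;> simp only [Finset.mem_singleton] <;> tauto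
  · have := Finset.card_sdiff_add_card_eq_card (s := {a}) (t := B) (by simpa using ha)
    have : mark live B a = 2 := by simp [mark, ha]
    simp only [Finset.card_singleton] at *
    simp; omega

/-- A sum of marks above two means that both slots are live and at least one of them is in `B`. A
pair that is still uncovered has both slots unvisited or at the end of the line. If one of them is
the end, then the other one is a candidate, and the step to the nearest candidate covers the pair.
-/
theorem PartialLine.step (hB : B ⊆ live) (hdm : ∀ p q, dm p q = dm q p)
    (h : PartialLine dm live B V cur j l) {nb : ℕ} (hnb : nb ∈ live) (hV : nb ∉ V)
    (hc : 2 < mark live B nb + mark live B cur)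
    (hmin : ∀ i ∈ live, i ∉ V → 2 < mark live B i + mark live B cur → dm cur nb ≤ dm cur i) :
    PartialLine dm live B (insert nb V) nb j (l ++ [⟨cur, nb, j⟩]) := by
  have hcur := h.subset h.cur_mem
  refine ⟨Finset.insert_subset hnb h.subset, by simp, ?_, ?_, ?_, ?_⟩
  · intro e he
    rcases List.mem_append.1 he with he | he
    · exact h.edge e he
    · rw [List.mem_singleton] at he
      subst he
      exact ⟨hcur, hnb, fun (e : cur = nb) => hV (e ▸ h.cur_mem), rfl⟩
  · intro p hp q hq hpq
    rcases h.cover p hp q hq hpq with ⟨e, he, h'⟩ | ⟨h1, h2⟩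
    · exact .inl ⟨e, by simp [he], h'⟩
    have hmp : mark live B p = 2 := by simp [mark, hp]
    have hmq : 1 ≤ mark live B q := by simp only [mark, hq]; split_ifs <;> simp
    by_cases ep : p = cur
    · subst ep
      have hqV : q ∉ V := h2.resolve_right fun e => hpq e.symm
      exact .inl ⟨⟨p, nb, j⟩, by simp, .inl rfl, hmin q hq hqV (by omega)⟩
    have hpV : p ∉ V := h1.resolve_right ep
    by_cases eq : q = cur
    · subst eq
      refine .inl ⟨⟨q, nb, j⟩, by simp, .inr rfl, ?_⟩
      rw [hdm p q]
      exact hmin p (hB hp) hpV (by omega)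
    have hqV : q ∉ V := h2.resolve_right eq
    refine .inr ⟨?_, ?_⟩ <;> simp only [Finset.mem_insert] <;> tauto
  · intro x
    have := h.indeg x
    rw [List.countP_append, List.countP_singleton]
    simp only [Finset.mem_insert, decide_eq_true_eq]
    by_cases hx : x = nb
    · subst hx
      simp [hV] at this ⊢
      exact this
    · simp [hx, Ne.symm hx] at this ⊢
      exact this
  -- The quantity `length + 2 * |B \ V| + mark cur` does not increase. Entering `B` pays with an
  -- element of `B \ V`; leaving `B` lowers the mark of the end from two to one.
  · have hl := h.length
    simp only [List.length_append, List.length_singleton]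
    by_cases hb : nb ∈ B
    · have e : B \ V = insert nb (B \ insert nb V) := by
        ext i; simp only [Finset.mem_sdiff, Finset.mem_insert]
        by_cases i = nb <;> simp_all
      have hm : mark live B nb = 2 := by simp [mark, hb]
      have : mark live B cur ≥ 1 := by simp only [mark, hcur]; split_ifs <;> simp
      rw [e, Finset.card_insert_of_notMem (by simp)] at hl
      omega
    · have e : B \ insert nb V = B \ V := by
        ext i; simp only [Finset.mem_sdiff, Finset.mem_insert]
        by_cases i = nb <;> simp_all
      have hm : mark live B nb = 1 := by simp [mark, hb, hnb]
      rw [e]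
      omega

/-- An uncovered pair would still contain a candidate: the unvisited `q` if the line ends at `p ∈
B`, and the unvisited `p` otherwise. -/
theorem PartialLine.line (hB : B ⊆ live) (h : PartialLine dm live B V cur j l)
    (hdone : ∀ i ∈ live, i ∉ V → mark live B i + mark live B cur ≤ 2) :
    Line dm live B j l := by
  have hcur := h.subset h.cur_mem
  refine ⟨h.edge, ?_, fun x => (h.indeg x).trans (by split_ifs <;> omega), by have := h.length; omega⟩
  intro p hp q hq hpq
  refine (h.cover p hp q hq hpq).resolve_right ?_
  rintro ⟨h1, h2⟩
  have hmp : mark live B p = 2 := by simp [mark, hp]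
  have hmq : 1 ≤ mark live B q := by simp only [mark, hq]; split_ifs <;> simp
  have hmc : 1 ≤ mark live B cur := by simp only [mark, hcur]; split_ifs <;> simp
  by_cases ep : p = cur
  · subst ep
    have hqV : q ∉ V := h2.resolve_right fun e => hpq e.symm
    have := hdone q hq hqV
    omega
  · have := hdone p (hB hp) (h1.resolve_right ep)
    omega

/-- The data structure after `k` mergers: every pair of slots is covered by an edge that starts at
one of the two, edges of the same level have different targets, and there are few edges of each
level, and few slots of low levels. -/
structure Conga (n L k : ℕ) (dm : ℕ → ℕ → D) (live : Finset ℕ) (lv : ℕ → ℕ) (l : List CEdge) :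
    Prop where
  edge : ∀ e ∈ l, e.src ∈ live ∧ e.tgt ∈ live ∧ e.src ≠ e.tgt ∧ e.lev ≤ L
  cover : ∀ p ∈ live, ∀ q ∈ live, p ≠ q → ∃ e ∈ l, (e.src = p ∨ e.src = q) ∧
    dm e.src e.tgt ≤ dm p q ∧ (lv p ≤ e.lev ∨ lv q ≤ e.lev)
  indeg : ∀ x i, l.countP (fun e => e.tgt = x ∧ e.lev = i) ≤ 1
  count : ∀ i < L, l.countP (fun e => e.lev = i) ≤ 2 * (2 ^ i * (2 * L + 3))
  count_top : l.countP (fun e => e.lev = L) ≤ 2 * n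
  lev_le : ∀ i ∈ live, lv i ≤ L
  few : ∀ i < L, (live.filter fun p => lv p ≤ i).card ≤ k % 2 ^ (i + 1) * (2 * L + 3)

theorem countP_eq_sum_lev {L : ℕ} (p : CEdge → Prop) [DecidablePred p] (l : List CEdge)
    (h : ∀ e ∈ l, e.lev ≤ L) :
    l.countP (fun e => p e) = ∑ i ∈ Finset.range (L + 1), l.countP (fun e => p e ∧ e.lev = i) := by
  induction l with
  | nil => simp
  | cons e l ih =>
    have he : e.lev ∈ Finset.range (L + 1) := by
      have := h e (by simp)
      simp; omega
    simp only [List.countP_cons]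
    rw [ih fun e he => h e (by simp [he]), Finset.sum_add_distrib]
    congr 1
    by_cases hp : p e
    · simp [hp]
      have := h e (by simp)
      omega
    · simp [hp]

/-- The bounds of the levels below the top form a geometric series. This is the linear space bound
once `2 ^ L * (2 * L + 3)` is of order `n`. -/
theorem Conga.length_le {n L k : ℕ} {lv : ℕ → ℕ} (h : Conga n L k dm live lv l) :
    l.length ≤ 2 * n + 2 * (2 ^ L * (2 * L + 3)) := by
  have h1 := countP_eq_sum_lev (L := L) (fun _ => True) l fun e he => (h.edge e he).2.2.2
  simp only [decide_true, List.countP_true, true_and] at h1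
  rw [h1, Finset.sum_range_succ]
  have h2 : ∑ i ∈ Finset.range L, l.countP (fun e => e.lev = i) ≤
      ∑ i ∈ Finset.range L, 2 ^ i * (2 * (2 * L + 3)) :=
    Finset.sum_le_sum fun i hi => (h.count i (Finset.mem_range.1 hi)).trans (le_of_eq (by ring))
  rw [← Finset.sum_mul, Nat.geomSum_eq le_rfl] at h2
  have h3 : (2 ^ L - 1) / (2 - 1) * (2 * (2 * L + 3)) ≤ 2 * (2 ^ L * (2 * L + 3)) := by
    rw [mul_left_comm]
    gcongr
    simp
  have := h.count_top
  omega

/-- The merged slot, and the slots with an edge to one of the slots `a`, `b`. -/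
def fresh (a b : ℕ) (l : List CEdge) : Finset ℕ :=
  insert a ((l.filter fun e => e.tgt = a ∨ e.tgt = b).map CEdge.src).toFinset

/-- The slots for which a new conga line of level `j` is built when `a` and `b` are merged. -/
def batch (live : Finset ℕ) (lv : ℕ → ℕ) (l : List CEdge) (a b j : ℕ) : Finset ℕ :=
  (live.erase b).filter fun i => lv i ≤ j ∨ i ∈ fresh a b l

/-- The edges that are kept when `a` and `b` are merged and the levels up to `j` are rebuilt. -/
def keeps (a b j : ℕ) (e : CEdge) : Prop :=
  (e.src ≠ a ∧ e.src ≠ b) ∧ (e.tgt ≠ a ∧ e.tgt ≠ b) ∧ j < e.lev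

instance (a b j : ℕ) : DecidablePred (keeps a b j) := fun e => by unfold keeps; infer_instance

theorem batch_subset {lv : ℕ → ℕ} : batch live lv l a b j ⊆ live.erase b :=
  Finset.filter_subset _ _

theorem mem_batch_self {lv : ℕ → ℕ} (ha : a ∈ live) (hab : a ≠ b) :
    a ∈ batch live lv l a b j :=
  Finset.mem_filter.2 ⟨Finset.mem_erase.2 ⟨hab, ha⟩, .inr (Finset.mem_insert_self _ _)⟩

/-- Each of the `L + 1` levels has at most one edge into a given slot. Two targets and the merged
slot itself give `2 * (L + 1) + 1`. -/
theorem Conga.card_fresh_le {n L k : ℕ} {lv : ℕ → ℕ} (h : Conga n L k dm live lv l) :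
    (fresh a b l).card ≤ 2 * L + 3 := by
  have key : ∀ x, l.countP (fun e => e.tgt = x) ≤ L + 1 := fun x => by
    rw [countP_eq_sum_lev (L := L) (fun e => e.tgt = x) l fun e he => (h.edge e he).2.2.2]
    exact (Finset.sum_le_sum fun i _ => h.indeg x i).trans (by simp)
  have hor : l.countP (fun e => e.tgt = a ∨ e.tgt = b) ≤
      l.countP (fun e => e.tgt = a) + l.countP (fun e => e.tgt = b) := by
    clear h key
    induction l with
    | nil => simp
    | cons e l ih =>
      simp only [List.countP_cons]
      by_cases h1 : e.tgt = a <;> by_cases h2 : e.tgt = b <;>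
        simp only [h1, h2, or_self, or_true, true_or, decide_true, decide_false, if_true] <;>
        (try simp only [reduceCtorEq, if_false]) <;> omega
  have h1 := Finset.card_insert_le a
    ((l.filter fun e => e.tgt = a ∨ e.tgt = b).map CEdge.src).toFinset
  have h2 := List.toFinset_card_le ((l.filter fun e => e.tgt = a ∨ e.tgt = b).map CEdge.src)
  rw [List.length_map, ← List.countP_eq_length_filter] at h2
  have ka := key a
  have kb := key b
  unfold fresh
  omega

/-- An upper bound for the size of the batch of the step `t`. -/
def batchBound (n L t : ℕ) : ℕ :=
  ∑ i ∈ Finset.range L, (if 2 ^ i ∣ t then 2 ^ i * (2 * L + 3) else 0) + if 2 ^ L ∣ t then n else 0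

/-- The level of the conga line that is built in the step `t`. -/
structure IsLevel (L t j : ℕ) : Prop where
  le : j ≤ L
  dvd : 2 ^ j ∣ t
  not_dvd : j < L → ¬ 2 ^ (j + 1) ∣ t

/-- Here `k + 1` is an odd multiple of `2 ^ j`, so the counter `k % 2 ^ (j + 1)` stands at `2 ^ j -
1`. This leaves room for exactly one more set of fresh slots. -/
theorem Conga.card_filter_le {n L k : ℕ} {lv : ℕ → ℕ} (h : Conga n L k dm live lv l)
    (hj : IsLevel L (k + 1) j) (hjL : j < L) :
    (live.filter fun p => lv p ≤ j).card + (2 * L + 3) ≤ 2 ^ j * (2 * L + 3) := by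
  have h1 : k % 2 ^ (j + 1) + 1 = 2 ^ j := by
    obtain ⟨c, hc⟩ := hj.dvd
    have hodd : c % 2 = 1 := by
      by_contra hc2
      refine hj.not_dvd hjL ⟨c / 2, ?_⟩
      have : c = 2 * (c / 2) := by omega
      rw [hc, pow_succ, mul_assoc, ← this]
    have h2 : k + 1 = 2 ^ j + 2 ^ (j + 1) * (c / 2) := by
      have : c = 1 + 2 * (c / 2) := by omega
      rw [hc, pow_succ]
      conv_lhs => rw [this]
      ring
    have hp : 0 < 2 ^ j := by positivity
    have h3 : k = 2 ^ j - 1 + 2 ^ (j + 1) * (c / 2) := by omega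
    rw [h3, Nat.add_mul_mod_self_left, Nat.mod_eq_of_lt]
    · omega
    · rw [pow_succ]; omega
  have h2 := h.few j hjL
  calc _ ≤ k % 2 ^ (j + 1) * (2 * L + 3) + (2 * L + 3) := by omega
    _ = (k % 2 ^ (j + 1) + 1) * (2 * L + 3) := by ring
    _ = _ := by rw [h1]

theorem Conga.card_batch_le {n L k : ℕ} {lv : ℕ → ℕ} (h : Conga n L k dm live lv l) :
    (batch live lv l a b j).card ≤ (live.filter fun p => lv p ≤ j).card + (2 * L + 3) := by
  refine le_trans (Finset.card_le_card (t := live.filter (fun p => lv p ≤ j) ∪ fresh a b l) ?_)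
    ((Finset.card_union_le _ _).trans (by have := h.card_fresh_le (a := a) (b := b); omega))
  intro i
  simp only [batch, Finset.mem_filter, Finset.mem_union, Finset.mem_erase]
  tauto

/-- `batchBound` charges every level whose power of two divides the step, not only the one that is
built. The overestimate does not mention `j`, so it can be summed over the steps by counting
multiples. -/
theorem Conga.card_batch_le_batchBound {n L k : ℕ} {lv : ℕ → ℕ}
    (h : Conga n L k dm live lv l) (hn : live.card ≤ n) (hj : IsLevel L (k + 1) j) :
    (batch live lv l a b j).card ≤ batchBound n L (k + 1) := by
  rcases hj.le.lt_or_eq with hjL | rfl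
  · refine (h.card_batch_le.trans (h.card_filter_le hj hjL)).trans ?_
    have := Finset.single_le_sum (f := fun i => if 2 ^ i ∣ k + 1 then 2 ^ i * (2 * L + 3) else 0)
      (fun i _ => Nat.zero_le _) (Finset.mem_range.2 hjL)
    simp only [hj.dvd, if_true] at this
    unfold batchBound
    omega
  · have h1 : (batch live lv l a b j).card ≤ n :=
      (Finset.card_le_card (batch_subset.trans (Finset.erase_subset _ _))).trans hn
    simp only [batchBound, hj.dvd, if_true]
    omega

/-- After exchanging the sums, level `i` occurs `n / 2 ^ i` times at a price of `2 ^ i * (2 * L +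
3)`, so each level below the top costs at most `n * (2 * L + 3)`. The hypothesis on `L` gives the
same bound for the full rebuilds of the top level. -/
theorem sum_batchBound_le {n L : ℕ} (hL : n ≤ 2 ^ L * (2 * L + 3)) :
    ∑ k ∈ Finset.range n, batchBound n L (k + 1) ≤ n * ((L + 1) * (2 * L + 3)) := by
  have key : ∀ c i, ∑ k ∈ Finset.range n, (if 2 ^ i ∣ k + 1 then c else 0) = n / 2 ^ i * c :=
    fun c i => by
      rw [← Finset.sum_filter, Finset.sum_const, Nat.card_multiples, smul_eq_mul]
  unfold batchBound
  rw [Finset.sum_add_distrib, Finset.sum_comm, key]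
  simp only [key]
  have h1 : ∑ i ∈ Finset.range L, n / 2 ^ i * (2 ^ i * (2 * L + 3)) ≤
      ∑ i ∈ Finset.range L, n * (2 * L + 3) := Finset.sum_le_sum fun i _ => by
    rw [← mul_assoc]
    exact Nat.mul_le_mul_right _ (Nat.div_mul_le_self _ _)
  have h2 : n / 2 ^ L * n ≤ (2 * L + 3) * n :=
    Nat.mul_le_mul_right _ (Nat.div_le_of_le_mul hL)
  rw [Finset.sum_const, Finset.card_range, smul_eq_mul] at h1
  calc _ ≤ L * (n * (2 * L + 3)) + (2 * L + 3) * n := add_le_add h1 h2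
    _ = _ := by ring

/-- A single line for all slots, placed on the top level; the lower levels start empty. -/
theorem Conga.init {n L : ℕ} (hn : live.card ≤ n) {lv : ℕ → ℕ} (hlv : ∀ i ∈ live, lv i = L)
    (hl : Line dm live live L l) : Conga n L 0 dm live lv l := by
  refine ⟨?_, ?_, ?_, ?_, ?_, fun i hi => (hlv i hi).le, ?_⟩
  · intro e he
    obtain ⟨h1, h2, h3, h4⟩ := hl.edge e he
    exact ⟨h1, h2, h3, h4.le⟩
  · intro p hp q hq hpq
    obtain ⟨e, he, h1, h2⟩ := hl.cover p hp q hq hpq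
    exact ⟨e, he, h1, h2, .inl (by rw [hlv p hp, (hl.edge e he).2.2.2])⟩
  · intro x i
    refine le_trans (List.countP_mono_left ?_) (hl.indeg x)
    simp +contextual
  · intro i hi
    rw [List.countP_eq_zero.2]
    · simp
    · intro e he
      have := (hl.edge e he).2.2.2
      simp; omega
  · exact List.countP_le_length.trans (hl.length.trans (by omega))
  · intro i hi
    rw [Finset.card_eq_zero.2]
    · simp
    · rw [Finset.filter_eq_empty_iff]
      intro p hp
      rw [hlv p hp]; omega

/-- A pair meeting the batch is covered by the new line. For any other pair the old covering edge
survives: its level is at least that of one of the two slots, hence above `j`, and it avoids `a` and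
`b`, because an edge into one of them would make its source fresh. The distances in question do not
involve the merged slot and are unchanged. -/
theorem Conga.merge {n L k : ℕ} {lv lv' : ℕ → ℕ} {l' : List CEdge}
    (h : Conga n L k dm live lv l) (hn : live.card ≤ n) (ha : a ∈ live) (hab : a ≠ b)
    (hj : IsLevel L (k + 1) j) (hsym : ∀ p q, dm' p q = dm' q p)
    (hdm : ∀ p ∈ live, ∀ q ∈ live, p ≠ a → p ≠ b → q ≠ a → q ≠ b → dm' p q = dm p q)
    (hlv : ∀ i ∈ live.erase b, lv' i = if i ∈ batch live lv l a b j then j else lv i)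
    (hl : Line dm' (live.erase b) (batch live lv l a b j) j l') :
    Conga n L (k + 1) dm' (live.erase b) lv' (l.filter (fun e => keeps a b j e) ++ l') := by
  set B := batch live lv l a b j with hBdef
  have hB : ∀ i ∈ live, i ≠ b → i ∉ B → j < lv i ∧ i ∉ fresh a b l := by
    intro i hi hib hiB
    simp only [hBdef, batch, Finset.mem_filter, Finset.mem_erase] at hiB
    by_contra hc
    refine hiB ⟨⟨hib, hi⟩, ?_⟩
    by_contra hc'
    push Not at hc'
    exact hc hc'
  have haB : a ∈ B := mem_batch_self ha hab
  have hl'count : ∀ i, i ≠ j → l'.countP (fun e => e.lev = i) = 0 := fun i hi => by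
    rw [List.countP_eq_zero]
    intro e he
    have := (hl.edge e he).2.2.2
    simp; omega
  have hkcount : (l.filter (fun e => keeps a b j e)).countP (fun e => e.lev = j) = 0 := by
    rw [List.countP_eq_zero]
    intro e he
    have := (of_decide_eq_true (List.mem_filter.1 he).2).2.2
    simp; omega
  have hBcard : (j < L → B.card ≤ 2 ^ j * (2 * L + 3)) ∧ B.card ≤ n :=
    ⟨fun hjL => h.card_batch_le.trans (h.card_filter_le hj hjL),
      (Finset.card_le_card (batch_subset.trans (Finset.erase_subset _ _))).trans hn⟩
  refine ⟨?_, ?_, ?_, ?_, ?_, ?_, ?_⟩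
  · intro e he
    rcases List.mem_append.1 he with he | he
    · obtain ⟨he, hk⟩ := List.mem_filter.1 he
      have hk := of_decide_eq_true hk
      obtain ⟨h1, h2, h3, h4⟩ := h.edge e he
      exact ⟨by simp [hk.1.2, h1], by simp [hk.2.1.2, h2], h3, h4⟩
    · obtain ⟨h1, h2, h3, h4⟩ := hl.edge e he
      exact ⟨h1, h2, h3, h4 ▸ hj.le⟩
  · intro p hp q hq hpq
    rw [hlv p hp, hlv q hq]
    by_cases hpB : p ∈ B
    · obtain ⟨e, he, h1, h2⟩ := hl.cover p hpB q hq hpq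
      exact ⟨e, by simp [he], h1, h2, .inl (by simp [hpB, (hl.edge e he).2.2.2])⟩
    by_cases hqB : q ∈ B
    · obtain ⟨e, he, h1, h2⟩ := hl.cover q hqB p hp hpq.symm
      exact ⟨e, by simp [he], h1.symm, hsym q p ▸ h2, .inr (by simp [hqB, (hl.edge e he).2.2.2])⟩
    rw [Finset.mem_erase] at hp hq
    obtain ⟨hp1, hp2⟩ := hB p hp.2 hp.1 hpB
    obtain ⟨hq1, hq2⟩ := hB q hq.2 hq.1 hqB
    obtain ⟨e, he, h1, h2, h3⟩ := h.cover p hp.2 q hq.2 hpq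
    have hpa : p ≠ a := fun e => hpB (e ▸ haB)
    have hqa : q ≠ a := fun e => hqB (e ▸ haB)
    have hsrc : e.src ≠ a ∧ e.src ≠ b := by
      rcases h1 with h1 | h1 <;> rw [h1]
      exacts [⟨hpa, hp.1⟩, ⟨hqa, hq.1⟩]
    -- Otherwise the source, which is `p` or `q`, would be fresh and belong to the batch.
    have htgt : e.tgt ≠ a ∧ e.tgt ≠ b := by
      by_contra hc
      have : e.src ∈ fresh a b l := by
        simp only [fresh, Finset.mem_insert, List.mem_toFinset, List.mem_map, List.mem_filter,
          decide_eq_true_eq]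
        exact .inr ⟨e, ⟨he, by tauto⟩, rfl⟩
      rcases h1 with h1 | h1 <;> rw [h1] at this
      exacts [hp2 this, hq2 this]
    have hlev : j < e.lev := by
      rcases h3 with h3 | h3 <;> omega
    refine ⟨e, by simp [he, keeps, hsrc, htgt, hlev], h1, ?_, by simpa [hpB, hqB] using h3⟩
    obtain ⟨e1, e2, -, -⟩ := h.edge e he
    rw [hdm _ e1 _ e2 hsrc.1 hsrc.2 htgt.1 htgt.2, hdm p hp.2 q hq.2 hpa hp.1 hqa hq.1]
    exact h2
  · intro x i
    rw [List.countP_append]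
    by_cases hi : i = j
    · subst hi
      have h1 : (l.filter (fun e => keeps a b i e)).countP (fun e => e.tgt = x ∧ e.lev = i) = 0 := by
        refine Nat.eq_zero_of_le_zero (hkcount ▸ List.countP_mono_left ?_)
        simp +contextual
      have h2 : l'.countP (fun e => e.tgt = x ∧ e.lev = i) ≤ 1 := by
        refine le_trans (List.countP_mono_left ?_) (hl.indeg x)
        simp +contextual
      omega
    · have h1 : l'.countP (fun e => e.tgt = x ∧ e.lev = i) = 0 := by
        refine Nat.eq_zero_of_le_zero (hl'count i hi ▸ List.countP_mono_left ?_)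
        simp +contextual
      rw [h1]
      exact (List.filter_sublist.countP_le).trans (h.indeg x i)
  · intro i hi
    rw [List.countP_append]
    by_cases hij : i = j
    · subst hij
      rw [hkcount, zero_add]
      exact List.countP_le_length.trans (hl.length.trans (by have := hBcard.1 hi; omega))
    · rw [hl'count i hij]
      exact (List.filter_sublist.countP_le).trans (h.count i hi)
  · rw [List.countP_append]
    by_cases hij : L = j
    · subst hij
      rw [hkcount, zero_add]
      exact List.countP_le_length.trans (hl.length.trans (by have := hBcard.2; omega))
    · rw [hl'count L hij]
      exact (List.filter_sublist.countP_le).trans h.count_top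
  · intro i hi
    rw [hlv i hi]
    split_ifs
    · exact hj.le
    · exact h.lev_le i (Finset.mem_of_mem_erase hi)
  · intro i hi
    -- When the counter modulo `2 ^ (i + 1)` returns to zero, the level being built exceeds `i` and
    -- no slot of level at most `i` remains. Otherwise the counter grows by one, and only fresh
    -- slots can join the slots of low level.
    by_cases hd : 2 ^ (i + 1) ∣ k + 1
    · have hij : i < j := by
        by_contra hc
        exact hj.not_dvd (by omega) ((pow_dvd_pow 2 (by omega)).trans hd)
      rw [Finset.card_eq_zero.2]
      · simp
      · rw [Finset.filter_eq_empty_iff]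
        intro p hp
        rw [hlv p hp]
        split_ifs with hpB
        · omega
        · rw [Finset.mem_erase] at hp
          have := (hB p hp.2 hp.1 hpB).1
          omega
    · have hji : j ≤ i := by
        by_contra hc
        exact hd ((pow_dvd_pow 2 (by omega)).trans hj.dvd)
      have hmod : (k + 1) % 2 ^ (i + 1) = k % 2 ^ (i + 1) + 1 := by
        have h1 := Nat.div_add_mod k (2 ^ (i + 1))
        have h2 := Nat.mod_lt k (show 0 < 2 ^ (i + 1) by positivity)
        refine (Nat.mod_eq_iff.2 (.inr ⟨?_, k / 2 ^ (i + 1), by omega⟩))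
        refine lt_of_le_of_ne h2 fun h3 => hd ⟨k / 2 ^ (i + 1) + 1, ?_⟩
        rw [mul_add]
        omega
      rw [hmod, add_mul, one_mul]
      refine le_trans (Finset.card_le_card
        (t := live.filter (fun p => lv p ≤ i) ∪ fresh a b l) ?_) ((Finset.card_union_le _ _).trans
          (add_le_add (h.few i hi) h.card_fresh_le))
      intro p hp
      rw [Finset.mem_filter] at hp
      obtain ⟨hp, hle⟩ := hp
      rw [hlv p hp] at hle
      have hp' := Finset.mem_of_mem_erase hp
      split_ifs at hle with hpB
      · simp only [hBdef, batch, Finset.mem_filter] at hpB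
        rcases hpB.2 with h1 | h1
        · exact Finset.mem_union_left _ (by simp [hp']; omega)
        · exact Finset.mem_union_right _ h1
      · exact Finset.mem_union_left _ (by simp [hp', hle])

end Conga

end Agglomerative

namespace Agglomerative

/-! ## The conga line program

Register `0` holds the number `n` of objects, `1` the top level, `2` the number of mergers,
`3` the number of edges, `4` and `5` the slots to be merged, `6` the level of the new conga line,
`7` its current end and `8` the mark of that end, `9` tells whether the line may be extended, and
`10` holds the nearest neighbour.  The word memory holds the output in the cells below `2 n`, then
the labels, the levels (increased by one; zero for an empty slot) and the marks of the slots, and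
from `5 n` on the edges. -/

/-- The cell `e` of the `k`-th array of length `n`. -/
abbrev cell (k : ℕ) (e : Expr) : Expr := .add (.mul (.lit k) (.reg 0)) e

/-- The field `f` of the edge `e`. -/
abbrev edgeCell (e : Expr) (f : ℕ) : Expr :=
  .add (.mul (.lit 5) (.reg 0)) (.add (.mul (.lit 3) e) (.lit f))

/-- Stores the smaller one of the two distances between the slots in the registers `p`, `q` in the
distance cell `1`. -/
def minDist (p q : ℕ) : Cmd :=
  .evalDist (.lit 1) (.reg p) (.reg q) ;; .evalDist (.lit 2) (.reg q) (.reg p) ;;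
  .ite (.leDist (.lit 1) (.lit 2)) .skip (.copyDist (.lit 1) (.lit 2))

/-- The value `n` in register `10` means that no candidate has been met. Distance cell `0` keeps the
best distance so far, and cells `1` and `2` are scratch, so distances take constant space. -/
def searchBody : Cmd :=
  .ite (.lt (.lit 2) (.add (.mem (cell 4 (.reg 11))) (.reg 8)))
    (minDist 7 11 ;;
      .ite (.eq (.reg 10) (.reg 0))
        (.setReg 10 (.reg 11) ;; .copyDist (.lit 0) (.lit 1))
        (.ite (.leDist (.lit 0) (.lit 1)) .skip
          (.setReg 10 (.reg 11) ;; .copyDist (.lit 0) (.lit 1))))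
    .skip ;;
  .setReg 11 (.add (.reg 11) (.lit 1))

/-- Searches the nearest neighbour of the end of the conga line. -/
def search : Cmd :=
  .setReg 10 (.reg 0) ;; .setReg 11 (.lit 0) ;; .while (.lt (.reg 11) (.reg 0)) searchBody

section

variable {Ob : Type u} {D : Type v} [LinearOrder D] {ops : Ops Ob D} {W S n : ℕ}
  {σ : State Ob D} {Q : State Ob D → Prop}

/-- The smaller one of the two distances between two slots. -/
def slotDist (ops : Ops Ob D) (ob : ℕ → Ob) (p q : ℕ) : D :=
  min (ops.dist (ob p) (ob q)) (ops.dist (ob q) (ob p))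

theorem slotDist_comm (ops : Ops Ob D) (ob : ℕ → Ob) (p q : ℕ) :
    slotDist ops ob p q = slotDist ops ob q p := min_comm _ _

theorem wp_minDist {ob : ℕ → Ob} {p q : ℕ} (hS : 3 ≤ S) (hW : S ≤ W)
    (hp : σ.reg p < S) (hq : σ.reg q < S)
    (ho : σ.obj (σ.reg p) = some (ob (σ.reg p))) (ho' : σ.obj (σ.reg q) = some (ob (σ.reg q)))
    (h : ∀ τ : State Ob D, τ.reg = σ.reg → τ.mem = σ.mem → τ.obj = σ.obj → τ.dst 0 = σ.dst 0 →
      τ.dst 1 = some (slotDist ops ob (σ.reg p) (σ.reg q)) → Q τ) :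
    (minDist p q).Wp ops W S Q σ := by
  simp only [minDist, Cmd.Wp, Expr.AddrOk, Expr.Ok, Expr.val, Test.Ok, Test.Holds]
  refine ⟨⟨by omega, by omega⟩, ⟨by omega, hp⟩, ⟨by omega, hq⟩, _, ho, _, ho', ?_⟩
  refine ⟨⟨by omega, by omega⟩, ⟨?_, hq⟩, ⟨?_, hp⟩, _, ho', _, ho, ?_⟩
  · simp; omega
  · simp; omega
  refine ⟨⟨⟨by omega, by omega⟩, ⟨by omega, by omega⟩, by simp⟩, fun hle => ?_,
    fun hle => ⟨⟨by omega, by omega⟩, ⟨by omega, by omega⟩, ops.dist (ob (σ.reg q)) (ob (σ.reg p)), by simp, ?_⟩⟩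
  · simp at hle
    exact h _ rfl rfl rfl (by simp) (by simp [slotDist, hle])
  · simp at hle
    exact h _ rfl rfl rfl (by simp) (by simp [slotDist, hle.le])

/-- The slot may be appended to a conga line that ends in a slot with mark `cf`. -/
def Candidate (n : ℕ) (σ : State Ob D) (i : ℕ) : Prop :=
  i < n ∧ 2 < σ.mem (4 * n + i) + σ.reg 8

theorem runs_search {ob : ℕ → Ob} (hS : 60 * (n + 1) ≤ S) (hW : S ≤ W) (hn : σ.reg 0 = n)
    (hcur : σ.reg 7 < n) (hcf : σ.reg 8 ≤ 2) (hmark : ∀ i < n, σ.mem (4 * n + i) ≤ 2)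
    (hobj : ∀ i, i = σ.reg 7 ∨ Candidate n σ i → σ.obj i = some (ob i)) :
    Runs ops W S search (60 * (n + 1)) σ fun τ =>
      (∀ r < 10, τ.reg r = σ.reg r) ∧ τ.mem = σ.mem ∧ τ.obj = σ.obj ∧
      ((τ.reg 10 = n ∧ ∀ i, ¬ Candidate n σ i) ∨
        (Candidate n σ (τ.reg 10) ∧ ∀ i, Candidate n σ i →
          slotDist ops ob (σ.reg 7) (τ.reg 10) ≤ slotDist ops ob (σ.reg 7) i)) := by
  have key : ∀ τ : State Ob D, (∀ r < 10, τ.reg r = σ.reg r) → τ.mem = σ.mem → τ.obj = σ.obj →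
      τ.reg 10 = n → τ.reg 11 = 0 →
      Runs ops W S (.while (.lt (.reg 11) (.reg 0)) searchBody) (n * (3 + 50) + 3) τ fun τ =>
      (∀ r < 10, τ.reg r = σ.reg r) ∧ τ.mem = σ.mem ∧ τ.obj = σ.obj ∧
      ((τ.reg 10 = n ∧ ∀ i, ¬ Candidate n σ i) ∨
        (Candidate n σ (τ.reg 10) ∧ ∀ i, Candidate n σ i →
          slotDist ops ob (σ.reg 7) (τ.reg 10) ≤ slotDist ops ob (σ.reg 7) i)) := by
    intro τ h1 h2 h3 h4 h5
    let I : ℕ → State Ob D → Prop := fun i τ =>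
      (∀ r < 10, τ.reg r = σ.reg r) ∧ τ.mem = σ.mem ∧ τ.obj = σ.obj ∧ τ.reg 11 = i ∧
      ((τ.reg 10 = n ∧ ∀ i' < i, ¬ Candidate n σ i') ∨
        (Candidate n σ (τ.reg 10) ∧
          τ.dst 0 = some (slotDist ops ob (σ.reg 7) (τ.reg 10)) ∧ ∀ i' < i, Candidate n σ i' →
          slotDist ops ob (σ.reg 7) (τ.reg 10) ≤ slotDist ops ob (σ.reg 7) i'))
    refine Runs.while_count (lo := 0) (hi := n) (C := 50) I (Nat.zero_le n) ?_ ?_ ⟨h1, h2, h3, h5, .inl ⟨h4, by simp⟩⟩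
    · rintro i τ - hi ⟨h1, h2, h3, h4, h5⟩
      have r0 := h1 0 (by omega)
      have r7 := h1 7 (by omega)
      have r8 := h1 8 (by omega)
      have hm := hmark i hi
      refine ⟨by simp; omega, by simp; omega, Runs.of_wp_le (by decide) ?_⟩
      rw [searchBody, Cmd.Wp, Cmd.Wp]
      refine ⟨?_, fun hc => ?_, fun hc => ?_⟩
      · simp [r0, h2, h4, r8, hn]; omega
      · simp only [Test.Holds, Expr.val, r0, h4, h2, r8, hn] at hc
        have hci : Candidate n σ i := ⟨hi, hc⟩
        rw [Cmd.Wp]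
        refine wp_minDist (ob := ob) (by omega) hW (by omega) (by omega) ?_ ?_ ?_
        · rw [h3, r7]; exact hobj _ (.inl rfl)
        · rw [h3, h4]; exact hobj _ (.inr hci)
        intro τ' g1 g2 g3 g4 g5
        rw [r7, h4] at g5
        simp only [Cmd.Wp]
        have hreg : ∀ r < 10, τ'.reg r = σ.reg r := fun r hr => by rw [g1, h1 r hr]
        have take : (∀ i' < i, Candidate n σ i' →
            slotDist ops ob (σ.reg 7) i ≤ slotDist ops ob (σ.reg 7) i') →
            (Cmd.setReg 10 (.reg 11) ;; .copyDist (.lit 0) (.lit 1)).Wp ops W S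
              ((Cmd.setReg 11 (.add (.reg 11) (.lit 1))).Wp ops W S (I (i + 1))) τ' := by
          intro hmin
          simp only [Cmd.Wp, Expr.Ok, Expr.AddrOk, Expr.val]
          refine ⟨by rw [g1]; omega, ⟨by omega, by omega⟩, ⟨by omega, by omega⟩, _, g5, ?_, ?_⟩
          · simp [g1]; omega
          refine ⟨fun r hr => ?_, by simp [g2, h2], by simp [g3, h3], by simp [g1, h4], .inr ?_⟩
          · simp [show r ≠ 10 by omega, show r ≠ 11 by omega, hreg r hr]
          · simp only [State.reg_setReg, State.reg_setDist, g1, h4]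
            refine ⟨hci, by simp, fun i' hi' hc' => ?_⟩
            rcases Nat.lt_succ_iff_lt_or_eq.1 hi' with hi' | rfl
            · simpa using hmin i' hi' hc'
            · simp
        have h10 : τ.reg 10 ≤ n := by
          rcases h5 with ⟨h, -⟩ | ⟨h, -⟩
          exacts [h.le, h.1.le]
        refine ⟨by simp [g1, r0]; omega, fun hx => ?_, fun hx => ?_⟩
        · refine take fun i' hi' hc' => ?_
          simp only [Expr.val, Test.Holds, g1, r0, hn] at hx
          rcases h5 with ⟨h5, h6⟩ | ⟨h5, h6, h7⟩
          · exact absurd hc' (h6 i' hi')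
          · exact absurd hx h5.1.ne
        · simp only [Expr.val, Test.Holds, g1, r0, hn] at hx
          rcases h5 with ⟨h5, h6⟩ | ⟨h5, h6, h7⟩
          · exact absurd h5 hx
          rw [← g4] at h6
          refine ⟨by simp [h6, g5]; omega, fun hle => ?_, fun hle => ?_⟩
          · simp only [Test.Holds, Expr.val, h6, g5, Option.some.injEq] at hle
            have hle := hle _ _ rfl rfl
            refine ⟨by simp [g1]; omega, fun r hr => ?_, by simp [g2, h2], by simp [g3, h3],
              by simp [g1, h4], .inr ?_⟩
            · simp [show r ≠ 11 by omega, hreg r hr]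
            · refine ⟨by simpa [g1] using h5, by simpa [g1] using h6, fun i' hi' hc' => ?_⟩
              rcases Nat.lt_succ_iff_lt_or_eq.1 hi' with hi' | rfl
              · simpa [g1] using h7 i' hi' hc'
              · simpa [g1] using hle
          · refine take fun i' hi' hc' => ?_
            simp [h6, g5] at hle
            exact hle.le.trans (h7 i' hi' hc')
      · simp only [Test.Holds, Expr.val, r0, h4, h2, r8, hn] at hc
        have hci : ¬ Candidate n σ i := fun h => hc h.2
        refine ⟨by simp; omega, fun r hr => ?_, by simp [h2], by simp [h3], by simp [h4], ?_⟩
        · simp [show r ≠ 11 by omega, h1 r hr]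
        simp only [State.reg_setReg, State.dst_setReg]
        refine h5.imp (fun h => ⟨h.1, fun i' hi' => ?_⟩) fun h => ⟨h.1, h.2.1, fun i' hi' hc' => ?_⟩
        all_goals rcases Nat.lt_succ_iff_lt_or_eq.1 hi' with hi' | rfl
        exacts [h.2 i' hi', hci, h.2.2 i' hi' hc', absurd hc' hci]
    · rintro τ ⟨h1, h2, h3, h4, h5⟩
      have r0 := h1 0 (by omega)
      refine ⟨by simp; omega, by simp; omega, h1, h2, h3, ?_⟩
      rcases h5 with ⟨h5, h6⟩ | ⟨h5, h6, h7⟩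
      · exact .inl ⟨h5, fun i hi => h6 i hi.1 hi⟩
      · exact .inr ⟨h5, fun i hi => h7 i hi.1 hi⟩
  refine Runs.mono (T := 2 + (2 + (n * (3 + 50) + 3))) ?_ (by omega) fun _ => id
  refine .seq (Runs.of_wp_le (by decide) ?_)
  refine ⟨by simp; omega, .seq (Runs.of_wp_le (by decide) ?_)⟩
  refine ⟨by simp, key _ ?_ rfl rfl ?_ ?_⟩
  · intro r hr
    have : r ≠ 10 := by omega
    have : r ≠ 11 := by omega
    simp [*]
  · simp [hn]
  · simp

end

/-- Appends the nearest neighbour to the conga line, if there is one. -/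
def extend : Cmd :=
  search ;;
  .ite (.eq (.reg 10) (.reg 0)) (.setReg 9 (.lit 0))
    (.store (edgeCell (.reg 3) 0) (.reg 7) ;;
      .store (edgeCell (.reg 3) 1) (.reg 10) ;;
      .store (edgeCell (.reg 3) 2) (.reg 6) ;;
      .setReg 3 (.add (.reg 3) (.lit 1)) ;;
      .setReg 8 (.mem (cell 4 (.reg 10))) ;;
      .store (cell 4 (.reg 10)) (.lit 0) ;;
      .setReg 7 (.reg 10))

/-- Builds a conga line for the marked slots, starting at the slot in register `7`. -/
def buildLine : Cmd :=
  (.setReg 8 (.lit 2) ;; .store (cell 4 (.reg 7)) (.lit 0) ;; .setReg 9 (.lit 1)) ;;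
  .while (.eq (.reg 9) (.lit 1)) extend

/-- The word memory holds the edges `l`. -/
def EdgesIn (n : ℕ) (mem : ℕ → ℕ) (l : List CEdge) : Prop :=
  ∀ i (h : i < l.length), mem (5 * n + 3 * i) = l[i].src ∧ mem (5 * n + (3 * i + 1)) = l[i].tgt ∧
    mem (5 * n + (3 * i + 2)) = l[i].lev

theorem EdgesIn.congr {n : ℕ} {mem mem' : ℕ → ℕ} {l : List CEdge} (h : EdgesIn n mem l)
    (hm : ∀ i, 5 * n ≤ i → i < 5 * n + 3 * l.length → mem' i = mem i) : EdgesIn n mem' l := by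
  intro i hi
  rw [hm _ (by omega) (by omega), hm _ (by omega) (by omega), hm _ (by omega) (by omega)]
  exact h i hi

theorem EdgesIn.append {n : ℕ} {mem : ℕ → ℕ} {l : List CEdge} (h : EdgesIn n mem l) {e : CEdge}
    (h0 : mem (5 * n + 3 * l.length) = e.src) (h1 : mem (5 * n + (3 * l.length + 1)) = e.tgt)
    (h2 : mem (5 * n + (3 * l.length + 2)) = e.lev) : EdgesIn n mem (l ++ [e]) := by
  intro i hi
  simp only [List.length_append, List.length_singleton] at hi
  rcases Nat.lt_succ_iff_lt_or_eq.1 hi with hi | rfl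
  · simpa [List.getElem_append_left hi] using h i hi
  · simp [h0, h1, h2]

section

variable {Ob : Type u} {D : Type v} [LinearOrder D] {ops : Ops Ob D} {W S n : ℕ}
  {σ : State Ob D} {Q : State Ob D → Prop}

/-- The memory mark of a visited slot is overwritten by zero. As marks are at most two, such a slot
fails the candidate test, so no separate visited set is stored. The mark of the current end is kept
in register `8`. -/
theorem runs_buildLine {ob : ℕ → Ob} {live B : Finset ℕ} {j : ℕ} {l : List CEdge}
    (hS : 60 * (n + 1) ≤ S) (hW : S ≤ W) (hn : σ.reg 0 = n) (hlive : live ⊆ Finset.range n)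
    (hB : B ⊆ live) (hcur : σ.reg 7 ∈ B) (hj : σ.reg 6 = j) (hjn : j ≤ S)
    (hE : EdgesIn n σ.mem l) (hl : σ.reg 3 = l.length) (hl' : l.length ≤ 14 * n)
    (hmark : ∀ i < n, σ.mem (4 * n + i) = mark live B i)
    (hobj : ∀ i ∈ live, σ.obj i = some (ob i)) :
    Runs ops W S buildLine ((B.card + 1) * (300 * (n + 1))) σ fun τ =>
      (∀ r < 3, τ.reg r = σ.reg r) ∧ (∀ i < 4 * n, τ.mem i = σ.mem i) ∧ τ.obj = σ.obj ∧
      ∃ l', Line (slotDist ops ob) live B j l' ∧ EdgesIn n τ.mem (l ++ l') ∧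
        τ.reg 3 = (l ++ l').length := by
  have hlt : ∀ i ∈ live, i < n := fun i hi => Finset.mem_range.1 (hlive hi)
  have hBn : B.card ≤ n := by simpa using Finset.card_le_card (hB.trans hlive)
  have ha := hlt _ (hB hcur)
  -- The fuel `f` counts the remaining searches: at most `2 * |B|` edges are appended, and one
  -- further search finds no candidate. After that search register `9` is zero and the fuel is
  -- irrelevant.
  let I : ℕ → State Ob D → Prop := fun f τ =>
    (∀ r < 3, τ.reg r = σ.reg r) ∧ τ.reg 6 = j ∧ (∀ i < 4 * n, τ.mem i = σ.mem i) ∧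
    τ.obj = σ.obj ∧ ∃ l', EdgesIn n τ.mem (l ++ l') ∧ τ.reg 3 = (l ++ l').length ∧
    ((τ.reg 9 = 0 ∧ Line (slotDist ops ob) live B j l') ∨
      (τ.reg 9 = 1 ∧ 2 * B.card + 1 ≤ f + l'.length ∧ τ.reg 8 = mark live B (τ.reg 7) ∧
        ∃ V, PartialLine (slotDist ops ob) live B V (τ.reg 7) j l' ∧
          ∀ i < n, τ.mem (4 * n + i) = if i ∈ V then 0 else mark live B i))
  have loop : ∀ τ, I (2 * B.card + 1) τ → Runs ops W S (.while (.eq (.reg 9) (.lit 1)) extend)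
      ((2 * B.card + 1) * (3 + (60 * (n + 1) + 60)) + 3) τ fun τ =>
      (∀ r < 3, τ.reg r = σ.reg r) ∧ (∀ i < 4 * n, τ.mem i = σ.mem i) ∧ τ.obj = σ.obj ∧
      ∃ l', Line (slotDist ops ob) live B j l' ∧ EdgesIn n τ.mem (l ++ l') ∧
        τ.reg 3 = (l ++ l').length := by
    intro τ hτ
    refine Runs.while_fuel I ?_ _ hτ
    rintro f τ ⟨h1, h2, h3, h4, l', h5, h6, h7⟩
    refine ⟨?_, fun hb => ?_, fun hb => ?_⟩
    · simp only [Test.Ok, Expr.Ok]; omega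
    · simp only [Test.Holds, Expr.val] at hb
      exact ⟨h1, h3, h4, l', (h7.resolve_right fun h => hb h.1).2, h5, h6⟩
    simp only [Test.Holds, Expr.val] at hb
    obtain ⟨-, hf, h8, V, hV, hm⟩ := h7.resolve_left fun h => by omega
    have hlen := hV.length
    have r0 := h1 0 (by omega)
    have hcl := hV.subset hV.cur_mem
    have hcn := hlt _ hcl
    have hmk := mark_le live B
    have hcand : ∀ i, Candidate n τ i ↔
        i ∈ live ∧ i ∉ V ∧ 2 < mark live B i + mark live B (τ.reg 7) := by
      intro i
      have := hmk (τ.reg 7)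
      constructor
      · rintro ⟨hi, hc⟩
        rw [hm i hi, h8] at hc
        split_ifs at hc with hiV
        · omega
        refine ⟨?_, hiV, hc⟩
        by_contra hil
        have : mark live B i = 0 := by
          simp only [mark, hil, if_false, show i ∉ B from fun h => hil (hB h)]
        omega
      · rintro ⟨hi, hiV, hc⟩
        refine ⟨hlt i hi, ?_⟩
        rw [hm i (hlt i hi), h8, if_neg hiV]
        exact hc
    refine ⟨f - 1, by omega, ?_⟩
    refine .seq (T := 60 * (n + 1)) (T' := 60)
      ((runs_search (ob := ob) hS hW (r0.trans hn) hcn (h8 ▸ hmk _) ?_ ?_).mono le_rfl ?_)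
    · intro i hi
      rw [hm i hi]
      split_ifs
      exacts [by omega, hmk i]
    · rintro i (rfl | hi)
      · rw [h4]; exact hobj _ hcl
      · rw [h4]; exact hobj _ ((hcand i).1 hi).1
    rintro τ' ⟨g1, g2, g3, g4⟩
    have q0 := g1 0 (by omega)
    have q3 := g1 3 (by omega)
    have q6 := g1 6 (by omega)
    have q7 := g1 7 (by omega)
    refine Runs.of_wp_le (by decide) ?_
    have h10 : τ'.reg 10 ≤ n := by
      rcases g4 with ⟨h, -⟩ | ⟨h, -⟩
      exacts [h.le, h.1.le]
    rw [List.length_append] at h6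
    refine ⟨by simp only [Test.Ok, Expr.Ok]; omega, fun hb => ?_, fun hb => ?_⟩
    · simp only [Test.Holds, Expr.val, q0, r0, hn] at hb
      refine ⟨by simp only [Expr.Ok]; omega, fun r hr => ?_, ?_, ?_, ?_, l', ?_, ?_, .inl ⟨rfl, ?_⟩⟩
      · simp [show r ≠ 9 by omega, g1 r (by omega), h1 r hr]
      · simp [q6, h2]
      · simpa [g2] using h3
      · simp [g3, h4]
      · simpa [g2] using h5
      · simp [q3, h6]
      · refine hV.line hB fun i hi hiV => ?_
        by_contra hc
        rcases g4 with ⟨-, hno⟩ | ⟨h, -⟩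
        · exact hno i ((hcand i).2 ⟨hi, hiV, by omega⟩)
        · exact absurd hb h.1.ne
    · simp only [Test.Holds, Expr.val, q0, r0, hn] at hb
      obtain ⟨hc, hmin⟩ := g4.resolve_left fun h => hb h.1
      obtain ⟨c1, c2, c3⟩ := (hcand _).1 hc
      have c0 := hlt _ c1
      have hnew := hV.step hB (slotDist_comm ops ob) c1 c2 c3 fun i hi hiV hc =>
        hmin i ((hcand i).2 ⟨hi, hiV, hc⟩)
      have hmnb : τ'.mem (4 * n + τ'.reg 10) = mark live B (τ'.reg 10) := by
        rw [g2, hm _ c0, if_neg c2]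
      have hmnb' := hmk (τ'.reg 10)
      simp [q0, r0, hn, q3, h6, q7, q6, h2, hmnb,
        show 4 * n + τ'.reg 10 ≠ 5 * n + 3 * (l.length + l'.length) by omega,
        show 4 * n + τ'.reg 10 ≠ 5 * n + (3 * (l.length + l'.length) + 1) by omega,
        show 4 * n + τ'.reg 10 ≠ 5 * n + (3 * (l.length + l'.length) + 2) by omega]
      refine ⟨by omega, by omega, by omega, by omega, by omega, by omega, by omega, by omega,
        by omega, by omega, ?_⟩
      refine ⟨fun r hr => ?_, by simp [q6, h2], fun i hi => ?_, by simp [g3, h4],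
        l' ++ [⟨τ.reg 7, τ'.reg 10, j⟩], ?_, by simp; omega,
        .inr ⟨?_, by simp; omega, by simp, insert (τ'.reg 10) V, by simpa using hnew,
          fun i hi => ?_⟩⟩
      · have := g1 r (by omega)
        have := h1 r hr
        simp [show r ≠ 7 by omega, show r ≠ 8 by omega, show r ≠ 3 by omega, *]
      · simp only [State.mem_setReg, State.mem_setMem]
        rw [if_neg (by omega), if_neg (by omega), if_neg (by omega), if_neg (by omega), g2, h3 i hi]
      · rw [← List.append_assoc]
        refine EdgesIn.append (h5.congr fun i hi hi' => ?_) ?_ ?_ ?_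
        · rw [List.length_append] at hi'
          simp only [State.mem_setReg, State.mem_setMem]
          rw [if_neg (by omega), if_neg (by omega), if_neg (by omega), if_neg (by omega), g2]
        all_goals simp only [State.mem_setReg, State.mem_setMem, List.length_append]
        · rw [if_neg (by omega), if_neg (by omega), if_neg (by omega), if_true]
        · rw [if_neg (by omega), if_neg (by omega), if_true]
        · rw [if_neg (by omega), if_true]
      · have := g1 9 (by omega)
        simp; omega
      · simp only [State.mem_setReg, State.mem_setMem, Finset.mem_insert]
        by_cases hi' : i = τ'.reg 10
        · simp [hi']
        · rw [if_neg (by omega), if_neg (by omega), if_neg (by omega), if_neg (by omega), g2,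
            hm i hi]
          simp [hi']
  refine Runs.mono (T := 30 + ((2 * B.card + 1) * (3 + (60 * (n + 1) + 60)) + 3)) ?_ ?_
    fun _ => id
  · refine .seq ((Runs.of_wp_le (Q := I (2 * B.card + 1)) (by decide) ?_).mono le_rfl loop)
    simp [hn]
    refine ⟨by omega, by omega, by omega, ?_⟩
    refine ⟨fun r hr => ?_, by simp [hj], fun i hi => ?_, by simp, [], ?_, by simp [hl],
        .inr ⟨by simp, by simp, by simp [mark, hcur], {σ.reg 7},
          by simpa using PartialLine.init hB hcur, fun i hi => ?_⟩⟩
    · simp [show r ≠ 8 by omega, show r ≠ 9 by omega]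
    · simp only [State.mem_setReg, State.mem_setMem]
      rw [if_neg (by omega)]
    · rw [List.append_nil]
      refine hE.congr fun i hi hi' => ?_
      simp only [State.mem_setReg, State.mem_setMem]
      rw [if_neg (by omega)]
    · simp [hmark i hi]
  · nlinarith

end

end Agglomerative

/-! ### Finding a closest pair among the edges -/

namespace Agglomerative

def findMinBody : Cmd :=
  .setReg 12 (.mem (edgeCell (.reg 11) 0)) ;; .setReg 13 (.mem (edgeCell (.reg 11) 1)) ;;
  minDist 12 13 ;;
  .ite (.leDist (.lit 0) (.lit 1)) .skip
    (.copyDist (.lit 0) (.lit 1) ;; .setReg 4 (.reg 12) ;; .setReg 5 (.reg 13)) ;;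
  .setReg 11 (.add (.reg 11) (.lit 1))

/-- Finds the shortest edge, and orients it. -/
def findMin : Cmd :=
  (.setReg 4 (.mem (edgeCell (.lit 0) 0)) ;; .setReg 5 (.mem (edgeCell (.lit 0) 1)) ;;
    minDist 4 5 ;; .copyDist (.lit 0) (.lit 1) ;; .setReg 11 (.lit 1)) ;;
  .while (.lt (.reg 11) (.reg 3)) findMinBody ;;
  .evalDist (.lit 1) (.reg 4) (.reg 5) ;; .evalDist (.lit 2) (.reg 5) (.reg 4) ;;
  .ite (.leDist (.lit 1) (.lit 2)) .skip
    (.setReg 12 (.reg 4) ;; .setReg 4 (.reg 5) ;; .setReg 5 (.reg 12))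

section

variable {Ob : Type u} {D : Type v} [LinearOrder D] {ops : Ops Ob D} {W S n : ℕ}
  {σ : State Ob D} {Q : State Ob D → Prop}

/-- Edges are compared by the smaller of their two directed distances, so a final swap is needed to
choose the direction that attains it. -/
theorem runs_findMin {ob : ℕ → Ob} {l : List CEdge}
    (hS : 60 * (n + 1) ≤ S) (hW : S ≤ W) (hn : σ.reg 0 = n)
    (hE : EdgesIn n σ.mem l) (hl : σ.reg 3 = l.length) (hl' : l.length ≤ 14 * n) (hne : l ≠ [])
    (hedge : ∀ e ∈ l, e.src < n ∧ e.tgt < n ∧ σ.obj e.src = some (ob e.src) ∧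
      σ.obj e.tgt = some (ob e.tgt)) :
    Runs ops W S findMin (1000 * (n + 1)) σ fun τ =>
      (∀ r < 4, τ.reg r = σ.reg r) ∧ τ.mem = σ.mem ∧ τ.obj = σ.obj ∧
      ∃ e ∈ l, (τ.reg 4 = e.src ∧ τ.reg 5 = e.tgt ∨ τ.reg 4 = e.tgt ∧ τ.reg 5 = e.src) ∧
        ∀ e' ∈ l, ops.dist (ob (τ.reg 4)) (ob (τ.reg 5)) ≤ slotDist ops ob e'.src e'.tgt := by
  have hpos : 0 < l.length := List.length_pos_iff.2 hne
  let I : ℕ → State Ob D → Prop := fun i τ =>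
    (∀ r < 4, τ.reg r = σ.reg r) ∧ τ.mem = σ.mem ∧ τ.obj = σ.obj ∧ τ.reg 11 = i ∧
    ∃ e ∈ l, τ.reg 4 = e.src ∧ τ.reg 5 = e.tgt ∧ τ.dst 0 = some (slotDist ops ob e.src e.tgt) ∧
      ∀ i' (h : i' < l.length), i' < i →
        slotDist ops ob e.src e.tgt ≤ slotDist ops ob l[i'].src l[i'].tgt
  refine Runs.mono (T := 50 + ((l.length - 1) * (3 + 60) + 3 + 30)) ?_ (by omega) fun _ => id
  refine .seq ((Runs.of_wp_le (Q := I 1) (by decide) ?_).mono le_rfl fun τ hτ => ?_)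
  · obtain ⟨e0, e1, e2⟩ := hE 0 hpos
    obtain ⟨m1, m2, m3, m4⟩ := hedge _ (List.getElem_mem hpos)
    simp only [mul_zero, zero_add, add_zero] at e0 e1
    -- Only sequencing (`eq_10`) and register assignment (`eq_2`) are unfolded, so that `minDist`
    -- remains intact for `wp_minDist`.
    simp [-Cmd.Wp, Cmd.Wp.eq_10, Cmd.Wp.eq_2, hn, e0, e1]
    repeat refine ⟨by omega, ?_⟩
    refine wp_minDist (ob := ob) (by omega) hW (by simp; omega) (by simp; omega)
      (by simp [m3]) (by simp [m4]) ?_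
    intro τ g1 g2 g3 g4 g5
    simp at g5
    simp [g5]
    repeat refine ⟨by omega, ?_⟩
    refine ⟨fun r hr => ?_, by simp [g2], by simp [g3], by simp, _,
      List.getElem_mem hpos, by simp [g1], by simp [g1], by simp, fun i' h hi' => ?_⟩
    · simp [g1, show r ≠ 11 by omega, show r ≠ 4 by omega, show r ≠ 5 by omega]
    · obtain rfl : i' = 0 := by omega
      exact le_rfl
  refine .seq ((Runs.while_count I (C := 60) (Q := I l.length) hpos ?_ ?_ hτ).mono le_rfl ?_)
  · rintro i τ hi0 hi ⟨h1, h2, h3, h4, e, he, h5, h6, h7, h8⟩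
    have r0 := h1 0 (by omega)
    have r3 := h1 3 (by omega)
    obtain ⟨e0, e1, e2⟩ := hE i hi
    obtain ⟨m1, m2, m3, m4⟩ := hedge _ (List.getElem_mem hi)
    refine ⟨by simp; omega, by simp; omega, Runs.of_wp_le (by decide) ?_⟩
    simp [findMinBody, -Cmd.Wp, Cmd.Wp.eq_10, Cmd.Wp.eq_2, r0, hn, e0, e1, h2, h4]
    repeat refine ⟨by omega, ?_⟩
    refine wp_minDist (ob := ob) (by omega) hW (by simp; omega) (by simp; omega)
      (by simp [h3, m3]) (by simp [h3, m4]) ?_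
    intro τ' g1 g2 g3 g4 g5
    simp at g4 g5
    have hreg : ∀ r, r ≠ 12 → r ≠ 13 → τ'.reg r = τ.reg r := fun r hr hr' => by
      simp [g1, hr, hr']
    have hm1 := (hedge e he).1
    refine ⟨by simp [g4, g5, h7]; omega, fun hle => ?_, fun hle => ?_⟩
    · simp [g4, g5, h7] at hle
      refine ⟨by simp [hreg, h4]; omega, fun r hr => ?_, by simp [g2, h2], by simp [g3, h3],
        by simp [hreg, h4], e, he, by simp [hreg, h5], by simp [hreg, h6], by simp [g4, h7],
        fun i' h hi' => ?_⟩
      · simp [hreg, h1 r hr, show r ≠ 11 by omega, show r ≠ 12 by omega, show r ≠ 13 by omega]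
      · rcases Nat.lt_succ_iff_lt_or_eq.1 hi' with hi' | rfl
        exacts [h8 i' h hi', hle]
    · simp [g4, g5, h7] at hle
      simp [g5, g1, h4]
      repeat refine ⟨by omega, ?_⟩
      refine ⟨fun r hr => ?_, by simp [g2, h2],
        by simp [g3, h3], by simp, l[i], List.getElem_mem hi, by simp, by simp, by simp,
        fun i' h hi' => ?_⟩
      · simp [hreg, h1 r hr, show r ≠ 11 by omega, show r ≠ 12 by omega, show r ≠ 13 by omega,
          show r ≠ 4 by omega, show r ≠ 5 by omega]
      · rcases Nat.lt_succ_iff_lt_or_eq.1 hi' with hi' | rfl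
        exacts [hle.le.trans (h8 i' h hi'), le_rfl]
  · rintro τ ⟨h1, h2, h3, h4, h5⟩
    have r3 := h1 3 (by omega)
    exact ⟨by simp; omega, by simp; omega, h1, h2, h3, h4, h5⟩
  · rintro τ ⟨h1, h2, h3, h4, e, he, h5, h6, h7, h8⟩
    obtain ⟨m1, m2, m3, m4⟩ := hedge e he
    have h8 : ∀ e' ∈ l, slotDist ops ob e.src e.tgt ≤ slotDist ops ob e'.src e'.tgt := by
      intro e' he'
      obtain ⟨i, hi, rfl⟩ := List.getElem_of_mem he'
      exact h8 i hi hi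
    refine Runs.of_wp_le (by decide) ?_
    simp [h5, h6, h3, m3, m4]
    repeat refine ⟨by omega, ?_⟩
    refine ⟨fun hle => ?_,
      fun hle => ?_⟩
    · refine ⟨h1, h2, e, he, .inl ⟨rfl, rfl⟩, fun e' he' => le_trans ?_ (h8 e' he')⟩
      simp [slotDist, hle]
    · repeat refine ⟨by omega, ?_⟩
      refine ⟨fun r hr => ?_, h2, e, he, .inr ⟨rfl, rfl⟩,
        fun e' he' => le_trans ?_ (h8 e' he')⟩
      · simp [h1 r hr, show r ≠ 12 by omega, show r ≠ 4 by omega, show r ≠ 5 by omega]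
      · simp [slotDist, hle.le]

end

end Agglomerative

/-! ### The merger, its level, and the removal of edges -/

namespace Agglomerative

/-- Records the merger of the slots in the registers `4` and `5` in the output, and performs it. -/
def mergeSlots : Cmd :=
  .store (.mul (.lit 2) (.reg 2)) (.mem (cell 2 (.reg 4))) ;;
  .store (.add (.mul (.lit 2) (.reg 2)) (.lit 1)) (.mem (cell 2 (.reg 5))) ;;
  .store (cell 2 (.reg 4)) (.add (.reg 0) (.reg 2)) ;;
  .joinObj (.reg 4) (.reg 4) (.reg 5) ;;
  .setReg 2 (.add (.reg 2) (.lit 1))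

/-- Computes the level of the next conga line. -/
def findLevel : Cmd :=
  (.setReg 6 (.lit 0) ;; .setReg 11 (.reg 2)) ;;
  .while (.lt (.add (.mul (.sub (.reg 11) (.mul (.lit 2) (.div (.reg 11) (.lit 2)))) (.reg 1))
      (.reg 6)) (.reg 1))
    (.setReg 11 (.div (.reg 11) (.lit 2)) ;; .setReg 6 (.add (.reg 6) (.lit 1)))

/-- Marks the slots by their levels. -/
def markLevels : Cmd :=
  .setReg 11 (.lit 0) ;;
  .while (.lt (.reg 11) (.reg 0))
    (.ite (.eq (.mem (cell 3 (.reg 11))) (.lit 0)) (.store (cell 4 (.reg 11)) (.lit 0))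
      (.ite (.lt (.add (.reg 6) (.lit 1)) (.mem (cell 3 (.reg 11))))
        (.store (cell 4 (.reg 11)) (.lit 1)) (.store (cell 4 (.reg 11)) (.lit 2))) ;;
    .setReg 11 (.add (.reg 11) (.lit 1)))

def keepEdge : Cmd :=
  .store (edgeCell (.reg 14) 0) (.reg 12) ;; .store (edgeCell (.reg 14) 1) (.reg 13) ;;
  .store (edgeCell (.reg 14) 2) (.reg 15) ;; .setReg 14 (.add (.reg 14) (.lit 1))

/-- The edge list is compacted in place: register `11` reads and register `14` writes, never ahead
of the reading. The same pass marks the source of every edge into one of the merged slots, which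
finds the fresh slots. -/
def filterBody : Cmd :=
  .setReg 12 (.mem (edgeCell (.reg 11) 0)) ;; .setReg 13 (.mem (edgeCell (.reg 11) 1)) ;;
  .setReg 15 (.mem (edgeCell (.reg 11) 2)) ;;
  .ite (.eq (.reg 13) (.reg 4)) (.store (cell 4 (.reg 12)) (.lit 2))
    (.ite (.eq (.reg 13) (.reg 5)) (.store (cell 4 (.reg 12)) (.lit 2))
      (.ite (.eq (.reg 12) (.reg 4)) .skip (.ite (.eq (.reg 12) (.reg 5)) .skip
        (.ite (.lt (.reg 6) (.reg 15)) keepEdge .skip)))) ;;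
  .setReg 11 (.add (.reg 11) (.lit 1))

/-- Removes the edges that are not kept, and marks the slots that need a new edge. -/
def filterEdges : Cmd :=
  (.setReg 11 (.lit 0) ;; .setReg 14 (.lit 0)) ;;
  .while (.lt (.reg 11) (.reg 3)) filterBody ;;
  .setReg 3 (.reg 14) ;; .store (cell 4 (.reg 4)) (.lit 2) ;;
  .store (cell 4 (.reg 5)) (.lit 0)

/-- Assigns the new level to the marked slots, and removes the slot in the register `5`. -/
def setLevels : Cmd :=
  (.store (cell 3 (.reg 5)) (.lit 0) ;; .setReg 7 (.reg 4) ;; .setReg 11 (.lit 0)) ;;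
  .while (.lt (.reg 11) (.reg 0))
    (.ite (.eq (.mem (cell 4 (.reg 11))) (.lit 2))
      (.store (cell 3 (.reg 11)) (.add (.reg 6) (.lit 1))) .skip ;;
    .setReg 11 (.add (.reg 11) (.lit 1)))

section

variable {Ob : Type u} {D : Type v} [LinearOrder D] {ops : Ops Ob D} {W S n : ℕ}
  {σ : State Ob D} {Q : State Ob D → Prop}

/-- Halving keeps `τ.reg 11 * 2 ^ τ.reg 6 = t` as long as the quotient is even, and stops at the cap
`L`. -/
theorem runs_findLevel {L t : ℕ} (hS : 60 * (n + 1) ≤ S) (hW : S ≤ W) (hL : σ.reg 1 = L)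
    (ht : σ.reg 2 = t) (hLn : L ≤ 2 * n) (htn : t ≤ n) :
    Runs ops W S findLevel (100 * (n + 1)) σ fun τ =>
      (∀ r < 6, τ.reg r = σ.reg r) ∧ τ.mem = σ.mem ∧ τ.obj = σ.obj ∧ IsLevel L t (τ.reg 6) := by
  let I : ℕ → State Ob D → Prop := fun f τ =>
    (∀ r < 6, τ.reg r = σ.reg r) ∧ τ.mem = σ.mem ∧ τ.obj = σ.obj ∧
    τ.reg 11 * 2 ^ τ.reg 6 = t ∧ τ.reg 6 + f = L ∧ τ.reg 11 ≤ n
  refine Runs.mono (T := 10 + (L * (13 + 10) + 13)) ?_ (by omega) fun _ => id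
  refine .seq ((Runs.of_wp_le (Q := I L) (by decide) ?_).mono le_rfl fun τ hτ => ?_)
  · simp [ht]
    refine ⟨by omega, fun r hr => ?_, by simp, by simp, by simp, by simp, by simpa using htn⟩
    simp [show r ≠ 11 by omega, show r ≠ 6 by omega]
  refine Runs.while_fuel I ?_ _ hτ
  rintro f τ ⟨h1, h2, h3, h4, h5, h6⟩
  have r1 := h1 1 (by omega)
  -- The loop test `parity * L + level < L` combines two conditions in one comparison: the quotient
  -- is even and the level is below `L`.
  have hq : τ.reg 11 - 2 * (τ.reg 11 / 2) = τ.reg 11 % 2 := by omega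
  simp only [Test.Ok, Expr.Ok, Test.Holds, Expr.val, r1, hL, hq]
  have hmul : τ.reg 11 % 2 * L ≤ L := by
    rcases Nat.mod_two_eq_zero_or_one (τ.reg 11) with h | h <;> simp [h]
  refine ⟨by omega, fun hb => ⟨h1, h2, h3, by omega, ⟨_, by rw [← h4, mul_comm]⟩, ?_⟩, fun hb => ?_⟩
  · rintro hlt ⟨c, hc⟩
    rw [← h4, pow_succ, mul_comm (τ.reg 11), mul_assoc] at hc
    have := Nat.eq_of_mul_eq_mul_left (by positivity) hc
    have : τ.reg 11 % 2 = 0 := by omega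
    rw [this] at hb
    omega
  · have hev : τ.reg 11 % 2 = 0 := by
      rcases Nat.mod_two_eq_zero_or_one (τ.reg 11) with h | h
      · exact h
      · rw [h] at hb; omega
    rw [hev] at hb
    refine ⟨f - 1, by omega, Runs.of_wp_le (by decide) ?_⟩
    simp
    repeat refine ⟨by omega, ?_⟩
    refine ⟨fun r hr => ?_, by simp [h2], by simp [h3], ?_, by simp; omega, by simp; omega⟩
    · simp [show r ≠ 11 by omega, show r ≠ 6 by omega, h1 r hr]
    · simp
      rw [pow_succ, mul_comm (2 ^ τ.reg 6), ← mul_assoc, ← h4]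
      congr 1
      omega

theorem runs_markLevels {live : Finset ℕ} {lv : ℕ → ℕ} {j : ℕ} (hS : 60 * (n + 1) ≤ S)
    (hW : S ≤ W) (hn : σ.reg 0 = n) (hj : σ.reg 6 = j) (hjn : j ≤ 2 * n)
    (hlive : ∀ i < n, σ.mem (3 * n + i) = if i ∈ live then lv i + 1 else 0)
    (hlv : ∀ i ∈ live, lv i ≤ 2 * n) :
    Runs ops W S markLevels (100 * (n + 1)) σ fun τ =>
      (∀ r < 10, τ.reg r = σ.reg r) ∧ τ.obj = σ.obj ∧
      (∀ i, i < 4 * n ∨ 5 * n ≤ i → τ.mem i = σ.mem i) ∧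
      ∀ i < n, τ.mem (4 * n + i) = if i ∈ live then (if lv i ≤ j then 2 else 1) else 0 := by
  let I : ℕ → State Ob D → Prop := fun k τ =>
    (∀ r < 10, τ.reg r = σ.reg r) ∧ τ.obj = σ.obj ∧
    (∀ i, i < 4 * n ∨ 5 * n ≤ i → τ.mem i = σ.mem i) ∧ τ.reg 11 = k ∧
    ∀ i < k, τ.mem (4 * n + i) = if i ∈ live then (if lv i ≤ j then 2 else 1) else 0
  refine Runs.mono (T := 2 + ((n - 0) * (3 + 50) + 3)) ?_ (by omega) fun _ => id
  refine .seq ((Runs.of_wp_le (Q := I 0) (by decide) ?_).mono le_rfl fun τ hτ => ?_)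
  · refine ⟨by simp, fun r hr => ?_, by simp, by simp, by simp, by simp⟩
    simp [show r ≠ 11 by omega]
  refine Runs.while_count I (Nat.zero_le n) ?_ ?_ hτ
  · rintro i τ - hi ⟨h1, h2, h3, h4, h5⟩
    have r0 := h1 0 (by omega)
    have r6 := h1 6 (by omega)
    refine ⟨by simp; omega, by simp; omega, Runs.of_wp_le (by decide) ?_⟩
    have hm := h3 (3 * n + i) (.inl (by omega))
    rw [hlive i hi] at hm
    have hmle : τ.mem (3 * n + i) ≤ 2 * n + 1 := by
      rw [hm]; split_ifs with h
      · have := hlv i h; omega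
      · omega
    have fin : ∀ v, v = (if i ∈ live then (if lv i ≤ j then 2 else 1) else 0) →
        (Cmd.setReg 11 (.add (.reg 11) (.lit 1))).Wp ops W S (I (i + 1))
          (τ.setMem (4 * n + i) v) := by
      intro v hv
      refine ⟨by simp; omega, fun r hr => ?_, by simp [h2], fun i' hi' => ?_, by simp [h4],
        fun i' hi' => ?_⟩
      · simp [show r ≠ 11 by omega, h1 r hr]
      · simp [show i' ≠ 4 * n + i by omega, h3 i' hi']
      · rcases Nat.lt_succ_iff_lt_or_eq.1 hi' with hi' | rfl
        · simp [h5 i' hi', hi'.ne]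
        · simp [hv]
    rw [Cmd.Wp.eq_10, Cmd.Wp.eq_11, Cmd.Wp.eq_11]
    refine ⟨?_, fun hb => ?_, fun hb => ⟨?_, fun hb' => ?_, fun hb' => ?_⟩⟩
    · simp [r0, h4, hn]; omega
    · simp [r0, h4, hn] at hb
      refine ⟨by simp [r0, h4, hn]; omega, by simp, ?_⟩
      simp only [Expr.val, r0, hn, h4]
      refine fin _ ?_
      by_contra hc
      split_ifs at hm <;> simp_all
    · simp [r0, h4, hn]; omega
    all_goals
      simp [r0, h4, hn, hm, r6, hj] at hb hb'
      refine ⟨by simp [r0, h4, hn]; omega, by simp; omega, ?_⟩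
      simp only [Expr.val, r0, hn, h4]
      refine fin _ ?_
      simp [hb] at hb' ⊢
      omega
  · rintro τ ⟨h1, h2, h3, h4, h5⟩
    have r0 := h1 0 (by omega)
    exact ⟨by simp; omega, by simp; omega, h1, h2, h3, h5⟩

theorem runs_setLevels {j b : ℕ} (hS : 60 * (n + 1) ≤ S)
    (hW : S ≤ W) (hn : σ.reg 0 = n) (hj : σ.reg 6 = j) (hjn : j ≤ 2 * n) (hb : σ.reg 5 = b)
    (hbn : b < n) (ha : σ.reg 4 < n) (hmark : ∀ i < n, σ.mem (4 * n + i) ≤ 2) :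
    Runs ops W S setLevels (100 * (n + 1)) σ fun τ =>
      (∀ r < 7, τ.reg r = σ.reg r) ∧ τ.reg 7 = σ.reg 4 ∧ τ.obj = σ.obj ∧
      (∀ i, i < 3 * n ∨ 4 * n ≤ i → τ.mem i = σ.mem i) ∧
      ∀ i < n, τ.mem (3 * n + i) = if σ.mem (4 * n + i) = 2 then j + 1
        else if i = b then 0 else σ.mem (3 * n + i) := by
  let I : ℕ → State Ob D → Prop := fun k τ =>
    (∀ r < 7, τ.reg r = σ.reg r) ∧ τ.reg 7 = σ.reg 4 ∧ τ.obj = σ.obj ∧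
    (∀ i, i < 3 * n ∨ 4 * n ≤ i → τ.mem i = σ.mem i) ∧ τ.reg 11 = k ∧
    (∀ i < n, τ.mem (3 * n + i) = if σ.mem (4 * n + i) = 2 ∧ i < k then j + 1
        else if i = b then 0 else σ.mem (3 * n + i))
  refine Runs.mono (T := 15 + ((n - 0) * (3 + 50) + 3)) ?_ (by omega) fun _ => id
  refine .seq ((Runs.of_wp_le (Q := I 0) (by decide) ?_).mono le_rfl fun τ hτ => ?_)
  · simp [hn, hb]
    repeat refine ⟨by omega, ?_⟩
    refine ⟨fun r hr => ?_, by simp, by simp, fun i hi => ?_, by simp, fun i hi => ?_⟩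
    · simp [show r ≠ 11 by omega, show r ≠ 7 by omega]
    · simp [show i ≠ 3 * n + b by omega]
    · simp
  refine Runs.while_count I (Nat.zero_le n) ?_ ?_ hτ
  · rintro i τ - hi ⟨h1, h7, h2, h3, h4, h5⟩
    have r0 := h1 0 (by omega)
    have r6 := h1 6 (by omega)
    have hm := h3 (4 * n + i) (.inr (by omega))
    have hm2 := hmark i hi
    refine ⟨by simp; omega, by simp; omega, Runs.of_wp_le (by decide) ?_⟩
    rw [Cmd.Wp.eq_10, Cmd.Wp.eq_11]
    refine ⟨?_, fun hb => ?_, fun hb => ?_⟩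
    · simp [r0, h4, hn]; omega
    · simp [r0, h4, hn, hm] at hb
      simp [r0, h4, hn, r6, hj]
      repeat refine ⟨by omega, ?_⟩
      refine ⟨fun r hr => ?_, by simp [h7], by simp [h2], fun i' hi' => ?_, by simp,
        fun i' hi' => ?_⟩
      · simp [show r ≠ 11 by omega, h1 r hr]
      · simp [show i' ≠ 3 * n + i by omega, h3 i' hi']
      · by_cases he : i' = i
        · subst he; simp [hb]
        · simp [he, h5 i' hi', show (i' < i + 1 ↔ i' < i) by omega]
    · simp [r0, h4, hn, hm] at hb
      refine ⟨by simp; omega, fun r hr => ?_, by simp [h7], by simp [h2], by simpa using h3,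
        by simp [h4], fun i' hi' => ?_⟩
      · simp [show r ≠ 11 by omega, h1 r hr]
      · simp only [State.mem_setReg, h5 i' hi']
        by_cases he : i' = i
        · subst he; simp [hb]
        · simp [show (i' < i + 1 ↔ i' < i) by omega]
  · rintro τ ⟨h1, h7, h2, h3, h4, h5⟩
    have r0 := h1 0 (by omega)
    refine ⟨by simp; omega, by simp; omega, h1, h7, h2, h3, fun i hi => ?_⟩
    simp [h5 i hi, hi]

theorem runs_filterEdges {l : List CEdge} {a b j : ℕ} (hS : 60 * (n + 1) ≤ S) (hW : S ≤ W)
    (hn : σ.reg 0 = n) (hj : σ.reg 6 = j) (hjn : j ≤ 2 * n) (ha : σ.reg 4 = a) (hb : σ.reg 5 = b)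
    (han : a < n) (hbn : b < n) (hE : EdgesIn n σ.mem l) (hl : σ.reg 3 = l.length)
    (hl' : l.length ≤ 14 * n) (hedge : ∀ e ∈ l, e.src < n ∧ e.tgt < n ∧ e.lev ≤ 2 * n) :
    Runs ops W S filterEdges (3000 * (n + 1)) σ fun τ =>
      (∀ r < 10, r ≠ 3 → τ.reg r = σ.reg r) ∧ τ.obj = σ.obj ∧ (∀ i < 4 * n, τ.mem i = σ.mem i) ∧
      EdgesIn n τ.mem (l.filter fun e => keeps a b j e) ∧
      τ.reg 3 = (l.filter fun e => keeps a b j e).length ∧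
      ∀ i < n, τ.mem (4 * n + i) =
        if i = b then 0 else if i ∈ fresh a b l then 2 else σ.mem (4 * n + i) := by
  let I : ℕ → State Ob D → Prop := fun k τ =>
    (∀ r < 10, τ.reg r = σ.reg r) ∧ τ.obj = σ.obj ∧ (∀ i < 4 * n, τ.mem i = σ.mem i) ∧
    EdgesIn n τ.mem ((l.take k).filter fun e => keeps a b j e) ∧
    τ.reg 14 = ((l.take k).filter fun e => keeps a b j e).length ∧ τ.reg 11 = k ∧
    (∀ i, 5 * n + 3 * k ≤ i → τ.mem i = σ.mem i) ∧
    ∀ i < n, ((∃ e ∈ l.take k, (e.tgt = a ∨ e.tgt = b) ∧ e.src = i) → τ.mem (4 * n + i) = 2) ∧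
      ((∀ e ∈ l.take k, (e.tgt = a ∨ e.tgt = b) → e.src ≠ i) →
        τ.mem (4 * n + i) = σ.mem (4 * n + i))
  refine Runs.mono (T := 10 + ((l.length - 0) * (3 + 100) + 3 + 40)) ?_ (by omega) fun _ => id
  refine .seq ((Runs.of_wp_le (Q := I 0) (by decide) ?_).mono le_rfl fun τ hτ => ?_)
  · refine ⟨by simp, by simp, fun r hr => ?_, by simp, by simp, by simp [EdgesIn], by simp,
      by simp, by simp, by simp⟩
    simp [show r ≠ 11 by omega, show r ≠ 14 by omega]
  refine .seq ((Runs.while_count I (C := 100) (Q := I l.length) (Nat.zero_le _) ?_ ?_ hτ).mono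
    le_rfl ?_)
  · rintro k τ - hk ⟨h1, h2, h3, h4, h5, h6, h7, h8⟩
    have r0 := h1 0 (by omega)
    have r3 := h1 3 (by omega)
    have r4 := h1 4 (by omega)
    have r5 := h1 5 (by omega)
    have r6 := h1 6 (by omega)
    obtain ⟨e0, e1, e2⟩ := hE k hk
    obtain ⟨m1, m2, m3⟩ := hedge _ (List.getElem_mem hk)
    -- At most `k` edges have been written back, so edge `k` and the later ones still have their
    -- original contents.
    rw [← h7 _ (by omega)] at e0 e1 e2
    have hw : ((l.take k).filter fun e => keeps a b j e).length ≤ k :=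
      (List.length_filter_le _ _).trans (by simp)
    have htake : l.take (k + 1) = l.take k ++ [l[k]] := by rw [List.take_append_getElem]
    refine ⟨by simp; omega, by simp; omega, Runs.of_wp_le (by decide) ?_⟩
    -- Common to all branches that discard the edge: they differ only in whether the mark of its
    -- source is set.
    have drop : ∀ τ' : State Ob D, τ'.reg = (((τ.setReg 12 l[k].src).setReg 13 l[k].tgt).setReg 15 l[k].lev).reg →
        τ'.obj = τ.obj → (∀ i, i < 4 * n ∨ 5 * n ≤ i → τ'.mem i = τ.mem i) →
        ¬ keeps a b j l[k] →
        (∀ i < n, ((l[k].tgt = a ∨ l[k].tgt = b) ∧ l[k].src = i → τ'.mem (4 * n + i) = 2) ∧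
          (¬ ((l[k].tgt = a ∨ l[k].tgt = b) ∧ l[k].src = i) →
            τ'.mem (4 * n + i) = τ.mem (4 * n + i))) →
        (Cmd.setReg 11 (.add (.reg 11) (.lit 1))).Wp ops W S (I (k + 1)) τ' := by
      intro τ' g1 g2 g3 g4 g5
      refine ⟨by simp [g1, h6]; omega, fun r hr => ?_, by simp [g2, h2], fun i hi => ?_, ?_, ?_,
        by simp [g1, h6], fun i hi => ?_, fun i hi => ?_⟩
      · simp [g1, show r ≠ 11 by omega, show r ≠ 12 by omega, show r ≠ 13 by omega,
          show r ≠ 15 by omega, h1 r hr]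
      · simp [g3 i (.inl hi), h3 i hi]
      · rw [htake, List.filter_append]
        simp only [g4, List.filter_singleton, decide_false, cond_false, List.append_nil]
        exact h4.congr fun i hi _ => by simp [g3 i (.inr hi)]
      · rw [htake, List.filter_append]
        simp [g4, g1, h5]
      · simp [g3 i (.inr (by omega)), h7 i (by omega)]
      · obtain ⟨c1, c2⟩ := g5 i hi
        obtain ⟨d1, d2⟩ := h8 i hi
        simp only [htake, List.mem_append, List.mem_singleton, State.mem_setReg]
        by_cases hc : (l[k].tgt = a ∨ l[k].tgt = b) ∧ l[k].src = i
        · exact ⟨fun _ => c1 hc, fun h => absurd hc.2 (h _ (.inr rfl) hc.1)⟩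
        · rw [c2 hc]
          refine ⟨?_, fun h => d2 fun e he => h e (.inl he)⟩
          rintro ⟨e, he | rfl, h⟩
          exacts [d1 ⟨e, he, h⟩, absurd h hc]
    simp [filterBody, -Cmd.Wp, Cmd.Wp.eq_10, Cmd.Wp.eq_2, r0, hn, h6, e0, e1, e2]
    repeat refine ⟨by omega, ?_⟩
    have addMark : (l[k].tgt = a ∨ l[k].tgt = b) →
        (Cmd.store (cell 4 (.reg 12)) (.lit 2)).Wp ops W S
          ((Cmd.setReg 11 (.add (.reg 11) (.lit 1))).Wp ops W S (I (k + 1)))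
          (((τ.setReg 12 l[k].src).setReg 13 l[k].tgt).setReg 15 l[k].lev) := by
      intro hc
      refine ⟨by simp [r0, hn]; omega, by simp; omega, drop _ (by simp) (by simp) (fun i hi => ?_)
        ?_ fun i hi => ?_⟩
      · simp [r0, hn, show i ≠ 4 * n + l[k].src by omega]
      · rintro ⟨-, hk, -⟩
        tauto
      · simp only [hc, true_and]
        refine ⟨fun h => by simp [r0, hn, h], fun h => by simp [r0, hn, Ne.symm h]⟩
    have noMark : (l[k].tgt ≠ a ∧ l[k].tgt ≠ b) → ¬ keeps a b j l[k] → Cmd.skip.Wp ops W S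
          ((Cmd.setReg 11 (.add (.reg 11) (.lit 1))).Wp ops W S (I (k + 1)))
          (((τ.setReg 12 l[k].src).setReg 13 l[k].tgt).setReg 15 l[k].lev) := by
      intro hc hk
      exact drop _ rfl rfl (fun _ _ => rfl) hk fun i hi => ⟨fun h => by tauto, fun _ => rfl⟩
    refine ⟨by simp; omega, fun c1 => ?_, fun c1 => ⟨by simp; omega, fun c2 => ?_, fun c2 =>
      ⟨by simp; omega, fun c3 => ?_, fun c3 => ⟨by simp; omega, fun c4 => ?_, fun c4 =>
      ⟨by simp; omega, fun c5 => ?_, fun c5 => ?_⟩⟩⟩⟩⟩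
    · simp [r4, ha] at c1
      exact addMark (.inl c1)
    · simp [r5, hb] at c2
      exact addMark (.inr c2)
    all_goals
      simp [r4, r5, ha, hb] at c1 c2 c3
    · exact noMark ⟨c1, c2⟩ fun h => h.1.1 c3
    · simp [r5, hb] at c4
      exact noMark ⟨c1, c2⟩ fun h => h.1.2 c4
    · simp [r5, hb, r6, hj] at c4 c5
      have hkeep : keeps a b j l[k] := ⟨⟨c3, c4⟩, ⟨c1, c2⟩, c5⟩
      simp [keepEdge, r0, hn, h5, h6]
      repeat refine ⟨by omega, ?_⟩
      set w := ((l.take k).filter fun e => keeps a b j e).length with hwdef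
      refine ⟨fun r hr => ?_, by simp [h2], fun i hi => ?_, ?_, ?_,
        by simp, fun i hi => ?_, fun i hi => ?_⟩
      · simp [show r ≠ 11 by omega, show r ≠ 12 by omega, show r ≠ 13 by omega,
          show r ≠ 14 by omega, show r ≠ 15 by omega, h1 r hr]
      · simp only [State.mem_setReg, State.mem_setMem]
        rw [if_neg (by omega), if_neg (by omega), if_neg (by omega), h3 i hi]
      · rw [htake, List.filter_append]
        simp only [hkeep, List.filter_singleton, decide_true, cond_true]
        refine EdgesIn.append (h4.congr fun i hi hi' => ?_) ?_ ?_ ?_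
        all_goals simp only [State.mem_setReg, State.mem_setMem, ← hwdef]
        · rw [if_neg (by omega), if_neg (by omega), if_neg (by omega)]
        · rw [if_neg (by omega), if_neg (by omega), if_true]
        · rw [if_neg (by omega), if_true]
        · rw [if_true]
      · rw [htake, List.filter_append]
        simp [hkeep, ← hwdef]
      · simp only [State.mem_setReg, State.mem_setMem]
        rw [if_neg (by omega), if_neg (by omega), if_neg (by omega), h7 i (by omega)]
      · obtain ⟨d1, d2⟩ := h8 i hi
        simp only [htake, List.mem_append, List.mem_singleton, State.mem_setReg, State.mem_setMem]
        rw [if_neg (by omega), if_neg (by omega), if_neg (by omega)]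
        refine ⟨?_, fun h => d2 fun e he => h e (.inl he)⟩
        rintro ⟨e, he | rfl, h⟩
        · exact d1 ⟨e, he, h⟩
        · tauto
    · simp [r6, hj] at c5
      exact noMark ⟨c1, c2⟩ fun h => absurd h.2.2 (by omega)
  · rintro τ ⟨h1, h2, h3, h4, h5, h6, h7, h8⟩
    have r3 := h1 3 (by omega)
    exact ⟨by simp; omega, by simp; omega, h1, h2, h3, h4, h5, h6, h7, h8⟩
  · rintro τ ⟨h1, h2, h3, h4, h5, h6, h7, h8⟩
    have r0 := h1 0 (by omega)
    have r4 := h1 4 (by omega)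
    have r5 := h1 5 (by omega)
    rw [List.take_length] at h4 h5 h8
    have hw : (l.filter fun e => keeps a b j e).length ≤ l.length := List.length_filter_le _ _
    refine Runs.of_wp_le (by decide) ?_
    simp only [Cmd.Wp, Expr.Ok, Expr.AddrOk, Expr.val, State.reg_setReg, State.reg_setMem, r0, r4,
      r5, hn, ha, hb, h5,
      Nat.reduceEqDiff, OfNat.zero_ne_ofNat, if_false]
    repeat refine ⟨by omega, ?_⟩
    refine ⟨fun r hr hr3 => ?_, by simp [h2], fun i hi => ?_, ?_, by simp, fun i hi => ?_⟩
    · simp [hr3, h1 r hr]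
    · simp only [State.mem_setReg, State.mem_setMem]
      rw [if_neg (by omega), if_neg (by omega), h3 i hi]
    · refine h4.congr fun i hi _ => ?_
      simp only [State.mem_setReg, State.mem_setMem]
      rw [if_neg (by omega), if_neg (by omega)]
    · obtain ⟨d1, d2⟩ := h8 i hi
      simp only [State.mem_setReg, State.mem_setMem, add_right_inj]
      by_cases hib : i = b
      · simp [hib]
      by_cases hia : i = a
      · rw [if_neg hib, if_pos hia, if_neg hib, if_pos]
        exact hia ▸ Finset.mem_insert_self _ _
      rw [if_neg hib, if_neg hia, if_neg hib]
      have hf : i ∈ fresh a b l ↔ ∃ e ∈ l, (e.tgt = a ∨ e.tgt = b) ∧ e.src = i := by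
        simp only [fresh, Finset.mem_insert, hia, false_or, List.mem_toFinset, List.mem_map,
          List.mem_filter, decide_eq_true_eq, and_assoc]
      by_cases hc : i ∈ fresh a b l
      · rw [if_pos hc, d1 (hf.1 hc)]
      · rw [if_neg hc]
        exact d2 fun e he h h' => hc (hf.2 ⟨e, he, h, h'⟩)

end

end Agglomerative

/-! ### One step of the conga line program -/

namespace Agglomerative

def congaStep : Cmd :=
  findMin ;; mergeSlots ;; findLevel ;; markLevels ;; filterEdges ;; setLevels ;; buildLine

/-- Computes the top level. -/
def topLevel : Cmd :=
  (.setReg 1 (.lit 0) ;; .setReg 11 (.lit 1)) ;;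
  .while (.lt (.mul (.reg 11) (.add (.mul (.lit 2) (.reg 1)) (.lit 3))) (.reg 0))
    (.setReg 1 (.add (.reg 1) (.lit 1)) ;; .setReg 11 (.mul (.lit 2) (.reg 11)))

/-- Puts the objects into slots of top level. -/
def fillSlots : Cmd :=
  (.setReg 6 (.reg 1) ;; .setReg 11 (.lit 0)) ;;
  .while (.lt (.reg 11) (.reg 0))
    (.store (cell 2 (.reg 11)) (.reg 11) ;; .store (cell 3 (.reg 11)) (.add (.reg 1) (.lit 1)) ;;
    .store (cell 4 (.reg 11)) (.lit 2) ;; .setReg 11 (.add (.reg 11) (.lit 1)))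

/-- Bottom-up clustering with conga lines. -/
def congaProgram : Cmd :=
  .ite (.lt (.lit 1) (.reg 0))
    (topLevel ;; fillSlots ;; buildLine ;;
      .while (.lt (.add (.reg 2) (.lit 1)) (.reg 0)) congaStep)
    .skip

section

variable {Ob : Type u} {D : Type v} [LinearOrder D] {ops : Ops Ob D} {W S n : ℕ}
  {σ : State Ob D} {Q : State Ob D → Prop}

theorem runs_mergeSlots {a b k la lb : ℕ} {oa ob : Ob} (hS : 60 * (n + 1) ≤ S) (hW : S ≤ W)
    (hn : σ.reg 0 = n) (hk : σ.reg 2 = k) (hkn : k + 1 < n) (ha : σ.reg 4 = a) (hb : σ.reg 5 = b)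
    (han : a < n) (hbn : b < n) (hla : σ.mem (2 * n + a) = la)
    (hlb : σ.mem (2 * n + b) = lb) (hla' : la ≤ 2 * n) (hlb' : lb ≤ 2 * n)
    (hoa : σ.obj a = some oa) (hob : σ.obj b = some ob) :
    Runs ops W S mergeSlots 60 σ fun τ =>
      (∀ r, r ≠ 2 → τ.reg r = σ.reg r) ∧ τ.reg 2 = k + 1 ∧
      (∀ i, τ.obj i = if i = a then some (ops.join oa ob) else σ.obj i) ∧
      τ.mem (2 * k) = la ∧ τ.mem (2 * k + 1) = lb ∧ τ.mem (2 * n + a) = n + k ∧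
      ∀ i, i ≠ 2 * k → i ≠ 2 * k + 1 → i ≠ 2 * n + a → τ.mem i = σ.mem i := by
  refine Runs.of_wp_le (by decide) ?_
  simp [mergeSlots, hn, hk, ha, hb, hoa, hob, hla, hlb, show 2 * n + b ≠ 2 * k by omega,
    show 2 * k ≠ 2 * n + a by omega, show 2 * k + 1 ≠ 2 * n + a by omega]
  repeat refine ⟨by omega, ?_⟩
  intro i h1 h2 h3
  simp [h1, h2, h3]

/-- The state of the machine after `k` mergers. -/
def CongaInv (ops : Ops Ob D) (x : Fin n → Ob) (L k : ℕ) (σ : State Ob D) : Prop :=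
  σ.reg 0 = n ∧ σ.reg 1 = L ∧ σ.reg 2 = k ∧
  ∃ (m : ℕ → ℕ × ℕ) (live : Finset ℕ) (lab : ℕ → ℕ) (cl : ℕ → Cluster n) (lv : ℕ → ℕ)
    (l : List CEdge),
    σ.reg 3 = l.length ∧ EdgesIn n σ.mem l ∧
    (∀ i < k, σ.mem (2 * i) = (m i).1 ∧ σ.mem (2 * i + 1) = (m i).2) ∧
    Slots n m k live lab cl ∧ live ⊆ Finset.range n ∧
    (∀ i ∈ live, σ.mem (2 * n + i) = lab i ∧ σ.obj i = some ((cl i).rep ops.join x)) ∧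
    (∀ i < n, σ.mem (3 * n + i) = if i ∈ live then lv i + 1 else 0) ∧
    Conga n L k (slotDist ops fun i => (cl i).rep ops.join x) live lv l ∧
    AgglomerationPrefix (repDist ops x) m k

/-- All phases except the last take `O(n)` time. Building the line takes `O(n)` per element of the
batch, whence the factor `batchBound n L (k + 1) + 1`. -/
theorem runs_congaStep {x : Fin n → Ob} {L k : ℕ} (hS : 60 * (n + 1) ≤ S) (hW : S ≤ W)
    (hL : 2 ^ L * (2 * L + 3) ≤ 6 * n) (hkn : k + 1 < n) (h : CongaInv ops x L k σ) :
    Runs ops W S congaStep ((batchBound n L (k + 1) + 1) * (5000 * (n + 1))) σ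
      (CongaInv ops x L (k + 1)) := by
  obtain ⟨hn, hL1, hk, m, live, lab, cl, lv, l, hl, hE, hm, hs, hlive, hslot, hlev, hc, hpre⟩ := h
  set ob : ℕ → Ob := fun i => (cl i).rep ops.join x with hob
  have hLn : L ≤ 2 * n := by
    have h1 : L < 2 ^ L := Nat.lt_two_pow_self
    have h2 : 2 ^ L * 3 ≤ 2 ^ L * (2 * L + 3) := Nat.mul_le_mul_left _ (by omega)
    omega
  -- The constant is `2 + 2 * 6`, from the bound `6 * n` on `2 ^ L * (2 * L + 3)`.
  have hlen : l.length ≤ 14 * n := hc.length_le.trans (by omega)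
  have hlt : ∀ i ∈ live, i < n := fun i hi => Finset.mem_range.1 (hlive hi)
  have hcard : live.card ≤ n := by simpa using Finset.card_le_card hlive
  have hne : l ≠ [] := by
    obtain ⟨p, hp, q, hq, hpq⟩ := Finset.one_lt_card.1 (by rw [hs.card]; omega : 1 < live.card)
    obtain ⟨e, he, -⟩ := hc.cover p hp q hq hpq
    exact List.ne_nil_of_mem he
  have hedge : ∀ e ∈ l, e.src < n ∧ e.tgt < n ∧ e.lev ≤ 2 * n := fun e he => by
    obtain ⟨h1, h2, -, h4⟩ := hc.edge e he
    exact ⟨hlt _ h1, hlt _ h2, h4.trans hLn⟩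
  refine Runs.mono (T := 1000 * (n + 1) + (60 + (100 * (n + 1) + (100 * (n + 1) +
    (3000 * (n + 1) + (100 * (n + 1) + (batchBound n L (k + 1) + 1) * (300 * (n + 1)))))))) ?_
    (by nlinarith [Nat.zero_le (batchBound n L (k + 1) * n)]) fun _ => id
  refine .seq ((runs_findMin (ob := ob) hS hW hn hE hl hlen hne fun e he => ?_).mono le_rfl ?_)
  · obtain ⟨h1, h2, -⟩ := hc.edge e he
    exact ⟨hlt _ h1, hlt _ h2, (hslot _ h1).2, (hslot _ h2).2⟩
  rintro σ1 ⟨r1, m1, o1, e, he, hab, hmin⟩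
  obtain ⟨a, ha⟩ : ∃ a, σ1.reg 4 = a := ⟨_, rfl⟩
  obtain ⟨b, hb⟩ : ∃ b, σ1.reg 5 = b := ⟨_, rfl⟩
  rw [ha, hb] at hab hmin
  obtain ⟨hal, hbl, hne'⟩ : a ∈ live ∧ b ∈ live ∧ a ≠ b := by
    obtain ⟨h1, h2, h3, -⟩ := hc.edge e he
    rcases hab with ⟨rfl, rfl⟩ | ⟨rfl, rfl⟩
    exacts [⟨h1, h2, h3⟩, ⟨h2, h1, h3.symm⟩]
  have han := hlt a hal
  have hbn := hlt b hbl
  have hla := hs.lab_lt a hal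
  have hlb := hs.lab_lt b hbl
  refine .seq ((runs_mergeSlots (la := lab a) (lb := lab b) (oa := ob a) (ob := ob b) hS hW ((r1 0 (by omega)).trans hn) ((r1 2 (by omega)).trans hk) hkn
    ha hb han hbn (by rw [m1]; exact (hslot a hal).1) (by rw [m1]; exact (hslot b hbl).1)
    (by omega) (by omega) (by rw [o1]; exact (hslot a hal).2)
    (by rw [o1]; exact (hslot b hbl).2)).mono le_rfl ?_)
  rintro σ2 ⟨r2, k2, o2, out1, out2, lab2, m2⟩
  have p2 : ∀ r < 6, r ≠ 2 → r ≠ 4 → r ≠ 5 → σ2.reg r = σ.reg r := fun r h1 h2 h3 h4 => by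
    rw [r2 r h2, r1 r (by omega)]
  refine .seq ((runs_findLevel (L := L) (t := k + 1) hS hW
    ((p2 1 (by omega) (by omega) (by omega) (by omega)).trans hL1) k2 hLn (by omega)).mono
    le_rfl ?_)
  rintro σ3 ⟨r3, m3, o3, hj⟩
  obtain ⟨j, hj3⟩ : ∃ j, σ3.reg 6 = j := ⟨_, rfl⟩
  rw [hj3] at hj
  have hjn := hj.le.trans hLn
  have q0 : σ3.reg 0 = n := by rw [r3 0 (by omega), p2 0] <;> omega
  have q1 : σ3.reg 1 = L := by rw [r3 1 (by omega), p2 1] <;> omega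
  have q2 : σ3.reg 2 = k + 1 := by rw [r3 2 (by omega), k2]
  have q3 : σ3.reg 3 = l.length := by rw [r3 3 (by omega), p2 3] <;> omega
  have q4 : σ3.reg 4 = a := by rw [r3 4 (by omega), r2 4 (by omega), ha]
  have q5 : σ3.reg 5 = b := by rw [r3 5 (by omega), r2 5 (by omega), hb]
  have mm3 : ∀ i, 3 * n ≤ i → σ3.mem i = σ.mem i := fun i hi => by
    rw [m3, m2 i (by omega) (by omega) (by omega), m1]
  refine .seq ((runs_markLevels (live := live) (lv := lv) hS hW q0 hj3 hjn
    (fun i hi => by rw [mm3 _ (by omega)]; exact hlev i hi)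
    (fun i hi => (hc.lev_le i hi).trans hLn)).mono le_rfl ?_)
  rintro σ4 ⟨r4, o4, m4, mark4⟩
  refine .seq ((runs_filterEdges (l := l) hS hW ((r4 0 (by omega)).trans q0)
    ((r4 6 (by omega)).trans hj3) hjn ((r4 4 (by omega)).trans q4) ((r4 5 (by omega)).trans q5)
    han hbn (hE.congr fun i hi _ => by rw [m4 i (.inr hi), mm3 i (by omega)])
    ((r4 3 (by omega)).trans q3) hlen hedge).mono le_rfl ?_)
  rintro σ5 ⟨r5, o5, m5, E5, l5, mark5⟩
  have s5 : ∀ r < 10, r ≠ 3 → σ5.reg r = σ3.reg r := fun r h h' => by rw [r5 r h h', r4 r h]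
  have hfresh : fresh a b l ⊆ live := by
    intro i hi
    simp only [fresh, Finset.mem_insert, List.mem_toFinset, List.mem_map, List.mem_filter] at hi
    rcases hi with rfl | ⟨e, ⟨he, -⟩, rfl⟩
    exacts [hal, (hc.edge e he).1]
  set B := batch live lv l a b j with hBdef
  have hmemB : ∀ i, i ∈ B ↔ (i ≠ b ∧ i ∈ live) ∧ (lv i ≤ j ∨ i ∈ fresh a b l) := fun i => by
    rw [hBdef, batch, Finset.mem_filter, Finset.mem_erase]
  -- Marking by level, then marking the fresh slots, then erasing `b` yields exactly the marks of
  -- the batch.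
  have hmark : ∀ i < n, σ5.mem (4 * n + i) = mark (live.erase b) B i := by
    intro i hi
    rw [mark5 i hi, mark4 i hi, mark]
    by_cases hib : i = b
    · simp [hib, hmemB]
    by_cases hil : i ∈ live
    · by_cases hf : i ∈ fresh a b l
      · simp [hib, hil, hf, hmemB]
      · by_cases hlj : lv i ≤ j <;> simp [hib, hil, hf, hlj, hmemB]
    · have hf : i ∉ fresh a b l := fun h => hil (hfresh h)
      simp [hib, hil, hf, hmemB]
  refine .seq ((runs_setLevels (b := b) (j := j) hS hW ((s5 0 (by omega) (by omega)).trans q0)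
    ((s5 6 (by omega) (by omega)).trans hj3) hjn ((s5 5 (by omega) (by omega)).trans q5) hbn
    (by rw [s5 4 (by omega) (by omega), q4]; exact han)
    (fun i hi => by rw [hmark i hi]; exact mark_le _ _ _)).mono le_rfl ?_)
  rintro σ6 ⟨r6, c6, o6, m6, lev6⟩
  have s6 : ∀ r < 7, r ≠ 3 → σ6.reg r = σ3.reg r := fun r h h' => by
    rw [r6 r h, s5 r (by omega) h']
  set cl' := Function.update cl a (.node k (cl a) (cl b)) with hcl'
  set ob' : ℕ → Ob := fun i => (cl' i).rep ops.join x with hob'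
  have hob'a : ob' a = ops.join (ob a) (ob b) := by simp [hob', hcl', hob, Cluster.rep]
  have hob'ne : ∀ i, i ≠ a → ob' i = ob i := fun i hi => by simp [hob', hcl', hob, hi]
  have hlen' : (l.filter fun e => keeps a b j e).length ≤ l.length := List.length_filter_le _ _
  have hBcard : B.card ≤ batchBound n L (k + 1) := hc.card_batch_le_batchBound hcard hj
  have hobj6 : ∀ i ∈ live.erase b, σ6.obj i = some (ob' i) := by
    intro i hi
    rw [o6, o5, o4, o3, o2 i]
    by_cases hia : i = a
    · rw [if_pos hia, hia, hob'a]
    · rw [if_neg hia, hob'ne i hia, o1]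
      exact (hslot i (Finset.mem_of_mem_erase hi)).2
  refine (runs_buildLine (ob := ob') (live := live.erase b) (B := B) (j := j)
    (l := l.filter fun e => keeps a b j e) hS hW
    ((s6 0 (by omega) (by omega)).trans q0) ((Finset.erase_subset _ _).trans hlive)
    batch_subset ?_ ((s6 6 (by omega) (by omega)).trans hj3) (by omega)
    (E5.congr fun i hi _ => m6 i (.inr (by omega))) ((r6 3 (by omega)).trans l5) (by omega)
    (fun i hi => by rw [m6 _ (.inr (by omega))]; exact hmark i hi) hobj6).mono
    (Nat.mul_le_mul_right _ (by omega)) ?_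
  · rw [c6, s5 4 (by omega) (by omega), q4]
    exact mem_batch_self hal hne'
  rintro σ7 ⟨r7, m7, o7, l', hline, E7, l7⟩
  have mm7 : ∀ i < 3 * n, σ7.mem i = σ2.mem i := fun i hi => by
    rw [m7 i (by omega), m6 i (.inl hi), m5 i (by omega), m4 i (.inl (by omega)), m3]
  -- The list of mergers is extended at position `k`; the first `k` forests do not see the change.
  set m' := Function.update m k (lab a, lab b) with hm'
  have hmm' : ∀ i < k, m i = m' i := fun i hi => by simp [hm', hi.ne]
  have hs' := hs.congr hmm'
  have hm'k : m' k = (lab a, lab b) := by simp [hm']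
  refine ⟨by rw [r7 0 (by omega), s6 0, q0] <;> omega, by rw [r7 1 (by omega), s6 1, q1] <;> omega,
    by rw [r7 2 (by omega), s6 2, q2] <;> omega, m', live.erase b,
    Function.update lab a (n + k), cl', fun i => if i ∈ B then j else lv i, _, l7, E7, ?_,
    hs'.merge hal hbl hne' hm'k, (Finset.erase_subset _ _).trans hlive, ?_, ?_, ?_, ?_⟩
  · intro i hi
    rw [mm7 _ (by omega), mm7 _ (by omega)]
    rcases Nat.lt_succ_iff_lt_or_eq.1 hi with hi | rfl
    · rw [m2 _ (by omega) (by omega) (by omega), m2 _ (by omega) (by omega) (by omega), m1,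
        ← hmm' i hi]
      exact hm i hi
    · rw [hm'k]
      exact ⟨out1, out2⟩
  · intro i hi
    have hil := Finset.mem_of_mem_erase hi
    have := hlt i hil
    refine ⟨?_, by rw [o7]; exact hobj6 i hi⟩
    rw [mm7 _ (by omega)]
    by_cases hia : i = a
    · rw [hia, lab2]; simp
    · rw [m2 _ (by omega) (by omega) (by omega), m1]
      simpa [hia] using (hslot i hil).1
  · intro i hi
    rw [m7 _ (by omega), lev6 i hi, hmark i hi, m5 _ (by omega), m4 _ (.inl (by omega)),
      mm3 _ (by omega), hlev i hi, mark]
    by_cases hiB : i ∈ B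
    · have := ((hmemB i).1 hiB).1
      simp [hiB, this.1, this.2]
    · have hbB : b ∉ B := fun h => ((hmemB b).1 h).1.1 rfl
      by_cases hib : i = b <;> by_cases hil : i ∈ live <;> simp [hiB, hib, hil, hbB]
  · refine hc.merge hcard hal hne' hj (slotDist_comm _ _) ?_ (fun i hi => rfl) hline
    intro p _ q _ hpa _ hqa _
    change slotDist ops ob' p q = slotDist ops ob p q
    simp only [slotDist, hob'ne p hpa, hob'ne q hqa]
  -- A pair is at least as long as its covering edge, and that edge is at least as long as the
  -- chosen pair.
  · refine (hpre.congr hmm').succ hs' hal hbl hne' hm'k fun p hp q hq hpq => ?_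
    obtain ⟨e', he', -, hle, -⟩ := hc.cover p hp q hq hpq
    exact (hmin e' he').trans (hle.trans (min_le_left _ _))

end

end Agglomerative

/-! ### Initialisation and total time of the conga line program -/

namespace Agglomerative

section

variable {Ob : Type u} {D : Type v} [LinearOrder D] {ops : Ops Ob D} {W S n : ℕ}
  {σ : State Ob D} {Q : State Ob D → Prop}

/-- The first `L` with `n ≤ 2 ^ L * (2 * L + 3)` is chosen. Raising `L` by one doubles this product
and adds `4 * 2 ^ L`, so it overshoots `n` by a constant factor only. -/
theorem runs_topLevel (hS : 60 * (n + 1) ≤ S) (hW : S ≤ W) (hn : σ.reg 0 = n) (hn1 : 1 < n) :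
    Runs ops W S topLevel (100 * (n + 1)) σ fun τ =>
      (∀ r < 11, r ≠ 1 → τ.reg r = σ.reg r) ∧ τ.mem = σ.mem ∧ τ.obj = σ.obj ∧
      n ≤ 2 ^ τ.reg 1 * (2 * τ.reg 1 + 3) ∧ 2 ^ τ.reg 1 * (2 * τ.reg 1 + 3) ≤ 6 * n ∧
      τ.reg 1 ≤ Nat.log 2 n + 1 := by
  let I : ℕ → State Ob D → Prop := fun f τ =>
    (∀ r < 11, r ≠ 1 → τ.reg r = σ.reg r) ∧ τ.mem = σ.mem ∧ τ.obj = σ.obj ∧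
    τ.reg 1 + f = n ∧ τ.reg 11 = 2 ^ τ.reg 1 ∧ 2 ^ τ.reg 1 * (2 * τ.reg 1 + 3) ≤ 6 * n ∧
    τ.reg 1 ≤ Nat.log 2 n + 1
  refine Runs.mono (T := 10 + (n * (9 + 20) + 9)) ?_ (by omega) fun _ => id
  refine .seq ((Runs.of_wp_le (Q := I n) (by decide) ?_).mono le_rfl fun τ hτ => ?_)
  · refine ⟨by simp, by simp; omega, fun r hr hr1 => ?_, by simp, by simp, by simp, by simp,
      by simp; omega, by simp⟩
    simp [hr.ne, hr1]
  refine Runs.while_fuel I ?_ _ hτ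
  rintro f τ ⟨h1, h2, h3, h4, h5, h6, h7⟩
  have r0 := h1 0 (by omega) (by omega)
  have hle : 2 ^ τ.reg 1 * 3 ≤ 2 ^ τ.reg 1 * (2 * τ.reg 1 + 3) :=
    Nat.mul_le_mul_left _ (by omega)
  have hlt : τ.reg 1 < 2 ^ τ.reg 1 := Nat.lt_two_pow_self
  simp only [Test.Ok, Expr.Ok, Test.Holds, Expr.val, r0, hn, h5]
  refine ⟨by omega, fun hb => ⟨h1, h2, h3, by omega, h6, h7⟩, fun hb => ?_⟩
  refine ⟨f - 1, by omega, Runs.of_wp_le (by decide) ?_⟩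
  have e1 : 2 ^ (τ.reg 1 + 1) * (2 * (τ.reg 1 + 1) + 3) =
      2 * (2 ^ τ.reg 1 * (2 * τ.reg 1 + 3)) + 4 * 2 ^ τ.reg 1 := by ring
  have e2 : τ.reg 1 ≤ Nat.log 2 n := Nat.le_log_of_pow_le (by omega) (by omega)
  simp [h5]
  repeat refine ⟨by omega, ?_⟩
  refine ⟨fun r hr hr1 => ?_, by simp [h2], by simp [h3], by simp; omega, by simp [pow_succ'],
    ?_, by simp; omega⟩
  · simp [hr.ne, hr1, h1 r hr]
  · simp only [State.reg_setReg]
    simp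
    rw [e1]
    omega

theorem runs_fillSlots {L : ℕ} (hS : 60 * (n + 1) ≤ S) (hW : S ≤ W) (hn : σ.reg 0 = n)
    (hL : σ.reg 1 = L) (hLn : L ≤ 2 * n) :
    Runs ops W S fillSlots (100 * (n + 1)) σ fun τ =>
      (∀ r < 11, r ≠ 6 → τ.reg r = σ.reg r) ∧ τ.reg 6 = L ∧ τ.obj = σ.obj ∧
      ∀ i < n, τ.mem (2 * n + i) = i ∧ τ.mem (3 * n + i) = L + 1 ∧ τ.mem (4 * n + i) = 2 := by
  let I : ℕ → State Ob D → Prop := fun k τ =>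
    (∀ r < 11, r ≠ 6 → τ.reg r = σ.reg r) ∧ τ.reg 6 = L ∧ τ.obj = σ.obj ∧ τ.reg 11 = k ∧
    ∀ i < k, τ.mem (2 * n + i) = i ∧ τ.mem (3 * n + i) = L + 1 ∧ τ.mem (4 * n + i) = 2
  refine Runs.mono (T := 10 + ((n - 0) * (3 + 50) + 3)) ?_ (by omega) fun _ => id
  refine .seq ((Runs.of_wp_le (Q := I 0) (by decide) ?_).mono le_rfl fun τ hτ => ?_)
  · refine ⟨by simp; omega, by simp, fun r hr hr1 => ?_, by simp [hL], by simp, by simp, by simp⟩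
    simp [hr.ne, hr1]
  refine Runs.while_count I (Nat.zero_le n) ?_ ?_ hτ
  · rintro i τ - hi ⟨h1, h2, h3, h4, h5⟩
    have r0 := h1 0 (by omega) (by omega)
    have r1 := h1 1 (by omega) (by omega)
    refine ⟨by simp; omega, by simp; omega, Runs.of_wp_le (by decide) ?_⟩
    simp [r0, hn, h4, r1, hL]
    repeat refine ⟨by omega, ?_⟩
    refine ⟨fun r hr hr1 => ?_, by simp [h2], by simp [h3], by simp, fun i' hi' => ?_⟩
    · simp [hr.ne, h1 r hr hr1]
    · simp only [State.mem_setReg, State.mem_setMem, add_right_inj]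
      rcases Nat.lt_succ_iff_lt_or_eq.1 hi' with hi' | rfl
      · rw [if_neg (by omega), if_neg (by omega), if_neg (by omega), if_neg (by omega),
          if_neg (by omega), if_neg (by omega), if_neg (by omega), if_neg (by omega),
          if_neg (by omega)]
        exact h5 i' hi'
      · rw [if_neg (by omega), if_neg (by omega), if_pos rfl, if_neg (by omega), if_pos rfl,
          if_pos rfl]
        exact ⟨rfl, rfl, rfl⟩
  · rintro τ ⟨h1, h2, h3, h4, h5⟩
    have r0 := h1 0 (by omega) (by omega)
    exact ⟨by simp; omega, by simp; omega, h1, h2, h3, h5⟩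

/-- Every memory address fits in a machine word. -/
theorem mul_succ_le_pow {c : ℕ} (hc : 0 < c) (n : ℕ) : c * (n + 1) ≤ (n + 2) ^ c := by
  obtain ⟨d, rfl⟩ := Nat.exists_eq_succ_of_ne_zero hc.ne'
  have h1 : d < 2 ^ d := Nat.lt_two_pow_self
  have h2 : 2 ^ d ≤ (n + 2) ^ d := Nat.pow_le_pow_left (by omega) d
  rw [pow_succ]
  exact Nat.mul_le_mul (by omega) (by omega)

/-- The total time of the conga line program. -/
theorem conga_time_le {n L : ℕ} (hn : 1 < n) (hL : L ≤ Nat.log 2 n + 1)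
    (hL' : n ≤ 2 ^ L * (2 * L + 3)) :
    100 * (n + 1) + (100 * (n + 1) + ((n + 1) * (300 * (n + 1)) +
      (∑ k ∈ Finset.Ico 0 (n - 1), (5 + (batchBound n L (k + 1) + 1) * (5000 * (n + 1))) + 5))) + 3
      ≤ 1000000 * (n ^ 2 * Nat.log 2 n ^ 2) := by
  set g := Nat.log 2 n with hg
  have hg1 : 1 ≤ g := Nat.le_log_of_pow_le (by omega) (by omega)
  have h1 : ∑ k ∈ Finset.Ico 0 (n - 1), (5 + (batchBound n L (k + 1) + 1) * (5000 * (n + 1))) ≤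
      ∑ k ∈ Finset.range n, (5 + (batchBound n L (k + 1) + 1) * (5000 * (n + 1))) := by
    refine Finset.sum_le_sum_of_subset fun k hk => ?_
    simp at hk ⊢; omega
  have h2 : ∑ k ∈ Finset.range n, (5 + (batchBound n L (k + 1) + 1) * (5000 * (n + 1))) =
      n * 5 + (∑ k ∈ Finset.range n, batchBound n L (k + 1) + n) * (5000 * (n + 1)) := by
    rw [Finset.sum_add_distrib, ← Finset.sum_mul, Finset.sum_add_distrib]
    simp
  have h3 := sum_batchBound_le hL'
  -- From `L ≤ g + 1` and `1 ≤ g`.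
  have h4 : (L + 1) * (2 * L + 3) ≤ 21 * g ^ 2 := by
    calc (L + 1) * (2 * L + 3) ≤ (3 * g) * (7 * g) := Nat.mul_le_mul (by omega) (by omega)
      _ = _ := by ring
  have h5 : 1 ≤ g ^ 2 := Nat.one_le_pow _ _ hg1
  have h6 : ∑ k ∈ Finset.range n, batchBound n L (k + 1) + n ≤ n * (22 * g ^ 2) := by
    calc _ ≤ n * (21 * g ^ 2) + n * g ^ 2 :=
          add_le_add (h3.trans (Nat.mul_le_mul_left _ h4)) (Nat.le_mul_of_pos_right _ h5)
      _ = _ := by ring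
  have h7 : (∑ k ∈ Finset.range n, batchBound n L (k + 1) + n) * (5000 * (n + 1)) ≤
      220000 * (n ^ 2 * g ^ 2) := by
    calc _ ≤ n * (22 * g ^ 2) * (5000 * (2 * n)) := Nat.mul_le_mul h6 (by omega)
      _ = _ := by ring
  have h8 : n ^ 2 * 1 ≤ n ^ 2 * g ^ 2 := Nat.mul_le_mul_left _ h5
  have h9 : (n + 1) * (300 * (n + 1)) ≤ 1200 * n ^ 2 := by nlinarith
  have h10 : n ≤ n ^ 2 := Nat.le_self_pow (by omega) n
  omega

theorem performs_congaProgram {c : ℕ} (hc : 1000000 ≤ c) (x : Fin n → Ob) :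
    Performs congaProgram ops x (repDist ops x) ((n + 2) ^ c) (c * (n + 1))
      (c * (n ^ 2 * Nat.log 2 n ^ 2 + 1)) := by
  have hS : 60 * (n + 1) ≤ c * (n + 1) := Nat.mul_le_mul_right _ (by omega)
  have hW := mul_succ_le_pow (c := c) (by omega) n
  generalize (n + 2) ^ c = W at hW
  have main : Runs ops W (c * (n + 1)) congaProgram (c * (n ^ 2 * Nat.log 2 n ^ 2 + 1))
      (initState x) fun σ =>
        IsAgglomeration (repDist ops x) fun k => (σ.mem (2 * k), σ.mem (2 * k + 1)) := by
    generalize hSd : c * (n + 1) = S at hS hW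
    by_cases hn1 : 1 < n
    swap
    -- For at most one object the logarithm vanishes; the summand `1` in the time bound pays for the
    -- initial test.
    · refine Runs.mono (T := 3 + 1) (.ite (by simp [initState]; omega) (fun h => ?_)
        fun h => Runs.of_wp_le (by decide) ?_) ?_ fun _ => id
      · simp [initState] at h; omega
      · intro k hk; omega
      · rw [mul_add]; omega
    obtain ⟨σ₀, hσ₀⟩ : ∃ σ₀ : State Ob D, σ₀ = initState x := ⟨_, rfl⟩
    rw [← hσ₀]
    have hr : ∀ r, r ≠ 0 → σ₀.reg r = 0 := fun r h => by simp [hσ₀, initState, h]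
    have hr0 : σ₀.reg 0 = n := by simp [hσ₀, initState]
    have hobj : ∀ i (h : i < n), σ₀.obj i = some (x ⟨i, h⟩) := fun i h => by
      simp [hσ₀, initState, h]
    clear hσ₀
    -- The remainder only makes the function total; slots from `n` on are never live.
    let cl : ℕ → Cluster n := fun i => .leaf ⟨i % n, Nat.mod_lt _ (by omega)⟩
    have hcl : ∀ i (h : i < n), cl i = .leaf ⟨i, h⟩ := fun i h => by
      simp [cl, Nat.mod_eq_of_lt h]
    suffices h : ∃ L, L ≤ Nat.log 2 n + 1 ∧ n ≤ 2 ^ L * (2 * L + 3) ∧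
        Runs ops W S (topLevel ;; fillSlots ;; buildLine ;;
          .while (.lt (.add (.reg 2) (.lit 1)) (.reg 0)) congaStep)
        (100 * (n + 1) + (100 * (n + 1) + ((n + 1) * (300 * (n + 1)) +
          (∑ k ∈ Finset.Ico 0 (n - 1), (5 + (batchBound n L (k + 1) + 1) * (5000 * (n + 1))) + 5))))
        σ₀ fun σ =>
          IsAgglomeration (repDist ops x) fun k => (σ.mem (2 * k), σ.mem (2 * k + 1)) by
      obtain ⟨L, hL1, hL2, h⟩ := h
      refine Runs.mono (.ite (T := 100 * (n + 1) + (100 * (n + 1) + ((n + 1) * (300 * (n + 1)) +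
          (∑ k ∈ Finset.Ico 0 (n - 1), (5 + (batchBound n L (k + 1) + 1) * (5000 * (n + 1))) + 5))))
          (by simp [hr0]; omega) (fun _ => h) fun h => ?_) ?_ fun _ => id
      · simp [hr0] at h; omega
      · have h1 := conga_time_le hn1 hL1 hL2
        have h2 : 1000000 * (n ^ 2 * Nat.log 2 n ^ 2) ≤ c * (n ^ 2 * Nat.log 2 n ^ 2 + 1) :=
          Nat.mul_le_mul hc (by omega)
        simp only [Test.cost, Expr.cost]
        omega
    obtain ⟨σ1, t1, hex, ht1, r1, m1, o1, hL1, hL2, hL3⟩ :=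
      runs_topLevel (ops := ops) hS hW hr0 hn1
    obtain ⟨L, hL⟩ : ∃ L, σ1.reg 1 = L := ⟨_, rfl⟩
    rw [hL] at hL1 hL2 hL3
    have hLn : L ≤ 2 * n := by
      have h1 : L < 2 ^ L := Nat.lt_two_pow_self
      have h2 : 2 ^ L * 3 ≤ 2 ^ L * (2 * L + 3) := Nat.mul_le_mul_left _ (by omega)
      omega
    refine ⟨L, hL3, hL1, .seq ⟨σ1, t1, hex, ht1, ?_⟩⟩
    refine .seq ((runs_fillSlots hS hW ((r1 0 (by omega) (by omega)).trans hr0) hL hLn).mono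
      le_rfl ?_)
    rintro σ2 ⟨r2, hj, o2, m2⟩
    have q : ∀ r < 11, r ≠ 0 → r ≠ 1 → r ≠ 6 → σ2.reg r = 0 := fun r h1 h2 h3 h4 => by
      rw [r2 r h1 h4, r1 r h1 h3, hr r h2]
    have q0 : σ2.reg 0 = n := by rw [r2 0 (by omega) (by omega), r1 0 (by omega) (by omega), hr0]
    have q1 : σ2.reg 1 = L := by rw [r2 1 (by omega) (by omega), hL]
    have hobj2 : ∀ i ∈ Finset.range n, σ2.obj i = some ((cl i).rep ops.join x) := fun i hi => by
      have hi := Finset.mem_range.1 hi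
      rw [o2, o1, hobj i hi, hcl i hi, Cluster.rep]
    refine .seq ((runs_buildLine (ob := fun i => (cl i).rep ops.join x) (live := Finset.range n)
      (B := Finset.range n) (l := []) hS hW q0 subset_rfl subset_rfl ?_ hj (by omega)
      (by simp [EdgesIn]) (by simp [q]) (by simp) (fun i hi => ?_) hobj2).mono (by simp) ?_)
    · simp [q]; omega
    · simp [mark, hi, (m2 i hi).2.2]
    rintro σ3 ⟨r3, m3, o3, l, hline, hE, hl⟩
    have inv : CongaInv ops x L 0 σ3 := by
      refine ⟨by rw [r3 0 (by omega), q0], by rw [r3 1 (by omega), q1],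
        by rw [r3 2 (by omega), q] <;> omega, fun _ => (0, 0), Finset.range n, fun i => i, cl,
        fun _ => L, l, by simpa using hl, by simpa using hE, by simp, ?_, subset_rfl, ?_, ?_, ?_, ?_⟩
      · have := Slots.init (fun _ => (0, 0)) 0 (lab := fun i => i) (cl := cl) (by simp)
          (fun i hi => by rw [zero_add]; exact hcl i hi)
        rwa [zero_add, ← Finset.range_eq_Ico] at this
      · intro i hi
        have hi' := Finset.mem_range.1 hi
        exact ⟨by rw [m3 _ (by omega), (m2 i hi').1], by rw [o3]; exact hobj2 i hi⟩
      · intro i hi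
        rw [m3 _ (by omega), (m2 i hi).2.1]
        simp [hi]
      · exact Conga.init (by simp) (fun _ _ => rfl) hline
      · intro i hi; omega
    refine Runs.while_sum (fun k => (batchBound n L (k + 1) + 1) * (5000 * (n + 1)))
      (CongaInv ops x L) (Nat.zero_le _) ?_ ?_ inv
    · intro k τ _ hk hτ
      have h0 := hτ.1
      have h2 := hτ.2.2.1
      exact ⟨by simp; omega, by simp; omega, runs_congaStep hS hW hL2 (by omega) hτ⟩
    · rintro τ ⟨h0, h1, h2, m, live, lab, cl, lv, l, -, -, hm, -, -, -, -, -, hpre⟩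
      refine ⟨by simp; omega, by simp; omega, (hpre.congr fun i hi => ?_).isAgglomeration⟩
      rw [(hm i hi).1, (hm i hi).2]
  obtain ⟨σ, t, h1, h2, h3⟩ := main
  exact ⟨σ, t, h1, h2, by omega, h3⟩

end

end Agglomerative

namespace Agglomerative

/-! ## The quadtree program

Register `0` holds the number `n` of objects, `1` a power `N` of two with `n ≤ N < 2 n`, `2` its
double `M`, `3` the number of mergers, `4` and `5` the slots to be merged.  The slots are numbered
from `N` on.  The word memory consists of rows of length `M`: the output, the labels, the sizes of
the clusters, the indicators of the slots in use, and then the rows of the quadtree.  A node of the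
quadtree holds the address of the smallest distance below it, or zero if there is none. -/

section Quadtree

variable {D : Type v} [LinearOrder D]

/-- `v` is the address of a smallest distance among the pairs in `P`. -/
def BestOf (M : ℕ) (dd : ℕ → ℕ → D) (P : ℕ → ℕ → Prop) (v : ℕ) : Prop :=
  (v = 0 ∧ ∀ x y, ¬ P x y) ∨
    ∃ x y, P x y ∧ v = x * M + y ∧ ∀ x' y', P x' y' → dd x y ≤ dd x' y'

theorem BestOf.congr {M : ℕ} {dd dd' : ℕ → ℕ → D} {P P' : ℕ → ℕ → Prop} {v : ℕ}
    (h : BestOf M dd P v) (hP : ∀ x y, P x y ↔ P' x y)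
    (hd : ∀ x y, P x y → dd x y = dd' x y) : BestOf M dd' P' v := by
  rcases h with ⟨h1, h2⟩ | ⟨x, y, h1, h2, h3⟩
  · exact .inl ⟨h1, fun x y h => h2 x y ((hP x y).2 h)⟩
  · refine .inr ⟨x, y, (hP x y).1 h1, h2, fun x' y' h' => ?_⟩
    rw [← hd x y h1, ← hd x' y' ((hP x' y').2 h')]
    exact h3 x' y' ((hP x' y').2 h')

/-- The pairs of slots in use below a node of height `h`. -/
def Below (live : Finset ℕ) (h r s x y : ℕ) : Prop :=
  (x ∈ live ∧ y ∈ live ∧ x ≠ y) ∧ x / 2 ^ h = r ∧ y / 2 ^ h = s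

/-- The row numbers of the nodes of height `h` in a tree of height `H`. -/
def Lvl (H h r : ℕ) : Prop := 2 ^ (H - h) ≤ r ∧ r < 2 * 2 ^ (H - h)

/-- A node holds a smallest distance below it. -/
def NodeOk (M : ℕ) (live : Finset ℕ) (dd : ℕ → ℕ → D) (mem : ℕ → ℕ) (h r s : ℕ) : Prop :=
  BestOf M dd (Below live h r s) (mem ((r + 4) * M + s))

theorem Lvl.lt {H h r : ℕ} (hr : Lvl H h r) : r < 2 * 2 ^ H :=
  hr.2.trans_le (Nat.mul_le_mul_left _ (Nat.pow_le_pow_right (by omega) (by omega)))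

theorem Lvl.pos {H h r : ℕ} (hr : Lvl H h r) : 0 < r := lt_of_lt_of_le (by positivity) hr.1

/-- The intervals `[2 ^ m, 2 ^ (m + 1))` are disjoint, so a row number determines its height. Nodes
of all heights therefore share one array without collision. -/
theorem Lvl.height_eq {H h h' r : ℕ} (hr : Lvl H h r) (hr' : Lvl H h' r) (hh : h ≤ H)
    (hh' : h' ≤ H) : h = h' := by
  have h1 : 2 ^ (H - h) < 2 ^ (H - h' + 1) := by rw [pow_succ']; exact hr.1.trans_lt hr'.2
  have h2 : 2 ^ (H - h') < 2 ^ (H - h + 1) := by rw [pow_succ']; exact hr'.1.trans_lt hr.2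
  rw [Nat.pow_lt_pow_iff_right (by omega)] at h1 h2
  omega

theorem Lvl.child {H h r i : ℕ} (hr : Lvl H (h + 1) r) (hh : h < H) (hi : i ≤ 1) :
    Lvl H h (2 * r + i) := by
  obtain ⟨h1, h2⟩ := hr
  have e : H - h = H - (h + 1) + 1 := by omega
  unfold Lvl
  rw [e, pow_succ]
  omega

theorem div_pow_succ (x h : ℕ) : x / 2 ^ (h + 1) = x / 2 ^ h / 2 := by
  rw [Nat.div_div_eq_div_mul, pow_succ]

theorem Lvl.div {H x : ℕ} (hx : Lvl H 0 x) {h : ℕ} (hh : h ≤ H) : Lvl H h (x / 2 ^ h) := by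
  induction h with
  | zero => simpa using hx
  | succ h ih =>
    obtain ⟨h1, h2⟩ := ih (by omega)
    have e : H - h = H - (h + 1) + 1 := by omega
    rw [e, pow_succ] at h1 h2
    rw [div_pow_succ]
    unfold Lvl
    omega

/-- The four quadrants of a node, in the order in which `recompute` visits them. -/
theorem below_succ {live : Finset ℕ} {h r s x y : ℕ} : Below live (h + 1) r s x y ↔
    ((Below live h (2 * r) (2 * s) x y ∨ Below live h (2 * r) (2 * s + 1) x y) ∨
      Below live h (2 * r + 1) (2 * s) x y) ∨ Below live h (2 * r + 1) (2 * s + 1) x y := by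
  unfold Below
  rw [div_pow_succ, div_pow_succ]
  have h1 : x / 2 ^ h / 2 = r ↔ x / 2 ^ h = 2 * r ∨ x / 2 ^ h = 2 * r + 1 := by omega
  have h2 : y / 2 ^ h / 2 = s ↔ y / 2 ^ h = 2 * s ∨ y / 2 ^ h = 2 * s + 1 := by omega
  rw [h1, h2]
  tauto

theorem row_inj {M a b x y : ℕ} (hx : x < M) (hy : y < M) (h : a * M + x = b * M + y) :
    a = b ∧ x = y := by
  have hM : 0 < M := by omega
  have h1 := congrArg (· / M) h
  simp only [mul_comm _ M, Nat.mul_add_div hM, Nat.div_eq_of_lt hx, Nat.div_eq_of_lt hy,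
    add_zero] at h1
  subst h1
  exact ⟨rfl, by omega⟩

theorem row_lt {M a b x : ℕ} (ha : a < b) (hx : x < M) : a * M + x < b * M := by
  calc a * M + x < a * M + M := by omega
    _ = (a + 1) * M := by ring
    _ ≤ b * M := Nat.mul_le_mul_right _ ha

end Quadtree

/-- The address of the node `(r, s)` of the quadtree. -/
abbrev nodeCell (r s : Expr) : Expr := .add (.mul (.add r (.lit 4)) (.reg 2)) s

/-- Replaces the address in register `9` by the one in the given cell, if that is better. -/
def improve (c : Expr) : Cmd :=
  .setReg 10 (.mem c) ;;
  .ite (.eq (.reg 10) (.lit 0)) .skip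
    (.ite (.eq (.reg 9) (.lit 0)) (.setReg 9 (.reg 10))
      (.ite (.leDist (.reg 9) (.reg 10)) .skip (.setReg 9 (.reg 10))))

/-- Recomputes the node of the quadtree whose row and column are in the registers `i`, `j`. -/
def recompute (i j : ℕ) : Cmd :=
  .setReg 9 (.mem (nodeCell (.mul (.lit 2) (.reg i)) (.mul (.lit 2) (.reg j)))) ;;
  improve (nodeCell (.mul (.lit 2) (.reg i)) (.add (.mul (.lit 2) (.reg j)) (.lit 1))) ;;
  improve (nodeCell (.add (.mul (.lit 2) (.reg i)) (.lit 1)) (.mul (.lit 2) (.reg j))) ;;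
  improve (nodeCell (.add (.mul (.lit 2) (.reg i)) (.lit 1))
    (.add (.mul (.lit 2) (.reg j)) (.lit 1))) ;;
  .store (nodeCell (.reg i) (.reg j)) (.reg 9)

/-- Recomputes all nodes above the slot in the register `p`. -/
def repair (p : ℕ) : Cmd :=
  (.setReg 6 (.div (.reg p) (.lit 2)) ;; .setReg 7 (.div (.reg 1) (.lit 2))) ;;
  .while (.lt (.lit 0) (.reg 7))
    (.setReg 8 (.reg 7) ;;
    .while (.lt (.reg 8) (.mul (.lit 2) (.reg 7)))
      (recompute 6 8 ;; recompute 8 6 ;; .setReg 8 (.add (.reg 8) (.lit 1))) ;;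
    .setReg 6 (.div (.reg 6) (.lit 2)) ;; .setReg 7 (.div (.reg 7) (.lit 2)))

section

variable {Ob : Type u} {D : Type v} [LinearOrder D] {ops : Ops Ob D} {W S M : ℕ}
  {σ : State Ob D} {Q : State Ob D → Prop} {dd : ℕ → ℕ → D}

/-- Combines the best entries of two sets of pairs into one for the union. Addresses of pairs are
positive, so zero safely encodes the absence of a pair. -/
theorem wp_improve {c : Expr} {P P' : ℕ → ℕ → Prop} {v : ℕ} (hW : S ≤ W) (hc : c.Ok W S σ)
    (hcS : c.val σ < S) (hv : σ.mem (c.val σ) = v)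
    (hP : ∀ x y, P x y ∨ P' x y →
      0 < x * M + y ∧ x * M + y < S ∧ σ.dst (x * M + y) = some (dd x y))
    (h9 : BestOf M dd P (σ.reg 9)) (hc' : BestOf M dd P' v)
    (h : ∀ τ : State Ob D, (∀ r, r ≠ 9 → r ≠ 10 → τ.reg r = σ.reg r) → τ.mem = σ.mem →
      τ.obj = σ.obj → τ.dst = σ.dst → BestOf M dd (fun x y => P x y ∨ P' x y) (τ.reg 9) → Q τ) :
    (improve c).Wp ops W S Q σ := by
  have hvS : v < S := by
    rcases hc' with ⟨h1, -⟩ | ⟨x, y, h1, h2, -⟩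
    · omega
    · exact h2 ▸ (hP x y (.inr h1)).2.1
  have h9S : σ.reg 9 < S := by
    rcases h9 with ⟨h1, -⟩ | ⟨x, y, h1, h2, -⟩
    · omega
    · exact h2 ▸ (hP x y (.inl h1)).2.1
  have hreg : ∀ r, r ≠ 9 → r ≠ 10 → (σ.setReg 10 v).reg r = σ.reg r := fun r _ h => by simp [h]
  have hreg' : ∀ r, r ≠ 9 → r ≠ 10 → ((σ.setReg 10 v).setReg 9 v).reg r = σ.reg r :=
    fun r h h' => by simp [h, h']
  rw [improve, Cmd.Wp.eq_10, Cmd.Wp.eq_2]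
  refine ⟨⟨hc, hcS, by omega⟩, ?_⟩
  simp only [Expr.val, hv]
  refine ⟨by simp; omega, fun e1 => ?_, fun e1 => ⟨by simp; omega, fun e2 => ?_, fun e2 => ?_⟩⟩
  · simp at e1
    refine h _ hreg rfl rfl rfl ?_
    rcases hc' with ⟨-, h2⟩ | ⟨x, y, h1, h2, -⟩
    · exact h9.congr (fun x y => by simp [h2 x y]) fun _ _ _ => rfl
    · have := (hP x y (.inr h1)).1
      omega
  · simp at e2
    refine ⟨by simp; omega, ?_⟩
    refine h _ hreg' rfl rfl rfl ?_
    rcases h9 with ⟨-, h2⟩ | ⟨x, y, h1, h2, -⟩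
    · simpa using hc'.congr (fun x y => by simp [h2 x y]) fun _ _ _ => rfl
    · have := (hP x y (.inl h1)).1
      omega
  · simp at e1 e2
    obtain ⟨x, y, h1, h2, h3⟩ := h9.resolve_left fun h => e2 h.1
    obtain ⟨x', y', h1', h2', h3'⟩ := hc'.resolve_left fun h => e1 h.1
    have d1 := (hP x y (.inl h1)).2.2
    have d2 := (hP x' y' (.inr h1')).2.2
    refine ⟨?_, fun hle => ?_, fun hle => ?_⟩
    · simp [h2, h2', d1, d2]; omega
    · simp [h2, h2', d1, d2] at hle
      refine h _ hreg rfl rfl rfl (.inr ⟨x, y, .inl h1, by simp [h2], ?_⟩)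
      rintro x'' y'' (h'' | h'')
      exacts [h3 _ _ h'', hle.trans (h3' _ _ h'')]
    · simp [h2, h2', d1, d2] at hle
      refine ⟨by simp; omega, ?_⟩
      simp only [Expr.val, State.reg_setReg, if_true]
      refine h _ hreg' rfl rfl rfl (.inr ⟨x', y', .inr h1', by simp [h2'], ?_⟩)
      rintro x'' y'' (h'' | h'')
      exacts [hle.le.trans (h3 _ _ h''), h3' _ _ h'']

theorem wp_recompute {i j r s h : ℕ} {live : Finset ℕ} (hS : (M + 4) * M ≤ S) (hW : S ≤ W)
    (hM4 : 4 ≤ M)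
    (hM : σ.reg 2 = M) (hi : σ.reg i = r) (hj : σ.reg j = s) (hi' : i ≠ 9 ∧ i ≠ 10)
    (hj' : j ≠ 9 ∧ j ≠ 10) (hr : 2 * r + 1 < M) (hs : 2 * s + 1 < M)
    (hlive : ∀ x ∈ live, 0 < x ∧ x < M)
    (hdst : ∀ x ∈ live, ∀ y ∈ live, x ≠ y → σ.dst (x * M + y) = some (dd x y))
    (h00 : NodeOk M live dd σ.mem h (2 * r) (2 * s))
    (h01 : NodeOk M live dd σ.mem h (2 * r) (2 * s + 1))
    (h10 : NodeOk M live dd σ.mem h (2 * r + 1) (2 * s))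
    (h11 : NodeOk M live dd σ.mem h (2 * r + 1) (2 * s + 1))
    (hQ : ∀ (τ : State Ob D) (v : ℕ), (∀ r, r ≠ 9 → r ≠ 10 → τ.reg r = σ.reg r) →
      (∀ a, τ.mem a = if a = (r + 4) * M + s then v else σ.mem a) →
      τ.obj = σ.obj → τ.dst = σ.dst → BestOf M dd (Below live (h + 1) r s) v → Q τ) :
    (recompute i j).Wp ops W S Q σ := by
  have hadr : ∀ a b, a < M → b < M → (a + 4) * M + b < S ∧ (a + 4) * M ≤ (a + 4) * M + b ∧
      a + 4 ≤ (a + 4) * M := fun a b ha hb =>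
    ⟨(row_lt (by omega) hb).trans_le hS, by omega, Nat.le_mul_of_pos_right _ (by omega)⟩
  have hval : ∀ x y, x ∈ live ∧ y ∈ live ∧ x ≠ y →
      0 < x * M + y ∧ x * M + y < S ∧ σ.dst (x * M + y) = some (dd x y) := by
    rintro x y ⟨hx, hy, hxy⟩
    have h1 := hlive x hx
    have h2 := hlive y hy
    exact ⟨by omega, (row_lt (by omega : x < M + 4) h2.2).trans_le hS, hdst x hx y hy hxy⟩
  have a00 := hadr (2 * r) (2 * s) (by omega) (by omega)
  have a01 := hadr (2 * r) (2 * s + 1) (by omega) (by omega)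
  have a10 := hadr (2 * r + 1) (2 * s) (by omega) (by omega)
  have a11 := hadr (2 * r + 1) (2 * s + 1) (by omega) (by omega)
  have ars := hadr r s (by omega) (by omega)
  have hMS : M < S := lt_of_lt_of_le (by nlinarith) hS
  have hv : ∀ {a b v}, v = σ.mem ((a + 4) * M + b) → NodeOk M live dd σ.mem h a b → v < S := by
    rintro a b v rfl (⟨h1, -⟩ | ⟨x, y, h1, h2, -⟩)
    · omega
    · exact h2 ▸ (hval x y h1.1).2.1
  have v00 := hv rfl h00
  have v01 := hv rfl h01
  have v10 := hv rfl h10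
  have v11 := hv rfl h11
  simp only [recompute, Cmd.Wp.eq_10, Cmd.Wp.eq_2]
  refine ⟨?_, ?_⟩
  · simp [hM, hi, hj]; omega
  simp only [Expr.val, hM, hi, hj]
  refine wp_improve (M := M) (dd := dd) (P := Below live h (2 * r) (2 * s))
    (P' := Below live h (2 * r) (2 * s + 1)) hW ?_ ?_ rfl ?_ ?_ ?_ ?_
  · simp [hM, hi, hj, hi'.1, hj'.1]; omega
  · simp [hM, hi, hj, hi'.1, hj'.1]; omega
  · rintro x y (h' | h')
    exacts [hval x y h'.1, hval x y h'.1]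
  · simpa [NodeOk] using h00
  · simpa [NodeOk, hM, hi, hj, hi'.1, hj'.1] using h01
  intro τ1 r1 m1 o1 d1 b1
  have k2 : τ1.reg 2 = M := by simp [r1, hM]
  have ki : τ1.reg i = r := by simp [r1 i hi'.1 hi'.2, hi'.1, hi]
  have kj : τ1.reg j = s := by simp [r1 j hj'.1 hj'.2, hj'.1, hj]
  simp only [State.mem_setReg, State.obj_setReg, State.dst_setReg] at m1 o1 d1
  refine wp_improve (M := M) (dd := dd)
    (P' := Below live h (2 * r + 1) (2 * s)) hW ?_ ?_ rfl ?_ b1 ?_ ?_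
  · simp [k2, ki, kj]; omega
  · simp [k2, ki, kj]; omega
  · rintro x y ((h' | h') | h') <;> rw [d1]
    exacts [hval x y h'.1, hval x y h'.1, hval x y h'.1]
  · simpa [NodeOk, k2, ki, kj, m1] using h10
  intro τ2 r2 m2 o2 d2 b2
  have l2 : τ2.reg 2 = M := by rw [r2 2 (by omega) (by omega), k2]
  have li : τ2.reg i = r := by rw [r2 i hi'.1 hi'.2, ki]
  have lj : τ2.reg j = s := by rw [r2 j hj'.1 hj'.2, kj]
  refine wp_improve (M := M) (dd := dd)
    (P' := Below live h (2 * r + 1) (2 * s + 1)) hW ?_ ?_ rfl ?_ b2 ?_ ?_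
  · simp [l2, li, lj]; omega
  · simp [l2, li, lj]; omega
  · rintro x y (((h' | h') | h') | h') <;> rw [d2, d1]
    exacts [hval x y h'.1, hval x y h'.1, hval x y h'.1, hval x y h'.1]
  · simpa [NodeOk, l2, li, lj, m2, m1] using h11
  intro τ3 r3 m3 o3 d3 b3
  have n2 : τ3.reg 2 = M := by rw [r3 2 (by omega) (by omega), l2]
  have ni : τ3.reg i = r := by rw [r3 i hi'.1 hi'.2, li]
  have nj : τ3.reg j = s := by rw [r3 j hj'.1 hj'.2, lj]
  have h9 : τ3.reg 9 < S := by
    rcases b3 with ⟨h1, -⟩ | ⟨x, y, h1, h2, -⟩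
    · omega
    · rw [h2]
      rcases h1 with ((h' | h') | h') | h'
      exacts [(hval x y h'.1).2.1, (hval x y h'.1).2.1, (hval x y h'.1).2.1, (hval x y h'.1).2.1]
  refine ⟨by simp [n2, ni, nj]; omega, by simp; omega, ?_⟩
  refine hQ _ (τ3.reg 9) (fun r' h h' => ?_) (fun a => ?_) ?_ ?_ ?_
  · simp [r3 r' h h', r2 r' h h', r1 r' h h', h]
  · simp [n2, ni, nj, m3, m2, m1]
  · simp [o3, o2, o1]
  · simp [d3, d2, d1]
  · exact b3.congr (fun x y => below_succ.symm) fun _ _ _ => rfl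

end

end Agglomerative

/-! ### Repair of the quadtree above one slot -/

namespace Agglomerative

section

variable {Ob : Type u} {D : Type v} [LinearOrder D] {ops : Ops Ob D} {W S M : ℕ}
  {σ : State Ob D} {Q : State Ob D → Prop} {dd : ℕ → ℕ → D}

/-- A node needs recomputation only if its row or its column is the ancestor `a / 2 ^ h` of `a`.
This leaves a cross of fewer than `2 * 2 ^ (H - h)` nodes at height `h`. Working upwards, the four
children of each node are already correct. -/
theorem runs_repair {p a H : ℕ} {live : Finset ℕ} (hp : p < 6) (hpa : σ.reg p = a)
    (hMH : M = 2 * 2 ^ H) (hH : 1 ≤ H) (hS : (M + 4) * M ≤ S) (hW : S ≤ W)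
    (hN : σ.reg 1 = 2 ^ H) (hM : σ.reg 2 = M) (ha : Lvl H 0 a) (hlive : ∀ x ∈ live, Lvl H 0 x)
    (hdst : ∀ x ∈ live, ∀ y ∈ live, x ≠ y → σ.dst (x * M + y) = some (dd x y))
    (hnode : ∀ h r s, h ≤ H → Lvl H h r → Lvl H h s → h = 0 ∨ (r ≠ a / 2 ^ h ∧ s ≠ a / 2 ^ h) →
      NodeOk M live dd σ.mem h r s) :
    Runs ops W S (repair p) (1000 * 2 ^ H) σ fun τ =>
      (∀ r < 6, τ.reg r = σ.reg r) ∧ τ.obj = σ.obj ∧ τ.dst = σ.dst ∧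
      (∀ i < 4 * M, τ.mem i = σ.mem i) ∧
      ∀ h r s, h ≤ H → Lvl H h r → Lvl H h s → NodeOk M live dd τ.mem h r s := by
  have hlive' : ∀ x ∈ live, 0 < x ∧ x < M := fun x hx => ⟨(hlive x hx).pos, hMH ▸ (hlive x hx).lt⟩
  have hM4 : 4 ≤ M := by
    have : 2 ^ 1 ≤ 2 ^ H := Nat.pow_le_pow_right (by omega) hH
    omega
  have hMS : 4 * M < S := lt_of_lt_of_le (by nlinarith) hS
  -- the frame, and the nodes that are already correct
  let F : (ℕ → ℕ → ℕ → Prop) → State Ob D → Prop := fun G τ =>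
    (∀ r < 6, τ.reg r = σ.reg r) ∧ τ.obj = σ.obj ∧ τ.dst = σ.dst ∧
    (∀ i < 4 * M, τ.mem i = σ.mem i) ∧
    ∀ h r s, h ≤ H → Lvl H h r → Lvl H h s →
      (h = 0 ∨ (r ≠ a / 2 ^ h ∧ s ≠ a / 2 ^ h) ∨ G h r s) → NodeOk M live dd τ.mem h r s
  let I : ℕ → State Ob D → Prop := fun h τ =>
    τ.reg 6 = a / 2 ^ h ∧ τ.reg 7 = 2 ^ H / 2 ^ h ∧ F (fun h' _ _ => h' < h) τ
  have hFw : ∀ {G} {τ τ' : State Ob D}, F G τ → (∀ r < 6, τ'.reg r = τ.reg r) → τ'.mem = τ.mem →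
      τ'.obj = τ.obj → τ'.dst = τ.dst → F G τ' := by
    rintro G τ τ' ⟨h1, h2, h3, h4, h5⟩ g1 g2 g3 g4
    exact ⟨fun r hr => by rw [g1 r hr, h1 r hr], by rw [g3, h2], by rw [g4, h3],
      by rw [g2]; exact h4, by rw [g2]; exact h5⟩
  have hset : ∀ {G : ℕ → ℕ → ℕ → Prop} {τ τ' : State Ob D} {h r₀ s₀ v : ℕ}, F G τ → h ≤ H →
      Lvl H h r₀ → Lvl H h s₀ → (∀ r, r ≠ 9 → r ≠ 10 → τ'.reg r = τ.reg r) →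
      (∀ a, τ'.mem a = if a = (r₀ + 4) * M + s₀ then v else τ.mem a) →
      τ'.obj = τ.obj → τ'.dst = τ.dst → BestOf M dd (Below live h r₀ s₀) v →
      F (fun h' r s => G h' r s ∨ (h' = h ∧ r = r₀ ∧ s = s₀)) τ' := by
    rintro G τ τ' h r₀ s₀ v ⟨h1, h2, h3, h4, h5⟩ hh hr₀ hs₀ g1 g2 g3 g4 g5
    refine ⟨fun r hr => by rw [g1 r (by omega) (by omega), h1 r hr], by rw [g3, h2],
      by rw [g4, h3], fun i hi => ?_, fun h' r s hh' hr hs hG => ?_⟩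
    · rw [g2, if_neg, h4 i hi]
      have : 4 * M ≤ (r₀ + 4) * M := Nat.mul_le_mul_right _ (by omega)
      omega
    · unfold NodeOk
      rw [g2]
      by_cases e : r = r₀ ∧ s = s₀
      · obtain ⟨rfl, rfl⟩ := e
        obtain rfl := hr.height_eq hr₀ hh' hh
        rwa [if_pos rfl]
      · rw [if_neg]
        · refine h5 h' r s hh' hr hs ?_
          tauto
        · intro e'
          have := row_inj (hMH ▸ hs.lt) (hMH ▸ hs₀.lt) e'
          exact e ⟨by omega, this.2⟩
  have hrec : ∀ {G : ℕ → ℕ → ℕ → Prop} {τ : State Ob D} {h i j r s : ℕ} {Q : State Ob D → Prop},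
      F G τ → h + 1 ≤ H → (∀ r s, G h r s) → τ.reg i = r → τ.reg j = s →
      (i ≠ 9 ∧ i ≠ 10) → (j ≠ 9 ∧ j ≠ 10) → Lvl H (h + 1) r → Lvl H (h + 1) s →
      (∀ τ', F (fun h' r' s' => G h' r' s' ∨ (h' = h + 1 ∧ r' = r ∧ s' = s)) τ' →
        (∀ r, r ≠ 9 → r ≠ 10 → τ'.reg r = τ.reg r) → Q τ') →
      (recompute i j).Wp ops W S Q τ := by
    intro G τ h i j r s Q hF hh hG hi hj hi' hj' hr hs hQ
    obtain ⟨h1, h2, h3, h4, h5⟩ := id hF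
    have c : ∀ {r}, Lvl H (h + 1) r → ∀ i ≤ 1, Lvl H h (2 * r + i) :=
      fun hr i hi => hr.child (by omega) hi
    have hlt := (c hr 1 le_rfl).lt
    have hlt' := (c hs 1 le_rfl).lt
    have n : ∀ i ≤ 1, ∀ j ≤ 1, NodeOk M live dd τ.mem h (2 * r + i) (2 * s + j) :=
      fun i hi j hj => h5 h _ _ (by omega) (c hr i hi) (c hs j hj) (.inr (.inr (hG _ _)))
    refine wp_recompute (dd := dd) (live := live) (h := h) hS hW hM4 ((h1 2 (by omega)).trans hM)
      hi hj hi' hj' (by omega) (by omega) hlive' (by rw [h3]; exact hdst)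
      (n 0 (by omega) 0 (by omega)) (n 0 (by omega) 1 (by omega)) (n 1 (by omega) 0 (by omega))
      (n 1 (by omega) 1 (by omega)) ?_
    intro τ' v g1 g2 g3 g4 g5
    exact hQ τ' (hset hF hh hr hs g1 g2 g3 g4 g5) g1
  have step : ∀ h τ, 1 ≤ h → h < H + 1 → I h τ →
      (Test.lt (.lit 0) (.reg 7)).Ok W S τ ∧ (Test.lt (.lit 0) (.reg 7)).Holds τ ∧
      Runs ops W S (.setReg 8 (.reg 7) ;;
      .while (.lt (.reg 8) (.mul (.lit 2) (.reg 7)))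
        (recompute 6 8 ;; recompute 8 6 ;; .setReg 8 (.add (.reg 8) (.lit 1))) ;;
      .setReg 6 (.div (.reg 6) (.lit 2)) ;; .setReg 7 (.div (.reg 7) (.lit 2)))
      (2 + (2 ^ (H - h) * (5 + 400) + 5 + 8)) τ (I (h + 1)) := by
    rintro h τ h0 hh ⟨h6, h7, hF⟩
    have hdiv : 2 ^ H / 2 ^ h = 2 ^ (H - h) := Nat.pow_div (by omega) (by omega)
    rw [hdiv] at h7
    have hA : Lvl H h (a / 2 ^ h) := ha.div (by omega)
    have hAlt := hA.lt
    set m := 2 ^ (H - h) with hm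
    have hmpos : 0 < m := by positivity
    have hmM : 2 * m ≤ M := by
      rw [hMH]
      exact Nat.mul_le_mul_left _ (Nat.pow_le_pow_right (by omega) (by omega))
    -- Both arms of the cross have been recomputed up to the position `s₀`; positions at this height
    -- range over `[m, 2 * m)`.
    let J : ℕ → State Ob D → Prop := fun s₀ τ =>
      τ.reg 6 = a / 2 ^ h ∧ τ.reg 7 = m ∧ τ.reg 8 = s₀ ∧ F (fun h' r s => h' < h ∨
        (h' = h ∧ (r = a / 2 ^ h ∧ s < s₀ ∨ s = a / 2 ^ h ∧ r < s₀))) τ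
    refine ⟨by simp; omega, by simp; omega, ?_⟩
    refine .seq ((Runs.of_wp_le (Q := J m) (by decide) ?_).mono le_rfl fun τ hτ => ?_)
    · refine ⟨by simp; omega, by simp [h6], by simp [h7], by simp [h7], ?_⟩
      obtain ⟨h1, h2, h3, h4, h5⟩ := hF
      refine ⟨fun r hr => by simp [show r ≠ 8 by omega, h1 r hr], h2, h3, h4,
        fun h' r s hh' hr hs hG => h5 h' r s hh' hr hs ?_⟩
      rcases hG with hG | hG | hG | ⟨rfl, hG⟩
      · exact .inl hG
      · exact .inr (.inl hG)
      · exact .inr (.inr hG)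
      · have := hr.1
        have := hs.1
        omega
    refine .seq ((Runs.while_count J (C := 400) (Q := J (2 * m)) (by omega : m ≤ 2 * m) ?_ ?_
      hτ).mono (by rw [show 2 * m - m = m by omega]; rfl) ?_)
    · rintro s₀ τ hs0 hs1 ⟨g6, g7, g8, gF⟩
      refine ⟨by simp; omega, by simp; omega, Runs.of_wp_le (by decide) ?_⟩
      obtain ⟨h, rfl⟩ := Nat.exists_eq_succ_of_ne_zero (show h ≠ 0 by omega)
      have hs₀ : Lvl H (h + 1) s₀ := ⟨hs0, hs1⟩
      rw [Cmd.Wp.eq_10]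
      refine hrec gF (by omega) (fun _ _ => .inl (by omega)) g6 g8 (by omega) (by omega) hA hs₀ ?_
      intro τ1 F1 r1
      rw [Cmd.Wp.eq_10]
      refine hrec F1 (by omega) (fun _ _ => .inl (.inl (by omega)))
        ((r1 8 (by omega) (by omega)).trans g8) ((r1 6 (by omega) (by omega)).trans g6) (by omega)
        (by omega) hs₀ hA ?_
      intro τ2 F2 r2
      have p : ∀ r, r ≠ 9 → r ≠ 10 → τ2.reg r = τ.reg r := fun r h h' => by rw [r2 r h h', r1 r h h']
      have p6 := p 6 (by omega) (by omega)
      have p7 := p 7 (by omega) (by omega)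
      have p8 := p 8 (by omega) (by omega)
      have : s₀ < M := hMH ▸ hs₀.lt
      refine ⟨by simp; omega, by simp [p6, g6], by simp [p7, g7], by simp [p8, g8], ?_⟩
      obtain ⟨h1, h2, h3, h4, h5⟩ := F2
      refine ⟨fun r hr => by simp [show r ≠ 8 by omega, h1 r hr], h2, h3, h4,
        fun h' r s hh' hr hs hG => h5 h' r s hh' hr hs ?_⟩
      rcases hG with hG | hG | hG | ⟨rfl, hG⟩
      · exact .inl hG
      · exact .inr (.inl hG)
      · exact .inr (.inr (.inl (.inl (.inl hG))))
      · refine .inr (.inr ?_)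
        rcases hG with ⟨e, hlt⟩ | ⟨e, hlt⟩
        · rcases Nat.lt_succ_iff_lt_or_eq.1 hlt with hlt | rfl
          · exact .inl (.inl (.inr ⟨rfl, .inl ⟨e, hlt⟩⟩))
          · exact .inl (.inr ⟨rfl, e, rfl⟩)
        · rcases Nat.lt_succ_iff_lt_or_eq.1 hlt with hlt | rfl
          · exact .inl (.inl (.inr ⟨rfl, .inr ⟨e, hlt⟩⟩))
          · exact .inr ⟨rfl, rfl, e⟩
    · rintro τ ⟨g6, g7, g8, gF⟩
      exact ⟨by simp; omega, by simp; omega, g6, g7, g8, gF⟩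
    · rintro τ ⟨g6, g7, g8, gF⟩
      refine Runs.of_wp_le (by decide) ?_
      simp [g6, g7]
      repeat refine ⟨by omega, ?_⟩
      refine ⟨by simp [div_pow_succ], by simp [div_pow_succ, hdiv], ?_⟩
      obtain ⟨h1, h2, h3, h4, h5⟩ := gF
      refine ⟨fun r hr => by simp [show r ≠ 6 by omega, show r ≠ 7 by omega, h1 r hr], h2, h3, h4,
        fun h' r s hh' hr hs hG => h5 h' r s hh' hr hs ?_⟩
      rcases hG with hG | hG | hG
      · exact .inl hG
      · exact .inr (.inl hG)
      · rcases Nat.lt_succ_iff_lt_or_eq.1 hG with hG | rfl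
        · exact .inr (.inr (.inl hG))
        · have := hr.2
          have := hs.2
          by_cases e1 : r = a / 2 ^ h'
          · exact .inr (.inr (.inr ⟨rfl, .inl ⟨e1, by omega⟩⟩))
          · by_cases e2 : s = a / 2 ^ h'
            · exact .inr (.inr (.inr ⟨rfl, .inr ⟨e2, by omega⟩⟩))
            · exact .inr (.inl ⟨e1, e2⟩)
  have haM := ha.lt
  -- The main terms form a geometric series; the constant overhead of each of the `H` rounds is
  -- absorbed by `H < 2 ^ H`.
  have sumle : ∑ h ∈ Finset.Ico 1 (H + 1), (3 + (2 + (2 ^ (H - h) * (5 + 400) + 5 + 8))) ≤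
      423 * 2 ^ H := by
    have h1 : ∑ h ∈ Finset.Ico 1 (H + 1), 2 ^ (H - h) ≤ 2 ^ H := by
      rw [Finset.sum_Ico_eq_sum_range]
      have : ∑ i ∈ Finset.range (H + 1 - 1), 2 ^ (H - (1 + i)) =
          ∑ i ∈ Finset.range H, 2 ^ (H - 1 - i) :=
        Finset.sum_congr (by simp) fun i _ => by rw [Nat.sub_sub]
      rw [this, Finset.sum_range_reflect (fun i => 2 ^ i) H, Nat.geomSum_eq le_rfl]
      simp
    have h2 : H < 2 ^ H := Nat.lt_two_pow_self
    calc _ = ∑ h ∈ Finset.Ico 1 (H + 1), (2 ^ (H - h) * 405 + 18) :=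
          Finset.sum_congr rfl fun _ _ => by ring
      _ = (∑ h ∈ Finset.Ico 1 (H + 1), 2 ^ (H - h)) * 405 + H * 18 := by
          rw [Finset.sum_add_distrib, Finset.sum_mul]
          simp
      _ ≤ _ := by omega
  have hpos : 0 < 2 ^ H := by positivity
  refine Runs.mono (T := 10 + (∑ h ∈ Finset.Ico 1 (H + 1),
    (3 + (2 + (2 ^ (H - h) * (5 + 400) + 5 + 8))) + 3)) ?_ (by omega) fun _ => id
  refine .seq ((Runs.of_wp_le (Q := I 1) (by simp [Cmd.maxCost] : _ ≤ 10) ?_).mono le_rfl fun τ hτ =>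
    Runs.while_sum (fun h => 2 + (2 ^ (H - h) * (5 + 400) + 5 + 8)) I (by omega) step ?_ hτ)
  · simp [hN, hpa]
    repeat refine ⟨by omega, ?_⟩
    refine ⟨by simp, by simp, ⟨fun r hr => ?_, by simp, by simp, by simp,
      fun h r s hh hr hs hG => hnode h r s hh hr hs (by omega)⟩⟩
    simp [show r ≠ 6 by omega, show r ≠ 7 by omega]
  · rintro τ ⟨h6, h7, h1, h2, h3, h4, h5⟩
    have e : 2 ^ H / 2 ^ (H + 1) = 0 := Nat.div_eq_of_lt (Nat.pow_lt_pow_right (by omega) (by omega))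
    rw [e] at h7
    exact ⟨by simp; omega, by simp; omega, h1, h2, h3, h4, fun h r s hh hr hs =>
      h5 h r s hh hr hs (.inr (.inr (by omega)))⟩

end

end Agglomerative

/-! ### Building the quadtree -/

namespace Agglomerative

/-- The cell `e` of the row `k` of the word memory. -/
abbrev rowCell (k : ℕ) (e : Expr) : Expr := .add (.mul (.lit k) (.reg 2)) e

/-- The address of the distance between two slots. -/
abbrev distCell (x y : Expr) : Expr := .add (.mul x (.reg 2)) y

/-- Computes the number of leaves of a side of the quadtree. -/
def findSize : Cmd :=
  .setReg 1 (.lit 1) ;;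
  .while (.lt (.reg 1) (.reg 0)) (.setReg 1 (.mul (.lit 2) (.reg 1))) ;;
  .setReg 2 (.mul (.lit 2) (.reg 1)) ;; .setReg 4 (.reg 1)

def insertBody : Cmd :=
  .evalDist (distCell (.reg 4) (.reg 11)) (.sub (.reg 4) (.reg 1)) (.sub (.reg 11) (.reg 1)) ;;
  .evalDist (distCell (.reg 11) (.reg 4)) (.sub (.reg 11) (.reg 1)) (.sub (.reg 4) (.reg 1)) ;;
  .store (nodeCell (.reg 4) (.reg 11)) (distCell (.reg 4) (.reg 11)) ;;
  .store (nodeCell (.reg 11) (.reg 4)) (distCell (.reg 11) (.reg 4)) ;;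
  .setReg 11 (.add (.reg 11) (.lit 1))

/-- Puts an object into the slot in the register `4`. -/
def insertSlot : Cmd :=
  (.store (rowCell 1 (.reg 4)) (.sub (.reg 4) (.reg 1)) ;;
    .store (rowCell 2 (.reg 4)) (.lit 1) ;; .store (rowCell 3 (.reg 4)) (.lit 1) ;;
    .setReg 11 (.reg 1)) ;;
  .while (.lt (.reg 11) (.reg 4)) insertBody ;;
  repair 4 ;; .setReg 4 (.add (.reg 4) (.lit 1))

section

variable {D : Type v} [LinearOrder D] {M H a h r s : ℕ} {live live' : Finset ℕ}
  {dd dd' : ℕ → ℕ → D} {mem mem' : ℕ → ℕ}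

/-- A leaf stores an address, not a distance, so it stays correct when the distances change. -/
theorem nodeOk_zero_iff : NodeOk M live dd mem 0 r s ↔
    mem ((r + 4) * M + s) = if r ∈ live ∧ s ∈ live ∧ r ≠ s then r * M + s else 0 := by
  simp only [NodeOk, BestOf, Below, pow_zero, Nat.div_one]
  constructor
  · rintro (⟨h1, h2⟩ | ⟨x, y, ⟨h1, rfl, rfl⟩, h2, -⟩)
    · rw [h1, if_neg]
      exact fun h => h2 r s ⟨h, rfl, rfl⟩
    · rw [h2, if_pos h1]
  · intro h
    split_ifs at h with hc
    · refine .inr ⟨r, s, ⟨hc, rfl, rfl⟩, h, ?_⟩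
      rintro x y ⟨-, rfl, rfl⟩
      exact le_rfl
    · refine .inl ⟨h, ?_⟩
      rintro x y ⟨h1, rfl, rfl⟩
      exact hc h1

/-- Nodes that are not above the slot `a` do not depend on it. -/
theorem NodeOk.of_ne (hok : NodeOk M live dd mem h r s) (hr : r ≠ a / 2 ^ h) (hs : s ≠ a / 2 ^ h)
    (hmem : mem' ((r + 4) * M + s) = mem ((r + 4) * M + s))
    (hlive : ∀ x, x ≠ a → (x ∈ live ↔ x ∈ live'))
    (hdd : ∀ x ∈ live, ∀ y ∈ live, x ≠ a → y ≠ a → dd x y = dd' x y) :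
    NodeOk M live' dd' mem' h r s := by
  unfold NodeOk
  rw [hmem]
  have ne : ∀ {x}, x / 2 ^ h = r ∨ x / 2 ^ h = s → x ≠ a := by
    rintro x hx rfl
    rcases hx with hx | hx
    exacts [hr hx.symm, hs hx.symm]
  refine BestOf.congr hok (fun x y => ?_) ?_
  · unfold Below
    constructor
    · rintro ⟨⟨h1, h2, h3⟩, h4, h5⟩
      exact ⟨⟨(hlive x (ne (.inl h4))).1 h1, (hlive y (ne (.inr h5))).1 h2, h3⟩, h4, h5⟩
    · rintro ⟨⟨h1, h2, h3⟩, h4, h5⟩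
      exact ⟨⟨(hlive x (ne (.inl h4))).2 h1, (hlive y (ne (.inr h5))).2 h2, h3⟩, h4, h5⟩
  · rintro x y ⟨⟨h1, h2, -⟩, h4, h5⟩
    exact hdd x h1 y h2 (ne (.inl h4)) (ne (.inr h5))

/-- A node above no leaf of the row or column `a` is not a leaf of that row or column. -/
theorem node_ne_of_div_ne (hh : h ≤ H) (hr : Lvl H h r) (ha : Lvl H 0 a) (hne : r ≠ a / 2 ^ h) :
    r ≠ a := by
  rintro rfl
  obtain rfl := hr.height_eq ha hh (Nat.zero_le _)
  simp at hne

theorem lvl_zero : Lvl H 0 a ↔ 2 ^ H ≤ a ∧ a < 2 * 2 ^ H := Iff.rfl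

end

section

variable {Ob : Type u} {D : Type v} [LinearOrder D] {ops : Ops Ob D} {W S M n : ℕ}
  {σ : State Ob D} {Q : State Ob D → Prop} {dd : ℕ → ℕ → D}

theorem runs_findSize (hn : σ.reg 0 = n) (hn1 : 1 < n) (hW : 8 * n ≤ W) :
    Runs ops W S findSize (100 * n) σ fun τ =>
      (∀ r, r ≠ 1 → r ≠ 2 → r ≠ 4 → τ.reg r = σ.reg r) ∧ τ.mem = σ.mem ∧ τ.obj = σ.obj ∧
      ∃ H, 1 ≤ H ∧ n ≤ 2 ^ H ∧ 2 ^ H < 2 * n ∧ τ.reg 1 = 2 ^ H ∧ τ.reg 2 = 2 * 2 ^ H ∧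
        τ.reg 4 = 2 ^ H := by
  let K : State Ob D → Prop := fun τ =>
    (∀ r, r ≠ 1 → r ≠ 2 → r ≠ 4 → τ.reg r = σ.reg r) ∧ τ.mem = σ.mem ∧ τ.obj = σ.obj ∧
    ∃ H, 1 ≤ H ∧ n ≤ 2 ^ H ∧ 2 ^ H < 2 * n ∧ τ.reg 1 = 2 ^ H ∧ τ.reg 2 = 2 * 2 ^ H ∧
      τ.reg 4 = 2 ^ H
  change Runs ops W S findSize (100 * n) σ K
  let I : ℕ → State Ob D → Prop := fun f τ =>
    (∀ r, r ≠ 1 → τ.reg r = σ.reg r) ∧ τ.mem = σ.mem ∧ τ.obj = σ.obj ∧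
    ∃ H, H + f = n ∧ 2 ^ H < 2 * n ∧ τ.reg 1 = 2 ^ H
  refine Runs.mono (T := 2 + (n * (3 + 4) + 3 + 6)) ?_ (by omega) fun _ => id
  refine .seq ((Runs.of_wp_le (Q := I n) (by decide) ?_).mono le_rfl fun τ hτ => ?_)
  · exact ⟨by simp; omega, fun r hr => by simp [hr], by simp, by simp, 0, by simp, by simp; omega,
      by simp⟩
  refine .seq ((Runs.while_fuel (C := 4) (Q := fun τ => ∃ f, I f τ ∧ n ≤ τ.reg 1) I ?_ _ hτ).mono
    le_rfl ?_)
  · rintro f τ ⟨h1, h2, h3, H, h4, h5, h6⟩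
    have r0 := h1 0 (by omega)
    refine ⟨by simp; omega, fun hb => ⟨f, ⟨h1, h2, h3, H, h4, h5, h6⟩, ?_⟩, fun hb => ?_⟩
    · simp at hb; omega
    · simp at hb
      have : H < 2 ^ H := Nat.lt_two_pow_self
      refine ⟨f - 1, by omega, Runs.of_wp_le (by decide) ?_⟩
      simp
      repeat refine ⟨by omega, ?_⟩
      exact ⟨fun r hr => by simp [hr, h1 r hr], by simp [h2], by simp [h3], H + 1, by omega,
        by rw [pow_succ]; omega, by simp [h6, pow_succ']⟩
  · rintro τ ⟨f, ⟨h1, h2, h3, H, h4, h5, h6⟩, h7⟩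
    have : H ≠ 0 := by rintro rfl; omega
    refine Runs.of_wp_le (by decide) ?_
    simp [h6]
    repeat refine ⟨by omega, ?_⟩
    exact ⟨fun r hr hr2 hr4 => by simp [hr, hr2, hr4, h1], h2, h3, H, by omega,
      by omega, by omega, by simp [h6], by simp, by simp⟩

/-- The quadtree holds the distances `dd` between the slots `live`. -/
def TreeInv (n H M : ℕ) (live : Finset ℕ) (dd : ℕ → ℕ → D) (σ : State Ob D) : Prop :=
  σ.reg 0 = n ∧ σ.reg 1 = 2 ^ H ∧ σ.reg 2 = M ∧
  (∀ x ∈ live, ∀ y ∈ live, x ≠ y → σ.dst (x * M + y) = some (dd x y)) ∧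
  (∀ h r s, h ≤ H → Lvl H h r → Lvl H h s → NodeOk M live dd σ.mem h r s) ∧
  ∀ x, 2 ^ H ≤ x → x < 2 ^ H + n → σ.mem (3 * M + x) = if x ∈ live then 1 else 0

/-- The state after the slots below `a` have been filled. -/
def InsertInv (n H M : ℕ) (ob : ℕ → Option Ob) (dd : ℕ → ℕ → D) (a : ℕ) (σ : State Ob D) : Prop :=
  TreeInv n H M (Finset.Ico (2 ^ H) a) dd σ ∧ σ.reg 3 = 0 ∧ σ.reg 4 = a ∧ σ.obj = ob ∧
  ∀ x ∈ Finset.Ico (2 ^ H) a, σ.mem (M + x) = x - 2 ^ H ∧ σ.mem (2 * M + x) = 1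

/-- Objects are inserted one at a time: only the row and column of the new slot change, so the same
repair as after a merger suffices, at cost `O(2 ^ H)`. -/
theorem runs_insertSlot {H a : ℕ} {ob : ℕ → Option Ob} (hMH : M = 2 * 2 ^ H) (hH : 1 ≤ H)
    (hn : n ≤ 2 ^ H) (hS : (M + 4) * M ≤ S) (hW : S ≤ W) (ha : 2 ^ H ≤ a) (ha' : a < 2 ^ H + n)
    (hob : ∀ x y, 2 ^ H ≤ x → x < 2 ^ H + n → 2 ^ H ≤ y → y < 2 ^ H + n → x ≠ y →
      ∃ o o', ob (x - 2 ^ H) = some o ∧ ob (y - 2 ^ H) = some o' ∧ dd x y = ops.dist o o')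
    (h : InsertInv n H M ob dd a σ) :
    Runs ops W S insertSlot (2000 * 2 ^ H) σ (InsertInv n H M ob dd (a + 1)) := by
  obtain ⟨⟨hn0, hN, hM, hdst, hnode, hind⟩, h3, h4, hobj, hrow⟩ := h
  have hN2 : 2 ^ 1 ≤ 2 ^ H := Nat.pow_le_pow_right (by omega) hH
  have hMS : 4 * M < S := lt_of_lt_of_le (by nlinarith) hS
  have hadr : ∀ x y, x < M → y < M → (x + 4) * M + y < S ∧ 4 * M ≤ (x + 4) * M ∧
      x * M + y ≤ (x + 4) * M + y := fun x y hx hy =>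
    ⟨(row_lt (by omega) hy).trans_le hS, Nat.mul_le_mul_right _ (by omega),
      Nat.add_le_add_right (Nat.mul_le_mul_right _ (by omega)) _⟩
  have haM : a < M := by omega
  have ha0 : Lvl H 0 a := lvl_zero.2 ⟨ha, by omega⟩
  let J : ℕ → State Ob D → Prop := fun y₀ τ =>
    (∀ r < 6, τ.reg r = σ.reg r) ∧ τ.obj = ob ∧ τ.reg 11 = y₀ ∧
    (∀ i < 4 * M, i ≠ M + a → i ≠ 2 * M + a → i ≠ 3 * M + a → τ.mem i = σ.mem i) ∧
    τ.mem (M + a) = a - 2 ^ H ∧ τ.mem (2 * M + a) = 1 ∧ τ.mem (3 * M + a) = 1 ∧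
    (∀ x < M, ∀ y < M, τ.mem ((x + 4) * M + y) =
      if (x = a ∧ 2 ^ H ≤ y ∧ y < y₀) ∨ (y = a ∧ 2 ^ H ≤ x ∧ x < y₀) then x * M + y
      else σ.mem ((x + 4) * M + y)) ∧
    (∀ x ∈ Finset.Ico (2 ^ H) a, ∀ y ∈ Finset.Ico (2 ^ H) a, x ≠ y →
      τ.dst (x * M + y) = some (dd x y)) ∧
    ∀ y, 2 ^ H ≤ y → y < y₀ →
      τ.dst (a * M + y) = some (dd a y) ∧ τ.dst (y * M + a) = some (dd y a)
  refine Runs.mono (T := 50 + ((a - 2 ^ H) * (3 + 100) + 3 + (1000 * 2 ^ H + 4))) ?_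
    (by omega) fun _ => id
  refine .seq ((Runs.of_wp_le (Q := J (2 ^ H)) (by decide) ?_).mono le_rfl fun τ hτ => ?_)
  · simp [hN, hM, h4]
    repeat refine ⟨by omega, ?_⟩
    refine ⟨fun r hr => by simp [show r ≠ 11 by omega], by simp [hobj], by simp,
      fun i hi h1 h2 h3 => by simp [h1, h2, h3], ?_, ?_, by simp, fun x hx y hy => ?_, by simpa using hdst,
      fun y h1 h2 => by omega⟩
    · simp only [State.mem_setReg, State.mem_setMem]
      rw [if_neg (by omega), if_neg (by omega), if_true]
    · simp only [State.mem_setReg, State.mem_setMem]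
      rw [if_neg (by omega), if_true]
    · have := hadr x y hx hy
      rw [if_neg (by omega)]
      simp only [State.mem_setReg, State.mem_setMem]
      rw [if_neg (by omega), if_neg (by omega), if_neg (by omega)]
  refine .seq ((Runs.while_count J (C := 100) (Q := J a) ha ?_ ?_ hτ).mono le_rfl ?_)
  · rintro y τ hy0 hya ⟨j1, j2, j3, j4, j5, j6, j7, j8, j9, j10⟩
    have r1 := j1 1 (by omega)
    have r2 := j1 2 (by omega)
    have r4 := j1 4 (by omega)
    obtain ⟨o, o', ho, ho', hd⟩ := hob a y ha ha' hy0 (by omega) (by omega)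
    obtain ⟨p', p, hp', hp, hd'⟩ := hob y a hy0 (by omega) ha ha' (by omega)
    rw [ho] at hp
    rw [ho'] at hp'
    cases hp; cases hp'
    have b1 := hadr a y haM (by omega)
    have b2 := hadr y a (by omega) haM
    refine ⟨by simp; omega, by simp; omega, Runs.of_wp_le (by decide) ?_⟩
    simp [insertBody, r1, r2, r4, hN, hM, h4, j3, j2, ho, ho']
    repeat refine ⟨by omega, ?_⟩
    refine ⟨fun r hr => by simp [show r ≠ 11 by omega, j1 r hr], by simp [j2], by simp,
      fun i hi h1 h2 h3 => ?_, ?_, ?_, ?_, fun x' hx' y' hy' => ?_, fun x' hx' y' hy' hxy => ?_,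
      fun y' h1 h2 => ?_⟩
    · simp only [State.mem_setReg, State.mem_setMem, State.mem_setDist]
      rw [if_neg (by omega), if_neg (by omega), j4 i hi h1 h2 h3]
    · simp only [State.mem_setReg, State.mem_setMem, State.mem_setDist]
      rw [if_neg (by omega), if_neg (by omega), j5]
    · simp only [State.mem_setReg, State.mem_setMem, State.mem_setDist]
      rw [if_neg (by omega), if_neg (by omega), j6]
    · simp only [State.mem_setReg, State.mem_setMem, State.mem_setDist]
      rw [if_neg (by omega), if_neg (by omega), j7]
    · simp only [State.mem_setReg, State.mem_setMem, State.mem_setDist]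
      by_cases e1 : x' = y ∧ y' = a
      · obtain ⟨rfl, rfl⟩ := e1
        rw [if_pos rfl, if_pos (.inr ⟨rfl, by omega, by omega⟩)]
      rw [if_neg fun e => e1 (by have := row_inj hy' haM e; omega)]
      by_cases e2 : x' = a ∧ y' = y
      · obtain ⟨rfl, rfl⟩ := e2
        rw [if_pos rfl, if_pos (.inl ⟨rfl, by omega, by omega⟩)]
      rw [if_neg fun e => e2 (by have := row_inj hy' (by omega : y < M) e; omega), j8 x' hx' y' hy']
      congr 1
      apply propext
      omega
    · rw [Finset.mem_Ico] at hx' hy'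
      simp only [State.dst_setReg, State.dst_setMem, State.dst_setDist]
      rw [if_neg fun e => by have := row_inj (by omega) haM e; omega,
        if_neg fun e => by have := row_inj (by omega) (by omega) e; omega]
      exact j9 x' (Finset.mem_Ico.2 hx') y' (Finset.mem_Ico.2 hy') hxy
    · simp only [State.dst_setReg, State.dst_setMem, State.dst_setDist]
      by_cases e : y' = y
      · subst e
        rw [if_neg fun e => by have := row_inj (by omega) haM e; omega, if_pos rfl, if_pos rfl, hd, hd']
        exact ⟨rfl, rfl⟩
      · rw [if_neg fun e' => by have := row_inj (by omega) haM e'; omega,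
          if_neg fun e' => by have := row_inj (by omega) (by omega) e'; omega,
          if_neg fun e' => by have := row_inj haM haM e'; omega,
          if_neg fun e' => by have := row_inj haM (by omega) e'; omega]
        exact j10 y' h1 (by omega)
  · rintro τ ⟨j1, j2, j3, j4⟩
    have r4 := j1 4 (by omega)
    exact ⟨by simp; omega, by simp; omega, j1, j2, j3, j4⟩
  · rintro τ ⟨j1, j2, j3, j4, j5, j6, j7, j8, j9, j10⟩
    have hdst' : ∀ x ∈ Finset.Ico (2 ^ H) (a + 1), ∀ y ∈ Finset.Ico (2 ^ H) (a + 1), x ≠ y →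
        τ.dst (x * M + y) = some (dd x y) := by
      intro x hx y hy hxy
      rw [Finset.mem_Ico] at hx hy
      by_cases e1 : x = a
      · subst e1
        exact (j10 y hy.1 (by omega)).1
      by_cases e2 : y = a
      · subst e2
        exact (j10 x hx.1 (by omega)).2
      exact j9 x (by rw [Finset.mem_Ico]; omega) y (by rw [Finset.mem_Ico]; omega) hxy
    refine .seq ((runs_repair (p := 4) (a := a) (live := Finset.Ico (2 ^ H) (a + 1)) (dd := dd)
      (by omega) ((j1 4 (by omega)).trans h4) hMH hH hS hW ((j1 1 (by omega)).trans hN)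
      ((j1 2 (by omega)).trans hM) ha0
      (fun x hx => by rw [Finset.mem_Ico] at hx; exact lvl_zero.2 (by omega)) hdst' ?_).mono
      le_rfl ?_)
    · intro h r s hh hr hs hne
      have hrM : r < M := hMH ▸ hr.lt
      have hsM : s < M := hMH ▸ hs.lt
      rcases hne with rfl | ⟨hne1, hne2⟩
      · rw [nodeOk_zero_iff, j8 r hrM s hsM, nodeOk_zero_iff.1 (hnode 0 r s hh hr hs)]
        have := lvl_zero.1 hr
        have := lvl_zero.1 hs
        simp only [Finset.mem_Ico]
        split_ifs <;> omega
      · refine (hnode h r s hh hr hs).of_ne hne1 hne2 ?_ (fun x hx => ?_) fun _ _ _ _ _ _ => rfl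
        · have := node_ne_of_div_ne hh hr ha0 hne1
          have := node_ne_of_div_ne hh hs ha0 hne2
          rw [j8 r hrM s hsM, if_neg (by omega)]
        · simp only [Finset.mem_Ico]; omega
    · rintro τ' ⟨q1, q2, q3, q4, q5⟩
      have t : ∀ r < 6, τ'.reg r = σ.reg r := fun r hr => by rw [q1 r hr, j1 r hr]
      have t4 := t 4 (by omega)
      refine Runs.of_wp_le (by decide) ⟨by simp; omega, ⟨?_, ?_, ?_, ?_, by simpa using q5, ?_⟩, ?_,
        ?_, ?_, ?_⟩
      · simp [t, hn0]
      · simp [t, hN]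
      · simp [t, hM]
      · simpa [q3] using hdst'
      · intro x hx hx'
        simp only [State.mem_setReg, Finset.mem_Ico]
        rw [q4 _ (by omega)]
        by_cases e : x = a
        · subst e
          rw [j7, if_pos (by omega)]
        · rw [j4 _ (by omega) (by omega) (by omega) (by omega), hind x hx hx']
          simp only [Finset.mem_Ico]
          congr 1
          apply propext
          omega
      · simp [t, h3]
      · simp [t4, h4]
      · simp [q2, j2]
      · intro x hx
        rw [Finset.mem_Ico] at hx
        simp only [State.mem_setReg]
        rw [q4 _ (by omega), q4 _ (by omega)]
        by_cases e : x = a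
        · subst e
          exact ⟨j5, j6⟩
        · rw [j4 _ (by omega) (by omega) (by omega) (by omega),
            j4 _ (by omega) (by omega) (by omega) (by omega)]
          exact hrow x (by rw [Finset.mem_Ico]; omega)

end

end Agglomerative

/-! ### The phases of a merger in the quadtree -/

namespace Agglomerative

/-- Finds a closest pair of clusters, in the slots in the registers `4` and `5`, and writes the
merger to the output. -/
def selectPair : Cmd :=
  .setReg 10 (.mem (nodeCell (.lit 1) (.lit 1))) ;;
  .setReg 4 (.div (.reg 10) (.reg 2)) ;;
  .setReg 5 (.sub (.reg 10) (.mul (.reg 4) (.reg 2))) ;;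
  .store (.mul (.lit 2) (.reg 3)) (.mem (rowCell 1 (.reg 4))) ;;
  .store (.add (.mul (.lit 2) (.reg 3)) (.lit 1)) (.mem (rowCell 1 (.reg 5))) ;;
  .store (rowCell 3 (.reg 5)) (.lit 0)

/-- Removes the slot in the register `5` from the quadtree. -/
def clearSlot : Cmd :=
  .setReg 11 (.reg 1) ;;
  .while (.lt (.reg 11) (.add (.reg 1) (.reg 0)))
    (.store (nodeCell (.reg 5) (.reg 11)) (.lit 0) ;;
      .store (nodeCell (.reg 11) (.reg 5)) (.lit 0) ;;
      .setReg 11 (.add (.reg 11) (.lit 1))) ;;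
  repair 5

/-- The sizes of the clusters in the slots in the registers `4`, `5`, `11`. -/
abbrev sizeArgs : Fin 3 → Expr :=
  ![.mem (rowCell 2 (.reg 4)), .mem (rowCell 2 (.reg 5)), .mem (rowCell 2 (.reg 11))]

/-- The distances between the clusters in the slots in the registers `4`, `5`, `11`. -/
abbrev distArgs : Fin 6 → Expr :=
  ![distCell (.reg 4) (.reg 5), distCell (.reg 5) (.reg 4), distCell (.reg 4) (.reg 11),
    distCell (.reg 11) (.reg 4), distCell (.reg 5) (.reg 11), distCell (.reg 11) (.reg 5)]

/-- Replaces the distances of the slots in the registers `4` and `11` by those after the merger. -/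
def updatePair : Cmd :=
  -- The first value is parked in cell `0`, which belongs to no pair of slots, because the second
  -- formula still needs the old distance that it replaces.
  .updateL (.lit 0) sizeArgs distArgs ;;
  .updateR (distCell (.reg 11) (.reg 4)) sizeArgs distArgs ;;
  .copyDist (distCell (.reg 4) (.reg 11)) (.lit 0)

/-- Replaces the distances of the slot in the register `4` by those after the merger. -/
def updateRow : Cmd :=
  .setReg 11 (.reg 1) ;;
  .while (.lt (.reg 11) (.add (.reg 1) (.reg 0)))
    (.ite (.eq (.mem (rowCell 3 (.reg 11))) (.lit 0)) .skip
      (.ite (.eq (.reg 11) (.reg 4)) .skip updatePair) ;;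
    .setReg 11 (.add (.reg 11) (.lit 1)))

/-- Merges a closest pair of clusters. -/
def mergeStep : Cmd :=
  selectPair ;; clearSlot ;; updateRow ;;
  (.store (rowCell 2 (.reg 4))
      (.add (.mem (rowCell 2 (.reg 4))) (.mem (rowCell 2 (.reg 5)))) ;;
    .store (rowCell 1 (.reg 4)) (.add (.reg 0) (.reg 3))) ;;
  repair 4 ;; .setReg 3 (.add (.reg 3) (.lit 1))

section

variable {Ob : Type u} {D : Type v} [LinearOrder D] {ops : Ops Ob D} {W S M n H a b : ℕ}
  {σ : State Ob D} {dd dd' : ℕ → ℕ → D} {live : Finset ℕ}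

/-- The addresses used for the slots lie in the memory. -/
theorem address_bounds (hMH : M = 2 * 2 ^ H) (hH : 1 ≤ H) (hS : (M + 4) * M ≤ S) :
    4 ≤ M ∧ 4 * M < S ∧ ∀ x y, x < M → y < M → (x + 4) * M + y < S ∧ 4 * M ≤ (x + 4) * M ∧
      x * M + y ≤ (x + 4) * M + y := by
  have hN2 : 2 ^ 1 ≤ 2 ^ H := Nat.pow_le_pow_right (by omega) hH
  exact ⟨by omega, lt_of_lt_of_le (by nlinarith) hS, fun x y hx hy =>
    ⟨(row_lt (by omega) hy).trans_le hS, Nat.mul_le_mul_right _ (by omega),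
      Nat.add_le_add_right (Nat.mul_le_mul_right _ (by omega)) _⟩⟩

/-- Only the tree forgets the slot: its distances stay in memory, since the update formulas read
them afterwards. -/
theorem runs_clearSlot (hMH : M = 2 * 2 ^ H) (hH : 1 ≤ H) (hn : n ≤ 2 ^ H)
    (hS : (M + 4) * M ≤ S) (hW : S ≤ W) (h0 : σ.reg 0 = n) (hN : σ.reg 1 = 2 ^ H)
    (hM : σ.reg 2 = M) (h5 : σ.reg 5 = b) (hb : b ∈ live)
    (hlive : live ⊆ Finset.Ico (2 ^ H) (2 ^ H + n))
    (hdst : ∀ x ∈ live, ∀ y ∈ live, x ≠ y → σ.dst (x * M + y) = some (dd x y))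
    (hnode : ∀ h r s, h ≤ H → Lvl H h r → Lvl H h s → NodeOk M live dd σ.mem h r s) :
    Runs ops W S clearSlot (2000 * 2 ^ H) σ fun τ =>
      (∀ r < 6, τ.reg r = σ.reg r) ∧ τ.obj = σ.obj ∧ τ.dst = σ.dst ∧
      (∀ i < 4 * M, τ.mem i = σ.mem i) ∧
      ∀ h r s, h ≤ H → Lvl H h r → Lvl H h s → NodeOk M (live.erase b) dd τ.mem h r s := by
  obtain ⟨hM4, hMS, hadr⟩ := address_bounds hMH hH hS
  have hlive' : ∀ x ∈ live, 2 ^ H ≤ x ∧ x < 2 ^ H + n := fun x hx => Finset.mem_Ico.1 (hlive hx)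
  have hb' := hlive' b hb
  have hb0 : Lvl H 0 b := lvl_zero.2 ⟨hb'.1, by omega⟩
  let J : ℕ → State Ob D → Prop := fun y₀ τ =>
    (∀ r < 6, τ.reg r = σ.reg r) ∧ τ.obj = σ.obj ∧ τ.dst = σ.dst ∧ τ.reg 11 = y₀ ∧
    (∀ i < 4 * M, τ.mem i = σ.mem i) ∧
    ∀ x < M, ∀ y < M, τ.mem ((x + 4) * M + y) =
      if (x = b ∧ 2 ^ H ≤ y ∧ y < y₀) ∨ (y = b ∧ 2 ^ H ≤ x ∧ x < y₀) then 0
      else σ.mem ((x + 4) * M + y)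
  refine Runs.mono (T := 2 + ((2 ^ H + n - 2 ^ H) * (5 + 50) + 5 + 1000 * 2 ^ H)) ?_
    (by omega) fun _ => id
  refine .seq ((Runs.of_wp_le (Q := J (2 ^ H)) (by decide) ?_).mono le_rfl fun τ hτ => ?_)
  · refine ⟨by simp; omega, fun r hr => by simp [show r ≠ 11 by omega], rfl, rfl, by simp [hN],
      fun i hi => rfl, fun x hx y hy => ?_⟩
    rw [if_neg (by omega)]
    rfl
  refine .seq ((Runs.while_count J (C := 50) (Q := J (2 ^ H + n)) (by omega) ?_ ?_ hτ).mono
    le_rfl ?_)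
  · rintro y τ hy0 hyn ⟨j1, j2, j3, j4, j5, j6⟩
    have r0 := j1 0 (by omega)
    have r1 := j1 1 (by omega)
    have r2 := j1 2 (by omega)
    have r5 := j1 5 (by omega)
    have b1 := hadr b y (by omega) (by omega)
    have b2 := hadr y b (by omega) (by omega)
    refine ⟨by simp; omega, by simp; omega, Runs.of_wp_le (by decide) ?_⟩
    simp [r2, r5, hM, h5, j4]
    repeat refine ⟨by omega, ?_⟩
    refine ⟨fun r hr => by simp [show r ≠ 11 by omega, j1 r hr], by simp [j2], by simp [j3],
      by simp, fun i hi => ?_, fun x' hx' y' hy' => ?_⟩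
    · simp only [State.mem_setReg, State.mem_setMem]
      rw [if_neg (by omega), if_neg (by omega), j5 i hi]
    · simp only [State.mem_setReg, State.mem_setMem]
      by_cases e1 : x' = y ∧ y' = b
      · obtain ⟨rfl, rfl⟩ := e1
        rw [if_pos rfl, if_pos (.inr ⟨rfl, by omega, by omega⟩)]
      rw [if_neg fun e => e1 (by have := row_inj hy' (by omega : b < M) e; omega)]
      by_cases e2 : x' = b ∧ y' = y
      · obtain ⟨rfl, rfl⟩ := e2
        rw [if_pos rfl, if_pos (.inl ⟨rfl, by omega, by omega⟩)]
      rw [if_neg fun e => e2 (by have := row_inj hy' (by omega : y < M) e; omega), j6 x' hx' y' hy']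
      congr 1
      apply propext
      omega
  · rintro τ ⟨j1, j2, j3, j4, j5⟩
    have r0 := j1 0 (by omega)
    have r1 := j1 1 (by omega)
    exact ⟨by simp; omega, by simp; omega, j1, j2, j3, j4, j5⟩
  · rintro τ ⟨j1, j2, j3, j4, j5, j6⟩
    refine (runs_repair (p := 5) (a := b) (live := live.erase b) (dd := dd)
      (by omega) ((j1 5 (by omega)).trans h5) hMH hH hS hW ((j1 1 (by omega)).trans hN)
      ((j1 2 (by omega)).trans hM) hb0 (fun x hx => ?_) (fun x hx y hy hxy => ?_) ?_).mono
      le_rfl ?_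
    · have := hlive' x (Finset.mem_of_mem_erase hx)
      exact lvl_zero.2 (by omega)
    · rw [j3]
      exact hdst x (Finset.mem_of_mem_erase hx) y (Finset.mem_of_mem_erase hy) hxy
    · intro h r s hh hr hs hne
      have hrM : r < M := hMH ▸ hr.lt
      have hsM : s < M := hMH ▸ hs.lt
      rcases hne with rfl | ⟨hne1, hne2⟩
      · rw [nodeOk_zero_iff, j6 r hrM s hsM, nodeOk_zero_iff.1 (hnode 0 r s hh hr hs)]
        have := lvl_zero.1 hr
        have := lvl_zero.1 hs
        have := hlive' r
        have := hlive' s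
        simp only [Finset.mem_erase]
        by_cases hrl : r ∈ live <;> by_cases hsl : s ∈ live <;> simp only [hrl, hsl] <;>
          split_ifs <;> first | rfl | omega | simp_all
      · refine (hnode h r s hh hr hs).of_ne hne1 hne2 ?_ (fun x hx => ?_) fun _ _ _ _ _ _ => rfl
        · have := node_ne_of_div_ne hh hr hb0 hne1
          have := node_ne_of_div_ne hh hs hb0 hne2
          rw [j6 r hrM s hsM, if_neg (by omega)]
        · simp [hx]
    · rintro τ' ⟨q1, q2, q3, q4, q5⟩
      exact ⟨fun r hr => by rw [q1 r hr, j1 r hr], q2.trans j2, q3.trans j3,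
        fun i hi => by rw [q4 i hi, j5 i hi], q5⟩

/-- When slot `c` is treated, none of the six distances among `a`, `b`, `c` has been overwritten:
earlier rounds replaced only the distances between `a` and slots smaller than `c`, other than `b`.
-/
theorem runs_updateRow {sz : ℕ → ℕ} (hMH : M = 2 * 2 ^ H) (hH : 1 ≤ H) (hn : n ≤ 2 ^ H)
    (hS : (M + 4) * M ≤ S) (hW : S ≤ W) (h0 : σ.reg 0 = n) (hN : σ.reg 1 = 2 ^ H)
    (hM : σ.reg 2 = M) (h4 : σ.reg 4 = a) (h5 : σ.reg 5 = b) (ha : a ∈ live) (hb : b ∈ live)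
    (hab : a ≠ b) (hlive : live ⊆ Finset.Ico (2 ^ H) (2 ^ H + n))
    (hdst : ∀ x ∈ live, ∀ y ∈ live, x ≠ y → σ.dst (x * M + y) = some (dd x y))
    (hind : ∀ x, 2 ^ H ≤ x → x < 2 ^ H + n → σ.mem (3 * M + x) = if x ∈ live.erase b then 1 else 0)
    (hsz : ∀ x ∈ live, σ.mem (2 * M + x) = sz x) (hszn : ∀ x ∈ live, sz x ≤ n)
    (hL : ∀ c ∈ live, c ≠ a → c ≠ b → dd' a c = ops.updL ![sz a, sz b, sz c]
      ![dd a b, dd b a, dd a c, dd c a, dd b c, dd c b])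
    (hR : ∀ c ∈ live, c ≠ a → c ≠ b → dd' c a = ops.updR ![sz a, sz b, sz c]
      ![dd a b, dd b a, dd a c, dd c a, dd b c, dd c b])
    (hdd : ∀ x ∈ live, ∀ y ∈ live, x ≠ a → y ≠ a → dd' x y = dd x y) :
    Runs ops W S updateRow (500 * 2 ^ H) σ fun τ =>
      (∀ r < 6, τ.reg r = σ.reg r) ∧ τ.mem = σ.mem ∧
      ∀ x ∈ live.erase b, ∀ y ∈ live.erase b, x ≠ y → τ.dst (x * M + y) = some (dd' x y) := by
  obtain ⟨hM4, hMS, hadr⟩ := address_bounds hMH hH hS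
  have hlive' : ∀ x ∈ live, 2 ^ H ≤ x ∧ x < 2 ^ H + n := fun x hx => Finset.mem_Ico.1 (hlive hx)
  have ha' := hlive' a ha
  have hb' := hlive' b hb
  let J : ℕ → State Ob D → Prop := fun c₀ τ =>
    (∀ r < 6, τ.reg r = σ.reg r) ∧ τ.mem = σ.mem ∧ τ.reg 11 = c₀ ∧
    ∀ x ∈ live, ∀ y ∈ live, x ≠ y → τ.dst (x * M + y) =
      some (if (x = a ∧ y ≠ b ∧ y < c₀) ∨ (y = a ∧ x ≠ b ∧ x < c₀) then dd' x y else dd x y)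
  refine Runs.mono (T := 2 + ((2 ^ H + n - 2 ^ H) * (5 + 300) + 5)) ?_ (by omega) fun _ => id
  refine .seq ((Runs.of_wp_le (Q := J (2 ^ H)) (by decide) ?_).mono le_rfl fun τ hτ => ?_)
  · refine ⟨by simp; omega, fun r hr => by simp [show r ≠ 11 by omega], rfl, by simp [hN],
      fun x hx y hy hxy => ?_⟩
    have := hlive' x hx
    have := hlive' y hy
    rw [if_neg (by omega)]
    exact hdst x hx y hy hxy
  refine Runs.while_count J (C := 300) (by omega) ?_ ?_ hτ
  · rintro c τ hc0 hcn ⟨j1, j2, j3, j4⟩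
    have r0 := j1 0 (by omega)
    have r1 := j1 1 (by omega)
    have r2 := j1 2 (by omega)
    have r4 := j1 4 (by omega)
    have r5 := j1 5 (by omega)
    rw [h0] at r0
    rw [hN] at r1
    rw [hM] at r2
    rw [h4] at r4
    rw [h5] at r5
    refine ⟨by simp; omega, by simp; omega, ?_⟩
    -- Skipped slots: the empty ones, and also `a` and the removed slot `b`.
    have hnop : (c ∉ live ∨ c = a ∨ c = b) → J (c + 1) (τ.setReg 11 (c + 1)) := fun hc => by
      refine ⟨fun r hr => by simp [show r ≠ 11 by omega, j1 r hr], j2, by simp,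
        fun x hx y hy hxy => ?_⟩
      rw [State.dst_setReg, j4 x hx y hy hxy]
      congr 2
      apply propext
      have hxc : x = c → c ∈ live := fun h => h ▸ hx
      have hyc : y = c → c ∈ live := fun h => h ▸ hy
      grind
    have hic := hind c hc0 hcn
    rw [← j2] at hic
    refine Runs.of_wp_le (by decide) ?_
    by_cases hc : c ∈ live.erase b
    swap
    · rw [if_neg hc] at hic
      simp [r2, j3, hic]
      repeat refine ⟨by omega, ?_⟩
      exact hnop (by rw [Finset.mem_erase] at hc; tauto)
    rw [if_pos hc] at hic
    by_cases hca : c = a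
    · subst hca
      simp [r2, j3, hic, r4]
      repeat refine ⟨by omega, ?_⟩
      exact hnop (.inr (.inl rfl))
    obtain ⟨hcb, hcl⟩ := Finset.mem_erase.1 hc
    have hcl' := hlive' c hcl
    have b1 := hadr a b (by omega) (by omega)
    have b2 := hadr b a (by omega) (by omega)
    have b3 := hadr a c (by omega) (by omega)
    have b4 := hadr c a (by omega) (by omega)
    have b5 := hadr b c (by omega) (by omega)
    have b6 := hadr c b (by omega) (by omega)
    have sa := hsz a ha
    have sb := hsz b hb
    have sc := hsz c hcl
    rw [← j2] at sa sb sc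
    have ta := hszn a ha
    have tb := hszn b hb
    have tc := hszn c hcl
    have d1 := j4 a ha b hb hab
    have d2 := j4 b hb a ha hab.symm
    have d3 := j4 a ha c hcl (Ne.symm hca)
    have d4 := j4 c hcl a ha hca
    have d5 := j4 b hb c hcl (Ne.symm hcb)
    have d6 := j4 c hcl b hb hcb
    rw [if_neg (by omega)] at d1 d2 d3 d4 d5 d6
    have hL' := hL c hcl hca hcb
    have hR' := hR c hcl hca hcb
    set ds : Fin 6 → D := ![dd a b, dd b a, dd a c, dd c a, dd b c, dd c b] with hds
    have args : ∀ τ' : State Ob D, τ'.reg = τ.reg → τ'.mem = τ.mem →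
        (∀ j, (sizeArgs j).Ok W S τ') ∧ (∀ j, (distArgs j).AddrOk W S τ') ∧
        (fun j => (sizeArgs j).val τ') = ![sz a, sz b, sz c] := fun τ' e1 e2 => by
      refine ⟨fun j => ?_, fun j => ?_, funext fun j => ?_⟩
      · fin_cases j <;> simp [e1, e2, r2, r4, r5, j3, sa, sb, sc] <;> omega
      · fin_cases j <;> simp [e1, r2, r4, r5, j3] <;> omega
      · fin_cases j <;> simp [e1, e2, r2, r4, r5, j3, sa, sb, sc]
    have vals : ∀ τ' : State Ob D, τ'.reg = τ.reg → (∀ i, i ≠ 0 → τ'.dst i = τ.dst i) →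
        ∀ j, τ'.dst ((distArgs j).val τ') = some (ds j) := fun τ' e1 e2 j => by
      have pa : 0 < a * M := Nat.mul_pos (by omega) (by omega)
      have pb : 0 < b * M := Nat.mul_pos (by omega) (by omega)
      have pc : 0 < c * M := Nat.mul_pos (by omega) (by omega)
      fin_cases j <;> simp [hds, e1, r2, r4, r5, j3] <;> rw [e2 _ (by omega)] <;> assumption
    obtain ⟨o1, o2, o3⟩ := args τ rfl rfl
    obtain ⟨o1', o2', o3'⟩ := args (τ.setDist 0 (dd' a c)) rfl rfl
    have v := vals τ rfl fun _ _ => rfl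
    have v' := vals (τ.setDist 0 (dd' a c)) rfl fun i hi => by simp [hi]
    refine ⟨by simp [r2, j3, hic]; omega, fun h => absurd h (by simp [r2, j3, hic]),
      fun _ => ⟨by simp [r4, j3]; omega, fun h => absurd h (by simp [r4, j3, hca]), fun _ => ?_⟩⟩
    refine ⟨by simp; omega, o1, o2, ds, v, ?_⟩
    rw [o3, ← hL', show Expr.val τ (.lit 0) = 0 from rfl]
    refine ⟨by simp [r2, r4, j3]; omega, o1', o2', ds, v', ?_⟩
    rw [o3', ← hR']
    have e0 : 0 ≠ c * M + a := by omega
    refine ⟨by simp [r2, r4, j3]; omega, by simp; omega, dd' a c, ?_, ?_⟩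
    · simp only [Expr.val, State.dst_setDist, State.reg_setDist, r2, r4, j3]
      rw [if_neg e0, if_pos trivial]
    simp only [Cmd.Wp, Expr.Ok, Expr.val, State.reg_setDist, r2, r4, j3]
    refine ⟨⟨by omega, by omega, by omega⟩, fun r hr => by simp [show r ≠ 11 by omega, j1 r hr], j2,
      by simp, fun x hx y hy hxy => ?_⟩
    have hx' := hlive' x hx
    have hy' := hlive' y hy
    simp only [State.dst_setReg, State.dst_setDist]
    by_cases e1 : x = a ∧ y = c
    · obtain ⟨rfl, rfl⟩ := e1
      rw [if_pos rfl, if_pos (.inl ⟨rfl, hcb, by omega⟩)]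
    rw [if_neg fun e => e1 (row_inj (by omega) (by omega) e)]
    by_cases e2 : x = c ∧ y = a
    · obtain ⟨rfl, rfl⟩ := e2
      rw [if_pos rfl, if_pos (.inr ⟨rfl, hcb, by omega⟩)]
    have : x * M + y ≠ 0 := by
      have : 0 < x * M := Nat.mul_pos (by omega) (by omega)
      omega
    rw [if_neg fun e => e2 (row_inj (by omega) (by omega) e), if_neg this, j4 x hx y hy hxy]
    congr 2
    apply propext
    omega
  · rintro τ ⟨j1, j2, j3, j4⟩
    have r0 := j1 0 (by omega)
    have r1 := j1 1 (by omega)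
    refine ⟨by simp; omega, by simp; omega, j1, j2, fun x hx y hy hxy => ?_⟩
    obtain ⟨hxb, hx⟩ := Finset.mem_erase.1 hx
    obtain ⟨hyb, hy⟩ := Finset.mem_erase.1 hy
    have := hlive' x hx
    have := hlive' y hy
    rw [j4 x hx y hy hxy]
    split_ifs with h
    · rfl
    · rw [hdd x hx y hy (by omega) (by omega)]

end

end Agglomerative

/-! ### One merger of the quadtree program -/

namespace Agglomerative

/-- Clustering with the distances between clusters kept in a quadtree. -/
def quadtreeProgram : Cmd :=
  .ite (.lt (.lit 1) (.reg 0))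
    (findSize ;;
      .while (.lt (.reg 4) (.add (.reg 1) (.reg 0))) insertSlot ;;
      .while (.lt (.add (.reg 3) (.lit 1)) (.reg 0)) mergeStep)
    .skip

section

variable {Ob : Type u} {D : Type v} [LinearOrder D] {ops : Ops Ob D} {W S M n H k : ℕ}
  {σ : State Ob D} {x : Fin n → Ob} {δ : Cluster n → Cluster n → D} {dd : ℕ → ℕ → D}
  {live : Finset ℕ}

/-- The state after `k` mergers. -/
def MergeInv (n H M : ℕ) (δ : Cluster n → Cluster n → D) (k : ℕ) (σ : State Ob D) : Prop :=
  ∃ live lab cl, TreeInv n H M live (fun x y => δ (cl x) (cl y)) σ ∧ σ.reg 3 = k ∧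
    live ⊆ Finset.Ico (2 ^ H) (2 ^ H + n) ∧
    (∀ x ∈ live, σ.mem (M + x) = lab x ∧ σ.mem (2 * M + x) = (cl x).members.card) ∧
    Slots n (fun i => (σ.mem (2 * i), σ.mem (2 * i + 1))) k live lab cl ∧
    AgglomerationPrefix δ (fun i => (σ.mem (2 * i), σ.mem (2 * i + 1))) k

/-- The root of the quadtree holds a smallest distance. -/
theorem root_spec (hlive : ∀ x ∈ live, Lvl H 0 x) (hcard : 1 < live.card) {mem : ℕ → ℕ}
    (h : NodeOk M live dd mem H 1 1) :
    ∃ a ∈ live, ∃ b ∈ live, a ≠ b ∧ mem ((1 + 4) * M + 1) = a * M + b ∧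
      ∀ x ∈ live, ∀ y ∈ live, x ≠ y → dd a b ≤ dd x y := by
  have below : ∀ x ∈ live, ∀ y ∈ live, x ≠ y → Below live H 1 1 x y := fun x hx y hy hxy => by
    have h1 := (hlive x hx).div le_rfl
    have h2 := (hlive y hy).div le_rfl
    simp only [Lvl, Nat.sub_self, pow_zero] at h1 h2
    exact ⟨⟨hx, hy, hxy⟩, by omega, by omega⟩
  rcases h with ⟨-, h⟩ | ⟨a, b, ⟨⟨ha, hb, hab⟩, -⟩, h1, h2⟩
  · obtain ⟨x, hx, y, hy, hxy⟩ := Finset.one_lt_card.1 hcard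
    exact absurd (below x hx y hy hxy) (h x y)
  · exact ⟨a, ha, b, hb, hab, h1, fun x hx y hy hxy => h2 x y (below x hx y hy hxy)⟩

/-- Slot `b` is removed while the tree is still valid for the old distances. Updating the distances
of `a` can then spoil only inner nodes above `a`, and the second repair restores these. -/
theorem runs_mergeStep (hδ : ComputedFromSubclusters ops x δ) (hMH : M = 2 * 2 ^ H) (hH : 1 ≤ H)
    (hn : n ≤ 2 ^ H) (hS : (M + 4) * M ≤ S) (hW : S ≤ W) (hk : k + 1 < n)
    (h : MergeInv n H M δ k σ) :
    Runs ops W S mergeStep (5000 * 2 ^ H) σ (MergeInv n H M δ (k + 1)) := by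
  obtain ⟨live, lab, cl, ⟨h0, hN, hM, hdst, hnode, hind⟩, h3, hlive, hrow, hs, hp⟩ := h
  obtain ⟨hM4, hMS, hadr⟩ := address_bounds hMH hH hS
  have hlive' : ∀ x ∈ live, 2 ^ H ≤ x ∧ x < 2 ^ H + n := fun x hx => Finset.mem_Ico.1 (hlive hx)
  have hlvl : ∀ x ∈ live, Lvl H 0 x := fun x hx => by
    have := hlive' x hx
    exact lvl_zero.2 (by omega)
  obtain ⟨a, ha, b, hb, hab, hroot, hmin⟩ := root_spec hlvl (by have := hs.card; omega)
    (hnode H 1 1 le_rfl (by simp [Lvl]) (by simp [Lvl]))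
  have ha' := hlive' a ha
  have hb' := hlive' b hb
  have hla := hs.lab_lt a ha
  have hlb := hs.lab_lt b hb
  obtain ⟨hra, hra'⟩ := hrow a ha
  obtain ⟨hrb, hrb'⟩ := hrow b hb
  have card_le : ∀ x, (cl x).members.card ≤ n := fun x => by
    simpa using Finset.card_le_univ (cl x).members
  have ca := card_le a
  have cb := card_le b
  have b1 := hadr 1 1 (by omega) (by omega)
  have b2 := hadr a b (by omega) (by omega)
  have hdiv : (a * M + b) / M = a := by
    rw [mul_comm, Nat.mul_add_div (by omega), Nat.div_eq_of_lt (by omega), add_zero]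
  let J : State Ob D → Prop := fun τ =>
    (∀ r < 4, τ.reg r = σ.reg r) ∧ τ.reg 4 = a ∧ τ.reg 5 = b ∧ τ.dst = σ.dst ∧
    (∀ i, i ≠ 2 * k → i ≠ 2 * k + 1 → i ≠ 3 * M + b → τ.mem i = σ.mem i) ∧
    τ.mem (2 * k) = lab a ∧ τ.mem (2 * k + 1) = lab b ∧ τ.mem (3 * M + b) = 0
  refine Runs.mono (T := 100 + (2000 * 2 ^ H + (500 * 2 ^ H + (100 + (1000 * 2 ^ H + 4))))) ?_
    (by omega) fun _ => id
  refine .seq ((Runs.of_wp_le (Q := J) (by decide) ?_).mono le_rfl fun τ hτ => ?_)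
  · norm_num only at hroot
    simp [selectPair, hM, h3, hdiv, hroot, hra, hrb, show M + b ≠ 2 * k by omega]
    repeat refine ⟨by omega, ?_⟩
    refine ⟨fun r hr => ?_, by simp, by simp, rfl, fun i h1 h2 h3 => by simp [h1, h2, h3],
      ?_, ?_, by simp⟩
    · simp [show r ≠ 4 by omega, show r ≠ 5 by omega, show r ≠ 10 by omega]
    · simp only [State.mem_setReg, State.mem_setMem]
      rw [if_neg (by omega), if_neg (by omega), if_true]
    · simp only [State.mem_setReg, State.mem_setMem]
      rw [if_neg (by omega), if_true]
  obtain ⟨s1, s2, s3, s4, s5, s6, s7, s8⟩ := hτ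
  have t0 := (s1 0 (by omega)).trans h0
  have t1 := (s1 1 (by omega)).trans hN
  have t2 := (s1 2 (by omega)).trans hM
  have t3 := (s1 3 (by omega)).trans h3
  refine .seq ((runs_clearSlot (dd := fun x y => δ (cl x) (cl y)) hMH hH hn hS hW t0 t1 t2 s3 hb
    hlive (s4 ▸ hdst) ?_).mono le_rfl fun τ₁ h₁ => ?_)
  · intro h r s hh hr hs
    have := hadr r s (hMH ▸ hr.lt) (hMH ▸ hs.lt)
    have e := hnode h r s hh hr hs
    unfold NodeOk at e ⊢
    rwa [s5 _ (by omega) (by omega) (by omega)]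
  obtain ⟨p1, -, p3, p4, p5⟩ := h₁
  let cl' := Function.update cl a (.node k (cl a) (cl b))
  have cl'_ne : ∀ x, x ≠ a → cl' x = cl x := fun x hx => Function.update_of_ne hx _ _
  have cl'_a : cl' a = .node k (cl a) (cl b) := Function.update_self ..
  refine .seq ((runs_updateRow (dd := fun x y => δ (cl x) (cl y))
    (dd' := fun x y => δ (cl' x) (cl' y)) (sz := fun x => (cl x).members.card) hMH hH hn hS hW
    ((p1 0 (by omega)).trans t0) ((p1 1 (by omega)).trans t1) ((p1 2 (by omega)).trans t2)
    ((p1 4 (by omega)).trans s2) ((p1 5 (by omega)).trans s3) ha hb hab hlive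
    (by rw [p3, s4]; exact hdst) ?_ ?_ (fun x _ => card_le x) ?_ ?_ ?_).mono le_rfl
    fun τ₂ h₂ => ?_)
  · intro x hx hx'
    rw [p4 _ (by omega)]
    by_cases e : x = b
    · rw [e, s8, if_neg (Finset.notMem_erase _ _)]
    · rw [s5 _ (by omega) (by omega) (by omega), hind x hx hx']
      simp [e]
  · intro x hx
    have := hlive' x hx
    rw [p4 _ (by omega), s5 _ (by omega) (by omega) (by omega)]
    exact (hrow x hx).2
  · intro c hc hca hcb
    simp only [cl'_a, cl'_ne c hca]
    exact hδ.left k _ _ _ (hs.formed a ha) (hs.formed b hb) (hs.formed c hc)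
      (hs.disj a ha b hb hab) (hs.disj a ha c hc (Ne.symm hca)) (hs.disj b hb c hc (Ne.symm hcb))
  · intro c hc hca hcb
    simp only [cl'_a, cl'_ne c hca]
    exact hδ.right k _ _ _ (hs.formed a ha) (hs.formed b hb) (hs.formed c hc)
      (hs.disj a ha b hb hab) (hs.disj a ha c hc (Ne.symm hca)) (hs.disj b hb c hc (Ne.symm hcb))
  · intro x _ y _ hx hy
    simp only [cl'_ne x hx, cl'_ne y hy]
  obtain ⟨q1, q2, q3⟩ := h₂
  have r : ∀ r < 6, τ₂.reg r = τ.reg r := fun r hr => by rw [q1 r hr, p1 r hr]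
  have r0 := (r 0 (by omega)).trans t0
  have r1 := (r 1 (by omega)).trans t1
  have r2 := (r 2 (by omega)).trans t2
  have r3 := (r 3 (by omega)).trans t3
  have r4 := (r 4 (by omega)).trans s2
  have r5 := (r 5 (by omega)).trans s3
  have m2 : ∀ x ∈ live, τ₂.mem (M + x) = lab x ∧ τ₂.mem (2 * M + x) = (cl x).members.card := by
    intro x hx
    have := hlive' x hx
    rw [q2, p4 _ (by omega), p4 _ (by omega), s5 _ (by omega) (by omega) (by omega),
      s5 _ (by omega) (by omega) (by omega)]
    exact hrow x hx
  have mout : ∀ i < M, τ₂.mem i = τ.mem i := fun i hi => by rw [q2, p4 _ (by omega)]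
  have mind : ∀ x, 2 ^ H ≤ x → x < 2 ^ H + n →
      τ₂.mem (3 * M + x) = if x ∈ live.erase b then 1 else 0 := by
    intro x hx hx'
    rw [q2, p4 _ (by omega)]
    by_cases e : x = b
    · rw [e, s8, if_neg (Finset.notMem_erase _ _)]
    · rw [s5 _ (by omega) (by omega) (by omega), hind x hx hx']
      simp [e]
  have hsum : (cl' a).members.card = (cl a).members.card + (cl b).members.card := by
    rw [cl'_a, Cluster.members, Finset.card_union_of_disjoint (hs.disj a ha b hb hab)]
  have hsum' : (cl' a).members.card ≤ n := by simpa using Finset.card_le_univ (cl' a).members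
  let K : State Ob D → Prop := fun τ' =>
    (∀ r < 6, τ'.reg r = τ₂.reg r) ∧ τ'.dst = τ₂.dst ∧
    (∀ i, i ≠ M + a → i ≠ 2 * M + a → τ'.mem i = τ₂.mem i) ∧
    τ'.mem (M + a) = n + k ∧ τ'.mem (2 * M + a) = (cl' a).members.card
  refine .seq ((Runs.of_wp_le (Q := K) (by decide) ?_).mono le_rfl fun τ₃ h₃ => ?_)
  · simp [r0, r2, r3, r4, r5, m2 a ha, m2 b hb]
    repeat refine ⟨by omega, ?_⟩
    refine ⟨fun _ _ => rfl, rfl, fun i h1 h2 => by simp [h1, h2], by simp, ?_⟩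
    simp only [State.mem_setMem]
    rw [if_neg (by omega), if_true, hsum]
  obtain ⟨k1, k2, k3, k4, k5⟩ := h₃
  have live'_lvl : ∀ x ∈ live.erase b, Lvl H 0 x := fun x hx => hlvl x (Finset.mem_of_mem_erase hx)
  refine .seq ((runs_repair (p := 4) (a := a) (live := live.erase b)
    (dd := fun x y => δ (cl' x) (cl' y)) (by omega) ((k1 4 (by omega)).trans r4) hMH hH hS hW
    ((k1 1 (by omega)).trans r1) ((k1 2 (by omega)).trans r2) (hlvl a ha) live'_lvl
    (by rw [k2]; exact q3) ?_).mono le_rfl fun τ₄ h₄ => ?_)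
  · intro h r s hh hr hs' hne
    have hn1 := p5 h r s hh hr hs'
    have := hadr r s (hMH ▸ hr.lt) (hMH ▸ hs'.lt)
    have e : τ₃.mem ((r + 4) * M + s) = τ₁.mem ((r + 4) * M + s) := by
      rw [k3 _ (by omega) (by omega), q2]
    rcases hne with rfl | ⟨hne1, hne2⟩
    · rw [nodeOk_zero_iff] at hn1 ⊢
      rw [e, hn1]
    · refine hn1.of_ne hne1 hne2 e (fun _ _ => Iff.rfl) fun x _ y _ hx hy => ?_
      simp only [cl'_ne x hx, cl'_ne y hy]
  obtain ⟨f1, -, f3, f4, f5⟩ := h₄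
  have g : ∀ r < 6, τ₄.reg r = τ₂.reg r := fun r hr => by rw [f1 r hr, k1 r hr]
  have g0 := (g 0 (by omega)).trans r0
  have g1 := (g 1 (by omega)).trans r1
  have g2 := (g 2 (by omega)).trans r2
  have g3 := (g 3 (by omega)).trans r3
  have out : ∀ i < M, τ₄.mem i = τ.mem i := fun i hi => by
    rw [f4 _ (by omega), k3 _ (by omega) (by omega), mout i hi]
  have out_lt : ∀ i < k, ((σ.mem (2 * i), σ.mem (2 * i + 1)) : ℕ × ℕ) =
      (τ₄.mem (2 * i), τ₄.mem (2 * i + 1)) := fun i hi => by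
    rw [out _ (by omega), out _ (by omega), s5 _ (by omega) (by omega) (by omega),
      s5 _ (by omega) (by omega) (by omega)]
  have out_k : ((τ₄.mem (2 * k), τ₄.mem (2 * k + 1)) : ℕ × ℕ) = (lab a, lab b) := by
    rw [out _ (by omega), out _ (by omega), s6, s7]
  have hs' := hs.congr out_lt
  refine Runs.of_wp_le (by decide) ⟨by simp; omega, live.erase b, Function.update lab a (n + k), cl',
    ⟨by simp [g0], by simp [g1], by simp [g2], ?_, f5, ?_⟩, by simp [g3],
    (Finset.erase_subset _ _).trans hlive, ?_, hs'.merge ha hb hab out_k,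
    (hp.congr out_lt).succ hs' ha hb hab out_k hmin⟩
  · rw [State.dst_setReg, f3, k2]
    exact q3
  · intro x hx hx'
    rw [State.mem_setReg, f4 _ (by omega), k3 _ (by omega) (by omega), mind x hx hx']
  · intro x hx
    have hxl := Finset.mem_of_mem_erase hx
    have := hlive' x hxl
    rw [State.mem_setReg, f4 _ (by omega), f4 _ (by omega)]
    by_cases e : x = a
    · subst e
      rw [k4, k5, Function.update_self]
      exact ⟨rfl, rfl⟩
    · rw [k3 _ (by omega) (by omega), k3 _ (by omega) (by omega), Function.update_of_ne e,
        cl'_ne x e]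
      exact m2 x hxl

end

end Agglomerative

/-! ### Total time of the quadtree program -/

namespace Agglomerative

theorem mul_sq_succ_le_pow {c : ℕ} (hc : 4 ≤ c) (n : ℕ) : c * (n ^ 2 + 1) ≤ (n + 2) ^ c := by
  obtain ⟨d, rfl⟩ : ∃ d, c = d + 4 := ⟨c - 4, by omega⟩
  have h1 : d < 2 ^ d := Nat.lt_two_pow_self
  have h2 : 2 ^ d ≤ (n + 2) ^ d := Nat.pow_le_pow_left (by omega) d
  calc (d + 4) * (n ^ 2 + 1) ≤ (2 ^ d * 4) * (n ^ 2 + 1) := Nat.mul_le_mul_right _ (by omega)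
    _ = 2 ^ d * (4 * (n ^ 2 + 1)) := by ring
    _ ≤ (n + 2) ^ d * (n + 2) ^ 4 := Nat.mul_le_mul h2 (by ring_nf; nlinarith)
    _ = (n + 2) ^ (d + 4) := by ring

section

variable {Ob : Type u} {D : Type v} [LinearOrder D] {ops : Ops Ob D} {n : ℕ}

theorem performs_quadtreeProgram {c : ℕ} (hc : 1000000 ≤ c) {x : Fin n → Ob}
    {δ : Cluster n → Cluster n → D} (hδ : ComputedFromSubclusters ops x δ) :
    Performs quadtreeProgram ops x δ ((n + 2) ^ c) (c * (n ^ 2 + 1)) (c * (n ^ 2 + 1)) := by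
  have hS : 1000000 * (n ^ 2 + 1) ≤ c * (n ^ 2 + 1) := Nat.mul_le_mul_right _ hc
  have hW := mul_sq_succ_le_pow (c := c) (by omega) n
  generalize (n + 2) ^ c = W at hW
  generalize c * (n ^ 2 + 1) = S at hS hW
  suffices main : Runs ops W S quadtreeProgram (1000000 * (n ^ 2 + 1)) (initState x) fun σ =>
      IsAgglomeration δ fun k => (σ.mem (2 * k), σ.mem (2 * k + 1)) by
    obtain ⟨σ, t, h1, h2, h3⟩ := main
    exact ⟨σ, t, h1, h2.trans hS, by nlinarith [Nat.sub_le n 1], h3⟩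
  have hnS : 8 * n ≤ S := by nlinarith
  by_cases hn1 : 1 < n
  swap
  · refine Runs.mono (T := 3 + 1) (.ite (by simp [initState]; omega) (fun h => ?_)
      fun h => Runs.of_wp_le (by decide) ?_) (by omega) fun _ => id
    · simp [initState] at h; omega
    · intro k hk; omega
  obtain ⟨σ₀, hσ₀⟩ : ∃ σ₀ : State Ob D, σ₀ = initState x := ⟨_, rfl⟩
  rw [← hσ₀]
  have hr : ∀ r, r ≠ 0 → σ₀.reg r = 0 := fun r h => by simp [hσ₀, initState, h]
  have hr0 : σ₀.reg 0 = n := by simp [hσ₀, initState]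
  have hobj : ∀ i (h : i < n), σ₀.obj i = some (x ⟨i, h⟩) := fun i h => by
    simp [hσ₀, initState, h]
  have hmem : ∀ i, σ₀.mem i = 0 := fun i => by simp [hσ₀, initState]
  clear hσ₀
  obtain ⟨σ₁, t₁, hex, ht₁, e1, e2, e3, H, hH, hnH, hHn, q1, q2, q4⟩ :=
    runs_findSize (ops := ops) (S := S) hr0 hn1 (by omega : 8 * n ≤ W)
  refine Runs.mono (T := 3 + (100 * n + ((2 ^ H + n - 2 ^ H) * (5 + 2000 * 2 ^ H) + 5 +
    ((n - 1 - 0) * (5 + 5000 * 2 ^ H) + 5)))) (.ite (by simp [hr0]; omega)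
      (fun _ => .seq ⟨σ₁, t₁, hex, ht₁, ?_⟩) fun h => ?_) ?_ fun _ => id
  · obtain ⟨M, hMH⟩ : ∃ M, M = 2 * 2 ^ H := ⟨_, rfl⟩
    have hSM : (M + 4) * M ≤ S := by
      have : (M + 4) * M ≤ (8 * n) * (4 * n) := Nat.mul_le_mul (by omega) (by omega)
      nlinarith
    let cl : ℕ → Cluster n := fun y => .leaf ⟨(y - 2 ^ H) % n, Nat.mod_lt _ (by omega)⟩
    have hcl : ∀ i (h : i < n), cl (2 ^ H + i) = .leaf ⟨i, h⟩ := fun i h => by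
      simp [cl, Nat.mod_eq_of_lt h]
    let dd : ℕ → ℕ → D := fun y z => δ (cl y) (cl z)
    have hob : ∀ y z, 2 ^ H ≤ y → y < 2 ^ H + n → 2 ^ H ≤ z → z < 2 ^ H + n → y ≠ z →
        ∃ o o', σ₀.obj (y - 2 ^ H) = some o ∧ σ₀.obj (z - 2 ^ H) = some o' ∧
          dd y z = ops.dist o o' := fun y z h1 h2 h3 h4 hyz => by
      obtain ⟨i, rfl⟩ := Nat.exists_eq_add_of_le h1
      obtain ⟨j, rfl⟩ := Nat.exists_eq_add_of_le h3
      refine ⟨x ⟨i, by omega⟩, x ⟨j, by omega⟩, ?_, ?_, ?_⟩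
      · rw [Nat.add_sub_cancel_left, hobj]
      · rw [Nat.add_sub_cancel_left, hobj]
      · simp only [dd, hcl i (by omega), hcl j (by omega)]
        exact hδ.base _ _ fun e => hyz (by rw [Fin.mk.injEq] at e; rw [e])
    have inv : InsertInv n H M σ₀.obj dd (2 ^ H) σ₁ := by
      refine ⟨⟨by rw [e1 0 (by omega) (by omega) (by omega), hr0], q1, by rw [q2, hMH], by simp, ?_,
        ?_⟩, by rw [e1 3 (by omega) (by omega) (by omega), hr _ (by omega)], q4, e3, by simp⟩
      · intro h r s _ _ _
        -- The zeroed memory is a correct tree for the empty set of slots.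
        exact .inl ⟨by rw [e2, hmem], by simp [Below]⟩
      · intro y _ _
        rw [e2, hmem]
        simp
    refine .seq ((Runs.while_count (InsertInv n H M σ₀.obj dd) (C := 2000 * 2 ^ H)
      (Q := InsertInv n H M σ₀.obj dd (2 ^ H + n)) (by omega) ?_ ?_ inv).mono le_rfl ?_)
    · intro a τ ha ha' hτ
      have h0 := hτ.1.1
      have h1 := hτ.1.2.1
      have h4 := hτ.2.2.1
      exact ⟨by simp; omega, by simp; omega, runs_insertSlot hMH hH hnH hSM hW ha ha' hob hτ⟩
    · intro τ hτ
      have h0 := hτ.1.1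
      have h1 := hτ.1.2.1
      have h4 := hτ.2.2.1
      exact ⟨by simp; omega, by simp; omega, hτ⟩
    · rintro τ ⟨htree, h3, -, -, hrow⟩
      have inv' : MergeInv n H M δ 0 τ := by
        refine ⟨_, fun y => y - 2 ^ H, cl, htree, h3, subset_rfl, ?_,
          Slots.init _ _ (by simp) hcl, fun i hi => by omega⟩
        intro y hy
        exact ⟨(hrow y hy).1, by simp [(hrow y hy).2, cl, Cluster.members]⟩
      refine Runs.while_count (MergeInv n H M δ) (C := 5000 * 2 ^ H) (Nat.zero_le _) ?_ ?_ inv'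
      · intro k τ _ hk hτ
        obtain ⟨live, lab, cl, ⟨h0, -⟩, h3, -⟩ := id hτ
        exact ⟨by simp; omega, by simp; omega, runs_mergeStep hδ hMH hH hnH hSM hW (by omega) hτ⟩
      · rintro τ ⟨live, lab, cl, ⟨h0, -⟩, h3, -, -, -, hp⟩
        exact ⟨by simp; omega, by simp; omega, hp.isAgglomeration⟩
  · simp [hr0] at h; omega
  · have h1 : (2 ^ H + n - 2 ^ H) * (5 + 2000 * 2 ^ H) ≤ n * (5000 * n) :=
      Nat.mul_le_mul (by omega) (by omega)
    have h2 : (n - 1 - 0) * (5 + 5000 * 2 ^ H) ≤ n * (15000 * n) :=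
      Nat.mul_le_mul (by omega) (by omega)
    nlinarith

end

end Agglomerative
-- The theorem
open Agglomerative in
theorem mainTheorem3 :
    -- cluster distances computable in constant time from the distances between subclusters
    (∃ (P : Cmd) (c : ℕ), ∀ (Ob : Type u) (D : Type v) [LinearOrder D] (ops : Ops Ob D) (n : ℕ)
        (x : Fin n → Ob) (δ : Cluster n → Cluster n → D), ComputedFromSubclusters ops x δ →
        Performs P ops x δ ((n + 2) ^ c) (c * (n ^ 2 + 1)) (c * (n ^ 2 + 1))) ∧
    -- clusters represented by objects
    (∃ (P : Cmd) (c : ℕ),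
      (∀ (Ob : Type u) (D : Type v) [LinearOrder D] (ops : Ops Ob D) (n : ℕ) (x : Fin n → Ob),
        Performs P ops x (repDist ops x)
          ((n + 2) ^ c) (c * (n + 1)) (c * (n ^ 2 * Nat.log 2 n ^ 2 + 1))) ∧
      (∀ (E : Type w) [NormedAddCommGroup E] [InnerProductSpace ℝ E] (n : ℕ) (p : Fin n → E),
        (∀ ops : Ops E ℝ, ops.dist = dist → ops.join = midpoint ℝ →
          Performs P ops p (medianDist p)
            ((n + 2) ^ c) (c * (n + 1)) (c * (n ^ 2 * Nat.log 2 n ^ 2 + 1))) ∧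
        (∀ ops : Ops (E × ℕ) ℝ, (ops.dist = fun a b => dist a.1 b.1) → ops.join = weightedJoin →
          Performs P ops (fun i => (p i, 1)) (centroidDist p)
            ((n + 2) ^ c) (c * (n + 1)) (c * (n ^ 2 * Nat.log 2 n ^ 2 + 1))) ∧
        (∀ ops : Ops (E × ℕ) ℝ, ops.dist = wardOp → ops.join = weightedJoin →
          Performs P ops (fun i => (p i, 1)) (wardDist p)
            ((n + 2) ^ c) (c * (n + 1)) (c * (n ^ 2 * Nat.log 2 n ^ 2 + 1))))) := by
  -- The constant is made opaque, so that the power `(n + 2) ^ c` is never expanded.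
  obtain ⟨c, hc⟩ : ∃ c, 1000000 ≤ c := ⟨_, le_rfl⟩
  refine ⟨⟨quadtreeProgram, c, fun Ob D _ ops n x δ hδ => performs_quadtreeProgram hc hδ⟩,
    congaProgram, c, fun Ob D _ ops n x => performs_congaProgram hc x, fun E _ _ n p =>
    ⟨fun ops hd hj => ?_, fun ops hd hj => ?_, fun ops hd hj => ?_⟩⟩
  · refine (performs_congaProgram (ops := ops) hc p).congr fun A B _ _ _ => ?_
    rw [repDist, hd, hj, medianDist]
  · refine (performs_congaProgram (ops := ops) hc fun i => (p i, 1)).congr fun A B hA hB _ => ?_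
    rw [repDist, hd, hj, hA.rep_weightedJoin, hB.rep_weightedJoin, centroidDist]
  · refine (performs_congaProgram (ops := ops) hc fun i => (p i, 1)).congr fun A B hA hB h => ?_
    rw [repDist, hd, hj, hA.rep_weightedJoin, hB.rep_weightedJoin, wardDist_eq p h]
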